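/- **Theorem 5.2 (Three Balls Inequality, hexagonal type).** Let $\mathcal L=\{\sum_{j=1}^d n_j\mathbf v_j: n\in\mathbb Z^d\}$ be the lattice generated by a basis $\mathbf v_1,\dots,\mathbf v_d$ of $\mathbb R^d$, let $p_1,p_2\in\mathbb R^d$ with $p_2-p_1\notin\mathcal L$, and let $\mathbf e_1,\dots,\mathbf e_k\in\mathcal L$ be distinct. For $h>0$ let $h\Gamma$ be the graph with vertex set $h\mathcal V=h\mathcal V_1\cup h\mathcal V_2$, $h\mathcal V_j=hp_j+h\mathcal L$, in which the neighbours of $x\in h\mathcal V_1$ are the points $x+h(p_2-p_1+\mathbf e_m)$ and the neighbours of $x\in h\mathcal V_2$ are the points $x-h(p_2-p_1+\mathbf e_m)$, $m=1,\dots,k$; assume that this graph is connected (a "periodic graph of hexagonal type", e.g. the honeycomb lattice). For $V:h\mathcal V\to\mathbb R$ put $$H_hu(x)=h^{-2}\sum_{y\sim x}\bigl(u(y)-u(x)\bigr)+V(x)u(x),\qquad x\in h\mathcal V,\ u:h\mathcal V\to\mathbb R .$$ Let $G=\sum_{1\le m<n\le k}(\mathbf e_m-\mathbf e_n)(\mathbf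 e_m-\mathbf e_n)^{T}$, which is positive definite, and let $|x|_\Gamma=\sqrt{x^{T}G^{-1}x}$, $B_r=\{x\in\mathbb R^d:|x|_\Gamma\le r\}$ and $\|u\|_{\ell^2(B_r)}^2=\sum_{x\in h\mathcal V\cap B_r}|u(x)|^2$. Let $M\in\mathbb R$. 1. There exist constants $h_0,\delta_0\in(0,1)$, $c_1,c_2>0$, $\tau_0>1$ and $C>1$, depending only on $\Gamma$ and $M$, such that for all $h\in(0,h_0)$, all $\tau\in(\tau_0,\delta_0h^{-1})$, all $V:h\mathcal V\to\mathbb R$ with $|V|\le M$ and all $u:h\mathcal V\to\mathbb R$ with $H_hu=0$ on $h\mathcal V\cap B_4$, $$\|u\|_{\ell^2(B_1)}\le C\left(e^{c_1\tau}\|u\|_{\ell^2(B_{1/2})}+e^{-c_2\tau}\|u\|_{\ell^2(B_2)}\right).$$ 2. There exist constants $\alpha\in(0,1)$, $c_0>0$, $h_0\in(0,1)$ and $D>1$, depending only on $\Gamma$ and $M$, such that for all $h\in(0,h_0)$, all $V:h\mathcal V\to\mathbb R$ with $|V|\le M$ and all $u:h\mathcal V\to\mathbb R$ with $H_hu=0$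 on $h\mathcal V\cap B_4$, $$\|u\|_{\ell^2(B_1)}\le D\left(\|u\|_{\ell^2(B_{1/2})}^{\alpha}\|u\|_{\ell^2(B_2)}^{1-\alpha}+e^{-c_0h^{-1}}\|u\|_{\ell^2(B_2)}\right).$$ -/

import Mathlib

/-- The data of a graph of hexagonal type, apart from connectedness: a basis of `ℝ^d` generating the
lattice, two points `p₁`, `p₂` which are not congruent modulo the lattice, and `k` distinct lattice
vectors `e 0, …, e (k - 1)` describing the edges. -/
structure HexagonalFrame (d : ℕ) where
  basis : Module.Basis (Fin d) ℝ (Fin d → ℝ)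
  p₁ : Fin d → ℝ
  p₂ : Fin d → ℝ
  sub_notMem : p₂ - p₁ ∉ Submodule.span ℤ (Set.range basis)
  k : ℕ
  e : Fin k → Fin d → ℝ
  e_mem : ∀ m, e m ∈ Submodule.span ℤ (Set.range basis)
  e_injective : Function.Injective e

namespace HexagonalFrame

variable {d : ℕ} (Γ : HexagonalFrame d)

/-- The lattice `ℒ`, i.e. all integer combinations of the basis vectors. -/
def lattice : Submodule ℤ (Fin d → ℝ) := Submodule.span ℤ (Set.range Γ.basis)

/-- The first layer `h 𝒱₁ = h p₁ + h ℒ` of vertices. -/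
def layer₁ (h : ℝ) : Set (Fin d → ℝ) := {x | ∃ l ∈ Γ.lattice, x = h • Γ.p₁ + h • l}

/-- The second layer `h 𝒱₂ = h p₂ + h ℒ` of vertices. -/
def layer₂ (h : ℝ) : Set (Fin d → ℝ) := {x | ∃ l ∈ Γ.lattice, x = h • Γ.p₂ + h • l}

/-- The vertices of `h Γ`, as a type. -/
abbrev Vertex (h : ℝ) : Type := ↥(Γ.layer₁ h ∪ Γ.layer₂ h)

/-- The graph `h Γ` with mesh size `h > 0`: a vertex `x` of the first layer is joined exactly to the
points `x + h (p₂ - p₁ + e m)`, a vertex `x` of the second layer exactly to the points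
`x - h (p₂ - p₁ + e m)`. -/
def graph (h : ℝ) (hh : 0 < h) : SimpleGraph (Γ.Vertex h) where
  Adj x y :=
    (x.1 ∈ Γ.layer₁ h ∧ ∃ m, y.1 = x.1 + h • (Γ.p₂ - Γ.p₁ + Γ.e m)) ∨
    (x.1 ∈ Γ.layer₂ h ∧ ∃ m, y.1 = x.1 - h • (Γ.p₂ - Γ.p₁ + Γ.e m))
  symm := by
    refine ⟨?_⟩
    rintro x y (⟨⟨l, hl, hx⟩, m, hy⟩ | ⟨⟨l, hl, hx⟩, m, hy⟩)
    · refine Or.inr ⟨⟨l + Γ.e m, add_mem hl (Γ.e_mem m), ?_⟩, m, ?_⟩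
      · rw [hy, hx]; module
      · rw [hy]; module
    · refine Or.inl ⟨⟨l - Γ.e m, sub_mem hl (Γ.e_mem m), ?_⟩, m, ?_⟩
      · rw [hy, hx]; module
      · rw [hy]; module
  loopless := by
    have key : ∀ m, Γ.p₂ - Γ.p₁ + Γ.e m ≠ 0 := fun m h0 =>
      Γ.sub_notMem (by rw [eq_neg_of_add_eq_zero_left h0]; exact neg_mem (Γ.e_mem m))
    refine ⟨?_⟩
    rintro x (⟨-, m, hx⟩ | ⟨-, m, hx⟩)
    · have h0 := left_eq_add.mp hx
      exact key m ((smul_eq_zero.mp h0).resolve_left hh.ne')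
    · have h0 := sub_eq_self.mp hx.symm
      exact key m ((smul_eq_zero.mp h0).resolve_left hh.ne')

/-- The graph Laplacian `Δ u (x) = ∑_{y ∼ x} (u y - u x)`; every vertex has `k` neighbours. -/
noncomputable def laplacian (h : ℝ) (hh : 0 < h) (u : Γ.Vertex h → ℝ) (x : Γ.Vertex h) : ℝ :=
  ∑ᶠ y ∈ (Γ.graph h hh).neighborSet x, (u y - u x)

/-- The Schrödinger operator `H_h u = h⁻² Δ u + V u`. -/
noncomputable def schrodinger (h : ℝ) (hh : 0 < h) (V u : Γ.Vertex h → ℝ) (x : Γ.Vertex h) : ℝ :=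
  (h ^ 2)⁻¹ * Γ.laplacian h hh u x + V x * u x

end HexagonalFrame

/-- The norm `|x| = √(xᵀ (Eᵀ E)⁻¹ x)` attached to a one-point periodic graph with edge vectors
`± η j`, where `E` is the matrix with rows `η j`. -/
noncomputable def onePointNorm {d : ℕ} {ι : Type} [Fintype ι] (η : ι → Fin d → ℝ)
    (x : Fin d → ℝ) : ℝ :=
  √(x ⬝ᵥ ((Matrix.of η).transpose * Matrix.of η)⁻¹.mulVec x)

namespace HexagonalFrame

variable {d : ℕ} (Γ : HexagonalFrame d)

/-- The edge vectors `e m - e n`, `m < n`, of the one-point periodic graph on the lattice that is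
hidden in a graph of hexagonal type (two vertices of one layer are joined when they have a common
neighbour). -/
def hiddenEdge (q : {q : Fin Γ.k × Fin Γ.k // q.1 < q.2}) : Fin d → ℝ := Γ.e q.1.1 - Γ.e q.1.2

/-- The closed ball `B_r ⊆ ℝ^d` for the norm of the hidden one-point periodic graph. -/
def ball (r : ℝ) : Set (Fin d → ℝ) := {x | onePointNorm Γ.hiddenEdge x ≤ r}

/-- The norm `‖u‖_{ℓ²(B_r)}`, summing over the (finitely many) vertices of `h Γ` lying in `B_r`. -/
noncomputable def l2Norm (h : ℝ) (u : Γ.Vertex h → ℝ) (r : ℝ) : ℝ :=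
  √(∑' x : {x : Γ.Vertex h // x.1 ∈ Γ.ball r}, u x.1 ^ 2)

end HexagonalFrame

/-- A periodic graph of hexagonal type in `ℝ^d`. Connectedness does not depend on the mesh size, so
it is required for mesh size `1`. -/
structure HexagonalGraph (d : ℕ) extends HexagonalFrame d where
  connected : (toHexagonalFrame.graph 1 one_pos).Connected

/-! The proof eliminates one layer at a time and then applies a discrete Carleman estimate. Let `u`
and `w` be the values of the solution on the two layers. A step from `l` to `l + e m - e n` inside
the first layer passes through a vertex of the second. Summing the two equations along such paths
shows that the Laplacian of the one-point graph with edges `e m - e n` sends `u` to `h²` times a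
bounded combination of neighbouring values of `u` and `w` (`abs_lap_le_neighborBound`). No gradient
appears, so each layer satisfies a Schrödinger-type inequality on an ordinary lattice graph, coupled
to the other layer only at order zero.

On such a graph the Laplacian is conjugated with `exp (τ g)`, where `g` is a Gaussian, and split
into a symmetric part `S` and an antisymmetric part `A`. The cross term `2⟨Sw, Aw⟩` is a potential
minus a quadratic form in differences of `w` (`tsum_commCoeff_eq`). The form is absorbed by pairing
`S w` with `ψ w`, `ψ` a multiple of `τ h² g`, and completing the square (`tsum_sq_ge`). In the norm
given by `G⁻¹` the edges form a tight frame, so the leading coefficient of the resulting potential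
is computable exactly: it is a positive multiple of `τ³ h⁴` on the annulus between radii 1/4 and 2.
Pairing each edge with its reverse cancels the terms of order `τ h²`, which would otherwise
dominate. The Taylor errors are relatively small when `τ` is large and `τ h` is small; this is the
origin of the range of `τ` (`exists_carleman`).

The estimate is applied to a cutoff of the solution. The cutoff produces errors on an inner and an
outer shell, where a Caccioppoli inequality replaces gradients by masses (`exists_layer_estimate`).
Since `τ h` is bounded, the weight is comparable at adjacent vertices, so after adding the estimates
of both layers the factor `τ³` absorbs the coupling (`exists_two_layer_estimate`). The weight is at
most 1 near the centre and strictly larger on the unit ball than on the outer shell, which gives the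
growing and the decaying exponential.

The second assertion follows by choosing the `τ` that balances the two exponentials, capped at a
multiple of `h⁻¹`; the cap accounts for the additional term (`le_rpow_mul_rpow_add_of_forall_exp`).
-/

namespace DiscreteCarleman

open Finset

/-! ### Commutator identities for the conjugated Laplacian on an abelian group -/

section Identities

variable {Λ ι : Type*} [AddCommGroup Λ]

/-- The coefficients of the commutator of the symmetric and the antisymmetric part. -/
noncomputable def commCoeff (v : ι → Λ) (φ : Λ → ℝ) (i j : ι) (x : Λ) : ℝ :=
  Real.cosh (φ (x + v i + v j) - φ x) *
    Real.sinh (φ (x + v i + v j) + φ x - φ (x + v i) - φ (x + v j))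

theorem commCoeff_comm (v : ι → Λ) (φ : Λ → ℝ) (i j : ι) (x : Λ) :
    commCoeff v φ i j x = commCoeff v φ j i x := by
  unfold commCoeff
  rw [add_right_comm x (v i) (v j)]
  congr 2; ring

variable [Fintype ι]

/-- All sums below involve a finitely supported `w` and finitely many translates of it, so this
settles every question of convergence. -/
theorem summable_of_stencil {v : ι → Λ} {w f : Λ → ℝ} (hw : w.support.Finite)
    (hf : ∀ x, w x = 0 → (∀ i, w (x + v i) = 0) → f x = 0) : Summable f := by
  apply summable_of_hasFiniteSupport
  have hs : (w.support ∪ ⋃ i, (fun x => x + v i) ⁻¹' w.support).Finite :=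
    hw.union (Set.finite_iUnion fun i => hw.preimage (add_left_injective (v i)).injOn)
  refine hs.subset fun x hx => ?_
  by_contra hcon
  simp only [Set.mem_union, Function.mem_support, Set.mem_iUnion, Set.mem_preimage, not_or,
    not_exists, not_not] at hcon
  exact hx (hf x hcon.1 hcon.2)

theorem tsum_shift (a : Λ) (f : Λ → ℝ) : ∑' x, f (x + a) = ∑' x, f x :=
  (Equiv.addRight a).tsum_eq f

/-- The symmetric part of the conjugated graph Laplacian. -/
noncomputable def symPart (v : ι → Λ) (φ w : Λ → ℝ) (x : Λ) : ℝ :=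
  ∑ i, (Real.cosh (φ (x + v i) - φ x) * w (x + v i) - w x)

/-- The antisymmetric part of the conjugated graph Laplacian. -/
noncomputable def antiPart (v : ι → Λ) (φ w : Λ → ℝ) (x : Λ) : ℝ :=
  -∑ i, Real.sinh (φ (x + v i) - φ x) * w (x + v i)

theorem symPart_add_antiPart (v : ι → Λ) (φ w : Λ → ℝ) (x : Λ) :
    symPart v φ w x + antiPart v φ w x =
      ∑ i, (Real.exp (φ x - φ (x + v i)) * w (x + v i) - w x) := by
  rw [symPart, antiPart, ← sub_eq_add_neg, ← sum_sub_distrib]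
  refine sum_congr rfl fun i _ => ?_
  have := Real.cosh_sub_sinh (φ (x + v i) - φ x)
  rw [neg_sub] at this
  rw [← this]; ring

/-- The potential arising from the commutator. -/
noncomputable def commPotential (v : ι → Λ) (φ : Λ → ℝ) (y : Λ) : ℝ :=
  ∑ i, ∑ j, Real.cosh (φ (y + v j) - φ (y + v i)) *
    Real.sinh (φ (y + v i) + φ (y + v j) - φ y - φ (y + v i + v j))

/-- The potential arising from pairing the symmetric part with a multiple `ψ` of the function. -/
noncomputable def energyPotential (v : ι → Λ) (φ ψ : Λ → ℝ) (y : Λ) : ℝ :=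
  ∑ i, (1 / 2 * (ψ y + ψ (y + v i)) * Real.cosh (φ (y + v i) - φ y) - ψ y)

variable {v : ι → Λ} {σ : Equiv.Perm ι} {w : Λ → ℝ}

/-- Reversing an edge changes the sign of the `sinh`, so the sum is its own negative. Hence the
diagonal part `-w x` of `symPart` does not contribute to the commutator. -/
theorem sum_sinh_pairing_eq_zero (hσ : ∀ i, v (σ i) = -v i) (φ w : Λ → ℝ) :
    ∑ j, ∑' x, Real.sinh (φ (x + v j) - φ x) * (w x * w (x + v j)) = 0 := by
  have h1 : ∀ j, ∑' x, Real.sinh (φ (x + v (σ j)) - φ x) * (w x * w (x + v (σ j))) =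
      -∑' x, Real.sinh (φ (x + v j) - φ x) * (w x * w (x + v j)) := by
    intro j
    rw [← tsum_shift (v j), ← tsum_neg]
    refine tsum_congr fun x => ?_
    rw [hσ, add_neg_cancel_right, ← neg_sub (φ (x + v j)) (φ x), Real.sinh_neg]
    ring
  have h2 := Equiv.sum_comp σ
    (fun j => ∑' x, Real.sinh (φ (x + v j) - φ x) * (w x * w (x + v j)))
  simp only [h1, sum_neg_distrib] at h2
  linarith

theorem two_mul_symPart_mul_antiPart (φ w : Λ → ℝ) (x : Λ) :
    2 * (symPart v φ w x * antiPart v φ w x) =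
      2 * (Fintype.card ι) * ∑ j, Real.sinh (φ (x + v j) - φ x) * (w x * w (x + v j)) -
      ∑ i, ∑ j, Real.sinh (φ (x + v i) + φ (x + v j) - 2 * φ x) *
        (w (x + v i) * w (x + v j)) := by
  have h1 : ∑ i, ∑ j, Real.sinh (φ (x + v i) + φ (x + v j) - 2 * φ x) *
        (w (x + v i) * w (x + v j)) =
      2 * ((∑ i, Real.cosh (φ (x + v i) - φ x) * w (x + v i)) *
        ∑ j, Real.sinh (φ (x + v j) - φ x) * w (x + v j)) := by
    have h3 : ∀ i j, Real.sinh (φ (x + v i) + φ (x + v j) - 2 * φ x) *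
        (w (x + v i) * w (x + v j)) =
        (Real.cosh (φ (x + v i) - φ x) * w (x + v i)) *
          (Real.sinh (φ (x + v j) - φ x) * w (x + v j)) +
        (Real.sinh (φ (x + v i) - φ x) * w (x + v i)) *
          (Real.cosh (φ (x + v j) - φ x) * w (x + v j)) := by
      intro i j
      rw [show φ (x + v i) + φ (x + v j) - 2 * φ x =
        (φ (x + v i) - φ x) + (φ (x + v j) - φ x) by ring, Real.sinh_add]
      ring
    simp only [h3, sum_add_distrib]
    rw [← sum_mul_sum, ← sum_mul_sum]
    ring
  have h2 : ∑ j, Real.sinh (φ (x + v j) - φ x) * (w x * w (x + v j)) =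
      w x * ∑ j, Real.sinh (φ (x + v j) - φ x) * w (x + v j) := by
    rw [mul_sum]; exact sum_congr rfl fun j _ => by ring
  rw [h1, h2, symPart, antiPart, sum_sub_distrib]
  simp only [sum_const, card_univ, nsmul_eq_mul]
  ring

/-- The pointwise product contains a `sinh` centred at `x`. Translating by `v i + v j` and reversing
both edges gives the same sum centred at `x + v i + v j`. Averaging the two and using the addition
formulas isolates the mixed second difference of `φ` inside one `sinh`. -/
theorem tsum_two_mul_symPart_mul_antiPart (hσ : ∀ i, v (σ i) = -v i) (hw : w.support.Finite)
    (φ : Λ → ℝ) :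
    ∑' x, 2 * (symPart v φ w x * antiPart v φ w x) =
      ∑ i, ∑ j, ∑' x, commCoeff v φ i j x * (w (x + v i) * w (x + v j)) := by
  have hS : ∀ (f : Λ → ℝ) i j, Summable fun x => f x * (w (x + v i) * w (x + v j)) :=
    fun f i j => summable_of_stencil (v := v) hw fun x _ h => by simp [h]
  have hS' : ∀ (f : Λ → ℝ) j, Summable fun x => f x * (w x * w (x + v j)) :=
    fun f j => summable_of_stencil (v := v) hw fun x h _ => by simp [h]
  set F : ι → ι → ℝ := fun i j => ∑' x, Real.sinh (φ (x + v i) + φ (x + v j) - 2 * φ x) *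
        (w (x + v i) * w (x + v j)) with hF
  set F' : ι → ι → ℝ := fun i j => ∑' x,
      Real.sinh (φ (x + v i) + φ (x + v j) - 2 * φ (x + v i + v j)) *
        (w (x + v i) * w (x + v j)) with hF'
  have h1 : ∑' x, 2 * (symPart v φ w x * antiPart v φ w x) = -∑ i, ∑ j, F i j := by
    simp only [two_mul_symPart_mul_antiPart]
    rw [Summable.tsum_sub, tsum_mul_left, Summable.tsum_finsetSum fun j _ => hS' _ j,
      sum_sinh_pairing_eq_zero hσ,
      Summable.tsum_finsetSum fun i _ => summable_sum fun j _ => hS _ i j]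
    · simp only [Summable.tsum_finsetSum fun j _ => hS _ _ j]
      simp [hF]
    · exact (summable_sum fun j _ => hS' _ j).mul_left _
    · exact summable_sum fun i _ => summable_sum fun j _ => hS _ i j
  have h2 : ∑ i, ∑ j, F i j = ∑ i, ∑ j, F' i j := by
    have h3 : ∀ i j, F (σ j) (σ i) = F' i j := by
      intro i j
      simp only [hF, hF']
      rw [← tsum_shift (v i + v j)]
      refine tsum_congr fun x => ?_
      rw [hσ, hσ, show x + (v i + v j) + -v j = x + v i by abel,
        show x + (v i + v j) + -v i = x + v j by abel, ← add_assoc]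
    calc ∑ i, ∑ j, F i j = ∑ j, ∑ i, F j i := rfl
      _ = ∑ j, ∑ i, F (σ j) (σ i) := by
        rw [← Equiv.sum_comp σ]
        exact sum_congr rfl fun j _ => (Equiv.sum_comp σ _).symm
      _ = ∑ i, ∑ j, F (σ j) (σ i) := sum_comm
      _ = _ := by simp only [h3]
  have h4 : ∀ i j, ∑' x, commCoeff v φ i j x * (w (x + v i) * w (x + v j)) =
      -(1 / 2 * F i j) - 1 / 2 * F' i j := by
    intro i j
    rw [← neg_mul, hF, hF', ← tsum_mul_left, ← tsum_mul_left, ← Summable.tsum_sub]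
    · refine tsum_congr fun x => ?_
      have e1 := Real.sinh_add (φ (x + v i + v j) - φ x)
        (φ (x + v i + v j) + φ x - φ (x + v i) - φ (x + v j))
      have e2 := Real.sinh_sub (φ (x + v i + v j) - φ x)
        (φ (x + v i + v j) + φ x - φ (x + v i) - φ (x + v j))
      rw [show φ (x + v i + v j) - φ x + (φ (x + v i + v j) + φ x - φ (x + v i) - φ (x + v j)) =
        -(φ (x + v i) + φ (x + v j) - 2 * φ (x + v i + v j)) by ring, Real.sinh_neg] at e1
      rw [show φ (x + v i + v j) - φ x - (φ (x + v i + v j) + φ x - φ (x + v i) - φ (x + v j)) =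
        φ (x + v i) + φ (x + v j) - 2 * φ x by ring] at e2
      unfold commCoeff
      linear_combination (-(1 / 2) * e1 + 1 / 2 * e2) * (w (x + v i) * w (x + v j))
    · exact (hS _ i j).mul_left _
    · exact (hS _ i j).mul_left _
  simp only [h4, sum_sub_distrib, sum_neg_distrib, ← mul_sum]
  rw [h1, ← h2]; ring

/-- Polarization `2ab = a² + b² - (a - b)²`; the squares are translated back to the base point,
where their coefficients add up to the potential. -/
theorem tsum_commCoeff_eq (hσ : ∀ i, v (σ i) = -v i) (hw : w.support.Finite) (φ : Λ → ℝ) :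
    ∑ i, ∑ j, ∑' x, commCoeff v φ i j x * (w (x + v i) * w (x + v j)) =
      ∑' y, w y ^ 2 * commPotential v φ y -
        1 / 2 * ∑' x, ∑ i, ∑ j, commCoeff v φ i j x * (w (x + v i) - w (x + v j)) ^ 2 := by
  have hS : ∀ (f : Λ → ℝ) i, Summable fun x => f x * w (x + v i) ^ 2 :=
    fun f i => summable_of_stencil (v := v) hw fun x _ h => by simp [h]
  have hT : ∀ (f : Λ → ℝ) i j, Summable fun x => f x * (w (x + v i) - w (x + v j)) ^ 2 :=
    fun f i j => summable_of_stencil (v := v) hw fun x _ h => by simp [h]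
  have h0 : ∀ f : Λ → ℝ, Summable fun x => w x ^ 2 * f x :=
    fun f => summable_of_stencil (v := v) hw fun x h _ => by simp [h]
  set G : ι → ι → ℝ := fun i j => ∑' x, commCoeff v φ i j x * w (x + v i) ^ 2 with hG
  have hpot : ∑' y, w y ^ 2 * commPotential v φ y = ∑ i, ∑ j, G i j := by
    have h1 : ∀ i j, G (σ i) j = ∑' y, w y ^ 2 * (Real.cosh (φ (y + v j) - φ (y + v i)) *
        Real.sinh (φ (y + v i) + φ (y + v j) - φ y - φ (y + v i + v j))) := by
      intro i j
      simp only [hG]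
      rw [← tsum_shift (v i)]
      refine tsum_congr fun x => ?_
      rw [hσ, add_neg_cancel_right]
      unfold commCoeff
      rw [hσ, add_neg_cancel_right, mul_comm]
      congr 3
      ring
    rw [← Equiv.sum_comp σ]
    simp only [h1, commPotential, mul_sum]
    rw [Summable.tsum_finsetSum fun i _ => summable_sum fun j _ => h0 _]
    exact sum_congr rfl fun i _ => Summable.tsum_finsetSum fun j _ => h0 _
  have h2 : ∀ i j, ∑' x, commCoeff v φ i j x * (w (x + v i) * w (x + v j)) =
      1 / 2 * G i j + 1 / 2 * G j i -
        1 / 2 * ∑' x, commCoeff v φ i j x * (w (x + v i) - w (x + v j)) ^ 2 := by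
    intro i j
    have : G j i = ∑' x, commCoeff v φ i j x * w (x + v j) ^ 2 :=
      tsum_congr fun x => by rw [commCoeff_comm]
    rw [this, hG, ← tsum_mul_left, ← tsum_mul_left, ← tsum_mul_left, ← Summable.tsum_add,
      ← Summable.tsum_sub]
    · exact tsum_congr fun x => by ring
    · exact ((hS _ i).mul_left _).add ((hS _ j).mul_left _)
    · exact (hT _ i j).mul_left _
    · exact (hS _ i).mul_left _
    · exact (hS _ j).mul_left _
  rw [hpot, Summable.tsum_finsetSum fun i _ => summable_sum fun j _ => hT _ i j]
  simp only [Summable.tsum_finsetSum fun j _ => hT _ _ j, h2, sum_add_distrib, sum_sub_distrib,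
    ← mul_sum]
  rw [sum_comm (f := fun i j => G j i)]
  ring

/-- A weighted Green identity, again by polarization. Moving the square at the far end of an edge to
the base point replaces `ψ` by its value at the other end, hence the mean of `ψ` over the edge in
`energyPotential`. -/
theorem tsum_mul_symPart (hσ : ∀ i, v (σ i) = -v i) (hw : w.support.Finite) (φ ψ : Λ → ℝ) :
    ∑' x, ψ x * w x * symPart v φ w x =
      ∑' y, w y ^ 2 * energyPotential v φ ψ y -
        1 / 2 * ∑' x, ψ x * ∑ i, Real.cosh (φ (x + v i) - φ x) * (w (x + v i) - w x) ^ 2 := by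
  have hS : ∀ (f : Λ → ℝ) i, Summable fun x => f x * w (x + v i) ^ 2 :=
    fun f i => summable_of_stencil (v := v) hw fun x _ h => by simp [h]
  have h0 : ∀ f : Λ → ℝ, Summable fun x => w x ^ 2 * f x :=
    fun f => summable_of_stencil (v := v) hw fun x h _ => by simp [h]
  have hA : ∀ i, ∑' x, 1 / 2 * ψ x * Real.cosh (φ (x + v i) - φ x) * w (x + v i) ^ 2 =
      ∑' x, w x ^ 2 * (1 / 2 * ψ (x + v (σ i)) * Real.cosh (φ (x + v (σ i)) - φ x)) := by
    intro i
    rw [← tsum_shift (v i)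
      (fun x => w x ^ 2 * (1 / 2 * ψ (x + v (σ i)) * Real.cosh (φ (x + v (σ i)) - φ x)))]
    refine tsum_congr fun x => ?_
    rw [hσ, add_neg_cancel_right, ← neg_sub (φ (x + v i)) (φ x), Real.cosh_neg]
    ring
  have hB : ∑ i, ∑' x, 1 / 2 * ψ x * Real.cosh (φ (x + v i) - φ x) * w (x + v i) ^ 2 =
      ∑ i, ∑' x, w x ^ 2 * (1 / 2 * ψ (x + v i) * Real.cosh (φ (x + v i) - φ x)) := by
    simp only [hA]
    exact Equiv.sum_comp σ
      fun i => ∑' x, w x ^ 2 * (1 / 2 * ψ (x + v i) * Real.cosh (φ (x + v i) - φ x))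
  rw [← Summable.tsum_finsetSum fun i _ => hS _ i,
    ← Summable.tsum_finsetSum fun i _ => h0 _] at hB
  have s1 : Summable fun x => ∑ i, 1 / 2 * ψ x * Real.cosh (φ (x + v i) - φ x) * w (x + v i) ^ 2 :=
    summable_sum fun i _ => hS _ i
  have s2 : Summable fun x =>
      ∑ i, w x ^ 2 * (1 / 2 * ψ (x + v i) * Real.cosh (φ (x + v i) - φ x)) :=
    summable_sum fun i _ => h0 _
  have s3 : Summable fun x =>
      ψ x * ∑ i, Real.cosh (φ (x + v i) - φ x) * (w (x + v i) - w x) ^ 2 :=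
    summable_of_stencil (v := v) hw fun x h h' => by simp [h, h']
  have s4 : Summable fun x => ψ x * w x * symPart v φ w x :=
    summable_of_stencil (v := v) hw fun x h h' => by simp [h]
  rw [eq_sub_iff_add_eq, ← tsum_mul_left, ← Summable.tsum_add s4 (s3.mul_left _)]
  have e : ∀ x, ψ x * w x * symPart v φ w x +
      1 / 2 * (ψ x * ∑ i, Real.cosh (φ (x + v i) - φ x) * (w (x + v i) - w x) ^ 2) =
      w x ^ 2 * energyPotential v φ ψ x +
      (∑ i, 1 / 2 * ψ x * Real.cosh (φ (x + v i) - φ x) * w (x + v i) ^ 2 -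
        ∑ i, w x ^ 2 * (1 / 2 * ψ (x + v i) * Real.cosh (φ (x + v i) - φ x))) := by
    intro x
    simp only [symPart, energyPotential, mul_sum, ← sum_add_distrib, ← sum_sub_distrib]
    exact sum_congr rfl fun i _ => by ring
  simp only [e]
  rw [Summable.tsum_add (h0 _) (s1.sub s2), Summable.tsum_sub s1 s2, hB, sub_self, add_zero]

/-- The abstract Carleman estimate: if the gradient part of the commutator is dominated by the
energy with density `ψ`, then the conjugated Laplacian is bounded below by a potential. -/
theorem tsum_sq_ge (hσ : ∀ i, v (σ i) = -v i) (hw : w.support.Finite) (φ ψ : Λ → ℝ)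
    (hψ : ∀ x, ∑ i, ∑ j, commCoeff v φ i j x * (w (x + v i) - w (x + v j)) ^ 2 ≤
      ψ x * ∑ i, Real.cosh (φ (x + v i) - φ x) * (w (x + v i) - w x) ^ 2) :
    ∑' y, w y ^ 2 * (commPotential v φ y - energyPotential v φ ψ y - ψ y ^ 2 / 4) ≤
      ∑' x, (∑ i, (Real.exp (φ x - φ (x + v i)) * w (x + v i) - w x)) ^ 2 := by
  have h0 : ∀ f : Λ → ℝ, Summable fun x => w x ^ 2 * f x :=
    fun f => summable_of_stencil (v := v) hw fun x h _ => by simp [h]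
  have hst : ∀ {f : Λ → ℝ}, (∀ x, w x = 0 → (∀ i, w (x + v i) = 0) → f x = 0) → Summable f :=
    fun hf => summable_of_stencil (v := v) hw hf
  have s1 : Summable fun x => ∑ i, ∑ j, commCoeff v φ i j x * (w (x + v i) - w (x + v j)) ^ 2 :=
    hst fun x _ h' => by simp [h']
  have s2 : Summable fun x =>
      ψ x * ∑ i, Real.cosh (φ (x + v i) - φ x) * (w (x + v i) - w x) ^ 2 :=
    hst fun x h h' => by simp [h, h']
  have s3 : Summable fun x => 2 * (symPart v φ w x * antiPart v φ w x) :=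
    hst fun x h h' => by simp [symPart, h, h']
  have s4 : Summable fun x => ψ x * w x * symPart v φ w x :=
    hst fun x h h' => by simp [h]
  have s5 : Summable fun x => (symPart v φ w x + antiPart v φ w x) ^ 2 :=
    hst fun x h h' => by simp [symPart, antiPart, h, h']
  have e1 := tsum_two_mul_symPart_mul_antiPart hσ hw φ
  rw [tsum_commCoeff_eq hσ hw] at e1
  have e2 := tsum_mul_symPart hσ hw φ ψ
  have e3 := Summable.tsum_le_tsum hψ s1 s2
  -- `(S + A)²` is bounded below by dropping `A²` and completing the square `(S + ψ w / 2)²`.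
  have e4 : ∑' x, (2 * (symPart v φ w x * antiPart v φ w x) - ψ x * w x * symPart v φ w x -
      w x ^ 2 * (ψ x ^ 2 / 4)) ≤ ∑' x, (symPart v φ w x + antiPart v φ w x) ^ 2 := by
    refine Summable.tsum_le_tsum (fun x => ?_) ((s3.sub s4).sub (h0 _)) s5
    nlinarith [sq_nonneg (symPart v φ w x + ψ x * w x / 2), sq_nonneg (antiPart v φ w x)]
  rw [Summable.tsum_sub (s3.sub s4) (h0 _), Summable.tsum_sub s3 s4] at e4
  have e5 : ∑' y, w y ^ 2 * (commPotential v φ y - energyPotential v φ ψ y - ψ y ^ 2 / 4) =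
      ∑' y, w y ^ 2 * commPotential v φ y - ∑' y, w y ^ 2 * energyPotential v φ ψ y -
        ∑' y, w y ^ 2 * (ψ y ^ 2 / 4) := by
    rw [← Summable.tsum_sub (h0 _) (h0 _), ← Summable.tsum_sub ((h0 _).sub (h0 _)) (h0 _)]
    exact tsum_congr fun y => by ring
  simp only [← symPart_add_antiPart]
  rw [e5]
  linarith

end Identities

end DiscreteCarleman

namespace DiscreteCarleman

open Finset
open scoped ContDiff

/-! ### Taylor expansion of hyperbolic functions and of iterated differences -/

section Taylor

theorem abs_cosh_sub_le {x : ℝ} (hx : |x| ≤ 1) : |Real.cosh x - 1 - x ^ 2 / 2| ≤ |x| ^ 4 := by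
  have h1 := Real.exp_bound hx (n := 4) (by norm_num)
  have h2 := Real.exp_bound (x := -x) (by rwa [abs_neg]) (n := 4) (by norm_num)
  rw [abs_neg] at h2
  norm_num [sum_range_succ, Nat.factorial] at h1 h2
  have h3 : (0 : ℝ) ≤ |x| ^ 4 := by positivity
  rw [Real.cosh_eq]
  rw [abs_le] at *
  constructor <;> nlinarith [h1.1, h1.2, h2.1, h2.2]

theorem abs_sinh_sub_le {x : ℝ} (hx : |x| ≤ 1) : |Real.sinh x - x| ≤ |x| ^ 3 := by
  have h1 := Real.exp_bound hx (n := 3) (by norm_num)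
  have h2 := Real.exp_bound (x := -x) (by rwa [abs_neg]) (n := 3) (by norm_num)
  rw [abs_neg] at h2
  norm_num [sum_range_succ, Nat.factorial] at h1 h2
  have h3 : (0 : ℝ) ≤ |x| ^ 3 := by positivity
  rw [Real.sinh_eq]
  rw [abs_le] at *
  constructor <;> nlinarith [h1.1, h1.2, h2.1, h2.2]

theorem abs_sinh_le {x : ℝ} (hx : |x| ≤ 1) : |Real.sinh x| ≤ 2 * |x| := by
  have h1 := abs_sinh_sub_le hx
  have h2 : |x| ^ 3 ≤ |x| := by
    calc |x| ^ 3 ≤ |x| ^ 1 := pow_le_pow_of_le_one (abs_nonneg x) hx (by norm_num)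
      _ = |x| := pow_one _
  calc |Real.sinh x| = |(Real.sinh x - x) + x| := by ring_nf
    _ ≤ |Real.sinh x - x| + |x| := abs_add_le _ _
    _ ≤ _ := by linarith

/-- Expansion of `cosh D * sinh X` for small `D ≈ d` and `X ≈ x`. -/
theorem abs_cosh_mul_sinh_sub_le {C T h ε D X d x : ℝ} (hC : 1 ≤ C) (hT : 0 ≤ T) (hh : 0 ≤ h)
    (hTε : T ≤ ε) (hhε : h ≤ ε) (hε : C * ε ≤ 1) (hD : |D| ≤ C * T) (hd : |d| ≤ C * T)
    (hDd : |D - d| ≤ C * T * h) (hX : |X| ≤ C * T * h) (hXx : |X - x| ≤ C * T * h ^ 2) :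
    |Real.cosh D * Real.sinh X - X - d ^ 2 * x / 2| ≤ 8 * C ^ 5 * ε * (T ^ 3 * h) := by
  have hε0 : 0 ≤ ε := hT.trans hTε
  have hC0 : 0 ≤ C := by linarith
  have hε1 : ε ≤ 1 := by nlinarith
  have hCT : C * T ≤ 1 := (mul_le_mul_of_nonneg_left hTε hC0).trans hε
  have hD1 : |D| ≤ 1 := hD.trans hCT
  have hh1 : h ≤ 1 := hhε.trans hε1
  have hX1 : |X| ≤ 1 := hX.trans (mul_le_one₀ hCT hh hh1)
  -- The errors are the quartic remainder of `cosh`, the cubic remainder of `sinh`, and the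
  -- replacements of `D` by `d` and of `X` by `x`; each carries a factor `ε` relative to `T ^ 3 *
  -- h`.
  have e : Real.cosh D * Real.sinh X - X - d ^ 2 * x / 2 =
      (Real.cosh D - 1 - D ^ 2 / 2) * Real.sinh X + (1 + D ^ 2 / 2) * (Real.sinh X - X) +
        ((D - d) * (D + d) * X + d ^ 2 * (X - x)) / 2 := by ring
  have b1 : |(Real.cosh D - 1 - D ^ 2 / 2) * Real.sinh X| ≤ (C * T) ^ 4 * (2 * (C * T * h)) := by
    rw [abs_mul]
    refine mul_le_mul ((abs_cosh_sub_le hD1).trans ?_) ((abs_sinh_le hX1).trans ?_) (abs_nonneg _)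
      (by positivity)
    · gcongr
    · linarith
  have b2 : |(1 + D ^ 2 / 2) * (Real.sinh X - X)| ≤ 2 * (C * T * h) ^ 3 := by
    rw [abs_mul]
    refine mul_le_mul ?_ ((abs_sinh_sub_le hX1).trans ?_) (abs_nonneg _) (by norm_num)
    · rw [abs_of_nonneg (by positivity), ← sq_abs]
      nlinarith [abs_nonneg D]
    · gcongr
  have b3 : |(D - d) * (D + d) * X| ≤ (C * T * h) * (C * T + C * T) * (C * T * h) := by
    rw [abs_mul, abs_mul]
    have : |D + d| ≤ C * T + C * T := (abs_add_le _ _).trans (add_le_add hD hd)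
    gcongr
  have b4 : |d ^ 2 * (X - x)| ≤ (C * T) ^ 2 * (C * T * h ^ 2) := by
    rw [abs_mul, abs_pow]
    gcongr
  have hC5 : C ^ 3 ≤ C ^ 5 := pow_le_pow_right₀ hC (by norm_num)
  have hT3 : 0 ≤ T ^ 3 * h := by positivity
  have c1 : T ^ 2 ≤ ε := by nlinarith
  have c2 : h ^ 2 ≤ ε := by nlinarith
  have d1 : (C * T) ^ 4 * (2 * (C * T * h)) ≤ 2 * C ^ 5 * ε * (T ^ 3 * h) := by
    calc (C * T) ^ 4 * (2 * (C * T * h)) = 2 * C ^ 5 * T ^ 2 * (T ^ 3 * h) := by ring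
      _ ≤ _ := by gcongr
  have d2 : 2 * (C * T * h) ^ 3 ≤ 2 * C ^ 5 * ε * (T ^ 3 * h) := by
    calc 2 * (C * T * h) ^ 3 = 2 * C ^ 3 * h ^ 2 * (T ^ 3 * h) := by ring
      _ ≤ _ := by gcongr
  have d3 : (C * T * h) * (C * T + C * T) * (C * T * h) ≤ 2 * C ^ 5 * ε * (T ^ 3 * h) := by
    calc (C * T * h) * (C * T + C * T) * (C * T * h) = 2 * C ^ 3 * h * (T ^ 3 * h) := by ring
      _ ≤ _ := by gcongr
  have d4 : (C * T) ^ 2 * (C * T * h ^ 2) ≤ 2 * C ^ 5 * ε * (T ^ 3 * h) := by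
    calc (C * T) ^ 2 * (C * T * h ^ 2) = 1 * C ^ 3 * h * (T ^ 3 * h) := by ring
      _ ≤ _ := by gcongr; norm_num
  rw [e]
  rw [abs_le] at *
  constructor <;> linarith [b1.1, b1.2, b2.1, b2.2, b3.1, b3.2, b4.1, b4.2]

theorem exists_uniform_const {κ : Type*} [Finite κ] {P : κ → ℝ → Prop}
    (hmono : ∀ i a b, a ≤ b → P i a → P i b) (h : ∀ i, ∃ C, P i C) :
    ∃ C, 1 ≤ C ∧ ∀ i, P i C := by
  choose C hC using h
  obtain ⟨B, hB⟩ := (Set.finite_range C).bddAbove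
  exact ⟨max 1 B, le_max_left _ _, fun i =>
    hmono i _ _ ((hB (Set.mem_range_self i)).trans (le_max_right _ _)) (hC i)⟩

variable {E : Type*} [NormedAddCommGroup E] [NormedSpace ℝ E]

/-- The forward difference along `a`. -/
def fwdDiff (a : E) (f : E → ℝ) (x : E) : ℝ := f (x + a) - f x

/-- The derivative along `a`. -/
noncomputable def dirDeriv (a : E) (f : E → ℝ) (x : E) : ℝ := fderiv ℝ f x a

/-- Iterated forward differences along the multiples by `h` of the vectors of a list. -/
def iterDiff (h : ℝ) : List E → (E → ℝ) → E → ℝ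
  | [], f => f
  | a :: l, f => fwdDiff (h • a) (iterDiff h l f)

theorem contDiff_fwdDiff {f : E → ℝ} (hf : ContDiff ℝ ∞ f) (a : E) :
    ContDiff ℝ ∞ (fwdDiff a f) := by
  unfold fwdDiff
  exact (hf.comp (contDiff_id.add contDiff_const)).sub hf

theorem contDiff_dirDeriv {f : E → ℝ} (hf : ContDiff ℝ ∞ f) (a : E) :
    ContDiff ℝ ∞ (dirDeriv a f) :=
  (hf.fderiv_right (m := ∞) le_rfl).clm_apply contDiff_const

theorem contDiff_iterDiff {f : E → ℝ} (hf : ContDiff ℝ ∞ f) (h : ℝ) (l : List E) :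
    ContDiff ℝ ∞ (iterDiff h l f) := by
  induction l with
  | nil => exact hf
  | cons a l ih => exact contDiff_fwdDiff ih _

theorem dirDeriv_fwdDiff {f : E → ℝ} (hf : ContDiff ℝ ∞ f) (a b : E) :
    dirDeriv a (fwdDiff b f) = fwdDiff b (dirDeriv a f) := by
  have hd : Differentiable ℝ f := hf.differentiable (by simp)
  funext x
  unfold dirDeriv fwdDiff
  have hd' : Differentiable ℝ fun y => f (y + b) := hd.comp (differentiable_id.add_const b)
  rw [fderiv_fun_sub (hd' x) (hd x), fderiv_comp_add_right]
  rfl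

theorem dirDeriv_iterDiff {f : E → ℝ} (hf : ContDiff ℝ ∞ f) (a : E) (h : ℝ) (l : List E) :
    dirDeriv a (iterDiff h l f) = iterDiff h l (dirDeriv a f) := by
  induction l with
  | nil => rfl
  | cons b l ih => rw [iterDiff, dirDeriv_fwdDiff (contDiff_iterDiff hf h l), ih]; rfl

theorem hasDerivAt_line {f : E → ℝ} (hf : ContDiff ℝ ∞ f) (x a : E) (t : ℝ) :
    HasDerivAt (fun s : ℝ => f (x + s • a)) (dirDeriv a f (x + t • a)) t := by
  have hd : Differentiable ℝ f := hf.differentiable (by simp)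
  have h1 : HasDerivAt (fun s : ℝ => x + s • a) a t := by
    simpa using ((hasDerivAt_id t).smul_const a).const_add x
  exact (hd (x + t • a)).hasFDerivAt.comp_hasDerivAt t h1

theorem abs_fwdDiff_sub_le {f : E → ℝ} (hf : ContDiff ℝ ∞ f) {x a : E} {h c K : ℝ} (hh : 0 ≤ h)
    (hK : ∀ t, 0 ≤ t → t ≤ h → |dirDeriv a f (x + t • a) - c| ≤ K) :
    |fwdDiff (h • a) f x - h * c| ≤ K * h := by
  have h1 := norm_image_sub_le_of_norm_deriv_le_segment' (a := 0) (b := h) (C := K)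
    (f := fun s : ℝ => f (x + s • a) - s * c) (f' := fun t => dirDeriv a f (x + t • a) - c)
    (fun t _ => ((hasDerivAt_line hf x a t).sub
      (by simpa using (hasDerivAt_id t).mul_const c)).hasDerivWithinAt)
    (fun t ht => hK t ht.1 ht.2.le) h ⟨hh, le_rfl⟩
  simp only [zero_smul, add_zero, zero_mul, sub_zero, Real.norm_eq_abs] at h1
  rw [fwdDiff]
  convert h1 using 2
  ring

theorem abs_fwdDiff_le {f : E → ℝ} (hf : ContDiff ℝ ∞ f) {x a : E} {h K : ℝ} (hh : 0 ≤ h)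
    (hK : ∀ t, 0 ≤ t → t ≤ h → |dirDeriv a f (x + t • a)| ≤ K) :
    |fwdDiff (h • a) f x| ≤ K * h := by
  simpa using abs_fwdDiff_sub_le hf (c := 0) hh (by simpa using hK)

theorem norm_add_smul_le {x a : E} {R t : ℝ} (hx : ‖x‖ ≤ R) (ht : 0 ≤ t) (ht1 : t ≤ 1) :
    ‖x + t • a‖ ≤ R + ‖a‖ := by
  refine (norm_add_le _ _).trans (add_le_add hx ?_)
  rw [norm_smul, Real.norm_of_nonneg ht]
  exact mul_le_of_le_one_left (norm_nonneg a) ht1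

/-- For a translation `T`, `(T - 1) + (T⁻¹ - 1) = -(T - 1)(T⁻¹ - 1)`. Symmetry of the edges thus
turns first differences into second ones and gains one power of `h`. -/
theorem sum_fwdDiff_eq {ι : Type*} [Fintype ι] {η : ι → E} {σ : Equiv.Perm ι}
    (hη : ∀ i, η (σ i) = -η i) (h : ℝ) (f : E → ℝ) (x : E) :
    ∑ i, fwdDiff (h • η i) f x = -(1 / 2) * ∑ i, iterDiff h [η i, -η i] f x := by
  have h1 := Equiv.sum_comp σ fun i => fwdDiff (h • η i) f x
  have h2 : ∑ i, iterDiff h [η i, -η i] f x =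
      -(∑ i, fwdDiff (h • η i) f x + ∑ i, fwdDiff (h • η (σ i)) f x) := by
    rw [← sum_add_distrib, ← sum_neg_distrib]
    refine sum_congr rfl fun i _ => ?_
    simp only [iterDiff, fwdDiff, hη, smul_neg, add_neg_cancel_right]
    ring
  rw [h2, h1]; ring

variable [FiniteDimensional ℝ E]

theorem exists_abs_le_of_contDiff {f : E → ℝ} (hf : ContDiff ℝ ∞ f) (R : ℝ) :
    ∃ C, ∀ x, ‖x‖ ≤ R → |f x| ≤ C := by
  have : ProperSpace E := FiniteDimensional.proper ℝ E
  obtain ⟨C, hC⟩ := (isCompact_closedBall (0 : E) R).exists_bound_of_continuousOn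
    hf.continuous.continuousOn
  exact ⟨C, fun x hx => hC x (by simpa using hx)⟩

/-- Iterated differences of order `n` of a smooth function are `O(h ^ n)` on bounded sets. -/
theorem exists_abs_iterDiff_le (l : List E) : ∀ {f : E → ℝ}, ContDiff ℝ ∞ f → ∀ R : ℝ,
    ∃ C, ∀ h x, 0 ≤ h → h ≤ 1 → ‖x‖ ≤ R → |iterDiff h l f x| ≤ C * h ^ l.length := by
  induction l with
  | nil =>
    intro f hf R
    obtain ⟨C, hC⟩ := exists_abs_le_of_contDiff hf R
    exact ⟨C, fun h x _ _ hx => by simpa [iterDiff] using hC x hx⟩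
  | cons a l ih =>
    intro f hf R
    obtain ⟨C, hC⟩ := ih (contDiff_dirDeriv hf a) (R + ‖a‖)
    refine ⟨C, fun h x hh hh1 hx => ?_⟩
    have := abs_fwdDiff_le (contDiff_iterDiff hf h l) (x := x) (a := a) hh
      (K := C * h ^ l.length) fun t ht hth => by
        rw [dirDeriv_iterDiff hf]
        exact hC h _ hh hh1 (norm_add_smul_le hx ht (hth.trans hh1))
    rw [List.length_cons, pow_succ, ← mul_assoc]
    exact this

theorem exists_abs_fwdDiff_sub_dirDeriv_le {f : E → ℝ} (hf : ContDiff ℝ ∞ f) (a : E) (R : ℝ) :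
    ∃ C, ∀ h x, 0 ≤ h → h ≤ 1 → ‖x‖ ≤ R →
      |fwdDiff (h • a) f x - h * dirDeriv a f x| ≤ C * h ^ 2 := by
  obtain ⟨C, hC⟩ := exists_abs_iterDiff_le [a] (contDiff_dirDeriv hf a) R
  refine ⟨max C 0, fun h x hh hh1 hx => ?_⟩
  rw [sq, ← mul_assoc]
  refine abs_fwdDiff_sub_le hf hh fun t ht hth => ?_
  have := hC t x ht (hth.trans hh1) hx
  simp only [iterDiff, fwdDiff, List.length_cons, List.length_nil, zero_add, pow_one] at this
  exact this.trans (mul_le_mul (le_max_left _ _) hth ht (le_max_right _ _))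

/-- The one-step remainder along `b`, differentiated along `a`, is the one-step remainder of
`dirDeriv a f`. This yields `h²` uniformly, and the outer difference supplies the third power of
`h`. -/
theorem exists_abs_fwdDiff_fwdDiff_sub_le {f : E → ℝ} (hf : ContDiff ℝ ∞ f) (a b : E) (R : ℝ) :
    ∃ C, ∀ h x, 0 ≤ h → h ≤ 1 → ‖x‖ ≤ R →
      |fwdDiff (h • a) (fwdDiff (h • b) f) x - h ^ 2 * dirDeriv a (dirDeriv b f) x| ≤
        C * h ^ 3 := by
  obtain ⟨C, hC⟩ := exists_abs_fwdDiff_sub_dirDeriv_le (contDiff_dirDeriv hf a) b (R + ‖a‖)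
  obtain ⟨C', hC'⟩ := exists_abs_fwdDiff_sub_dirDeriv_le (contDiff_dirDeriv hf b) a R
  refine ⟨C + C', fun h x hh hh1 hx => ?_⟩
  have hs : ContDiff ℝ ∞ fun x => fwdDiff (h • b) f x - h * dirDeriv b f x :=
    (contDiff_fwdDiff hf _).sub (contDiff_const.mul (contDiff_dirDeriv hf b))
  have hcomm : ∀ y, dirDeriv a (dirDeriv b f) y = dirDeriv b (dirDeriv a f) y := by
    intro y
    have h2 : IsSymmSndFDerivAt ℝ f y :=
      (hf.contDiffAt (x := y)).isSymmSndFDerivAt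
        (by rw [minSmoothness_of_isRCLikeNormedField]; exact WithTop.coe_le_coe.2 (le_top : (2 : ℕ∞) ≤ ⊤))
    have hd : DifferentiableAt ℝ (fderiv ℝ f) y :=
      ((hf.fderiv_right (m := ∞) le_rfl).differentiable (by simp)) y
    unfold dirDeriv
    rw [fderiv_clm_apply hd (differentiableAt_const b),
      fderiv_clm_apply hd (differentiableAt_const a)]
    simpa using h2 a b
  have h1 := abs_fwdDiff_le hs (x := x) (a := a) hh (K := C * h ^ 2) fun t ht hth => by
    have e : dirDeriv a (fun x => fwdDiff (h • b) f x - h * dirDeriv b f x) (x + t • a) =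
        fwdDiff (h • b) (dirDeriv a f) (x + t • a) -
          h * dirDeriv b (dirDeriv a f) (x + t • a) := by
      rw [← dirDeriv_fwdDiff hf, ← hcomm]
      have d1 : Differentiable ℝ (fwdDiff (h • b) f) :=
        (contDiff_fwdDiff hf _).differentiable (by simp)
      have d2 : Differentiable ℝ (dirDeriv b f) :=
        (contDiff_dirDeriv hf b).differentiable (by simp)
      change fderiv ℝ (fun y => fwdDiff (h • b) f y - h * dirDeriv b f y) (x + t • a) a = _
      rw [fderiv_fun_sub (d1 _) ((d2 _).const_mul h), fderiv_const_mul (d2 _)]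
      rfl
    rw [e]
    exact hC h _ hh hh1 (norm_add_smul_le hx ht (hth.trans hh1))
  have h2 := hC' h x hh hh1 hx
  have e2 : fwdDiff (h • a) (fwdDiff (h • b) f) x - h ^ 2 * dirDeriv a (dirDeriv b f) x =
      fwdDiff (h • a) (fun x => fwdDiff (h • b) f x - h * dirDeriv b f x) x +
      h * (fwdDiff (h • a) (dirDeriv b f) x - h * dirDeriv a (dirDeriv b f) x) := by
    simp only [fwdDiff]; ring
  rw [e2]
  refine (abs_add_le _ _).trans ?_
  rw [abs_mul, abs_of_nonneg hh]
  have := mul_le_mul_of_nonneg_left h2 hh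
  nlinarith

section Symmetric

variable {ι : Type*} [Fintype ι] {η : ι → E} {σ : Equiv.Perm ι}

theorem exists_abs_sum_fwdDiff_le (hη : ∀ i, η (σ i) = -η i) {f : E → ℝ}
    (hf : ContDiff ℝ ∞ f) (R : ℝ) :
    ∃ C, ∀ h x, 0 ≤ h → h ≤ 1 → ‖x‖ ≤ R → |∑ i, fwdDiff (h • η i) f x| ≤ C * h ^ 2 := by
  choose C hC using fun i => exists_abs_iterDiff_le [η i, -η i] hf R
  refine ⟨1 / 2 * ∑ i, C i, fun h x hh hh1 hx => ?_⟩
  rw [sum_fwdDiff_eq hη, abs_mul, abs_neg, abs_of_pos (by norm_num : (0 : ℝ) < 1 / 2), mul_assoc,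
    sum_mul]
  gcongr
  exact (abs_sum_le_sum_abs _ _).trans (sum_le_sum fun i _ => hC i h x hh hh1 hx)

/-- The symmetry is used in both indices, giving fourth differences; without it the bound would only
be of order `h²`, too large to be absorbed later. -/
theorem exists_abs_sum_sum_fwdDiff_le (hη : ∀ i, η (σ i) = -η i) {f : E → ℝ}
    (hf : ContDiff ℝ ∞ f) (R : ℝ) :
    ∃ C, ∀ h x, 0 ≤ h → h ≤ 1 → ‖x‖ ≤ R →
      |∑ i, ∑ j, fwdDiff (h • η i) (fwdDiff (h • η j) f) x| ≤ C * h ^ 4 := by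
  choose C hC using fun q : ι × ι => exists_abs_iterDiff_le [η q.2, -η q.2, η q.1, -η q.1] hf R
  refine ⟨1 / 4 * ∑ i, ∑ j, C (i, j), fun h x hh hh1 hx => ?_⟩
  have e : ∑ i, ∑ j, fwdDiff (h • η i) (fwdDiff (h • η j) f) x =
      1 / 4 * ∑ i, ∑ j, iterDiff h [η j, -η j, η i, -η i] f x := by
    have e1 : ∀ j, ∑ i, fwdDiff (h • η i) (fwdDiff (h • η j) f) x =
        fwdDiff (h • η j) (fun y => -(1 / 2) * ∑ i, iterDiff h [η i, -η i] f y) x := by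
      intro j
      simp only [← sum_fwdDiff_eq hη]
      simp only [fwdDiff, ← sum_sub_distrib]
      refine sum_congr rfl fun i _ => ?_
      rw [add_right_comm]; ring
    rw [sum_comm]
    simp only [e1]
    rw [sum_fwdDiff_eq hη]
    have e2 : ∀ j, iterDiff h [η j, -η j]
        (fun y => -(1 / 2) * ∑ i, iterDiff h [η i, -η i] f y) x =
        -(1 / 2) * ∑ i, iterDiff h [η j, -η j, η i, -η i] f x := by
      intro j
      simp only [iterDiff, fwdDiff, mul_sum, ← sum_sub_distrib]
      exact sum_congr rfl fun i _ => by ring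
    simp only [e2, ← mul_sum]
    rw [sum_comm]; ring
  rw [e, abs_mul, abs_of_pos (by norm_num : (0 : ℝ) < 1 / 4), mul_assoc, sum_mul]
  gcongr
  refine (abs_sum_le_sum_abs _ _).trans (sum_le_sum fun i _ => ?_)
  rw [sum_mul]
  exact (abs_sum_le_sum_abs _ _).trans (sum_le_sum fun j _ => hC (i, j) h x hh hh1 hx)

end Symmetric

end Taylor

end DiscreteCarleman

namespace DiscreteCarleman

open Finset
open scoped ContDiff RealInnerProductSpace

/-! ### The Gaussian weight and its derivatives -/

section Weight

variable {E : Type*} [NormedAddCommGroup E]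

/-- The Gaussian Carleman weight. -/
noncomputable def weight (x : E) : ℝ := Real.exp (-(32 * ‖x‖ ^ 2))

theorem weight_pos (x : E) : 0 < weight x := Real.exp_pos _

theorem weight_le_one (x : E) : weight x ≤ 1 :=
  Real.exp_le_one_iff.2 (by nlinarith [sq_nonneg ‖x‖])

theorem weight_anti {x : E} {r : ℝ} (hx : ‖x‖ ≤ r) : Real.exp (-(32 * r ^ 2)) ≤ weight x :=
  Real.exp_le_exp.2 (by nlinarith [norm_nonneg x])

theorem weight_le {x : E} {r : ℝ} (hr : 0 ≤ r) (hx : r ≤ ‖x‖) :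
    weight x ≤ Real.exp (-(32 * r ^ 2)) :=
  Real.exp_le_exp.2 (by nlinarith [norm_nonneg x])

variable [InnerProductSpace ℝ E]

theorem contDiff_weight : ContDiff ℝ ∞ (weight : E → ℝ) := by
  unfold weight
  exact (contDiff_const.mul (contDiff_norm_sq ℝ)).neg.exp

theorem dirDeriv_weight (a : E) :
    dirDeriv a (weight : E → ℝ) = fun x => -64 * ⟪x, a⟫ * weight x := by
  funext x
  have h1 : HasFDerivAt (fun y : E => ‖y‖ ^ 2) (2 • innerSL ℝ x) x := by
    simpa using (hasStrictFDerivAt_norm_sq x).hasFDerivAt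
  have h2 := ((h1.const_mul 32).neg).exp
  unfold dirDeriv
  have h3 : HasFDerivAt (weight : E → ℝ) _ x := h2
  rw [h3.fderiv]
  simp [weight]
  ring

theorem dirDeriv_dirDeriv_weight (a b x : E) :
    dirDeriv a (dirDeriv b (weight : E → ℝ)) x =
      (-64 * ⟪a, b⟫ + 4096 * ⟪x, a⟫ * ⟪x, b⟫) * weight x := by
  have hw : DifferentiableAt ℝ (weight : E → ℝ) x :=
    contDiff_weight.contDiffAt.differentiableAt (by simp)
  have h1 : HasFDerivAt (fun y : E => -64 * ⟪y, b⟫) ((-64 : ℝ) • innerSL ℝ b) x := by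
    have h4 : HasFDerivAt (fun y : E => -64 * ⟪b, y⟫) ((-64 : ℝ) • innerSL ℝ b) x :=
      ((innerSL ℝ b).hasFDerivAt (x := x)).const_mul (-64)
    simpa only [real_inner_comm] using h4
  have h2 := h1.mul hw.hasFDerivAt
  have h3 : fderiv ℝ (weight : E → ℝ) x a = -64 * ⟪x, a⟫ * weight x :=
    congrFun (dirDeriv_weight a) x
  rw [dirDeriv_weight b]
  unfold dirDeriv
  have h5 : HasFDerivAt (fun y : E => -64 * ⟪y, b⟫ * weight y) _ x := h2
  rw [h5.fderiv]
  simp [h3, real_inner_comm]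
  ring

end Weight

/-! ### Algebra of symmetric tight frames -/

section Frame

variable {E : Type*} [NormedAddCommGroup E] [InnerProductSpace ℝ E]
variable {ι : Type*} [Fintype ι] {η : ι → E} {σ : Equiv.Perm ι}

theorem sum_inner_eq_zero (hη : ∀ i, η (σ i) = -η i) (x : E) : ∑ i, ⟪x, η i⟫ = 0 := by
  have h := Equiv.sum_comp σ fun i => ⟪x, η i⟫
  simp only [hη, inner_neg_right, sum_neg_distrib] at h
  linarith

theorem sum_inner_pow_three_eq_zero (hη : ∀ i, η (σ i) = -η i) (x : E) :
    ∑ i, ⟪x, η i⟫ ^ 3 = 0 := by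
  have h := Equiv.sum_comp σ fun i => ⟪x, η i⟫ ^ 3
  simp only [hη, inner_neg_right, Odd.neg_pow (by decide : Odd 3), sum_neg_distrib] at h
  linarith

variable (hP : ∀ x y : E, ∑ i, ⟪x, η i⟫ * ⟪y, η i⟫ = 2 * ⟪x, y⟫)
include hP

theorem sum_inner_sq (x : E) : ∑ i, ⟪x, η i⟫ ^ 2 = 2 * ‖x‖ ^ 2 := by
  simpa only [sq, real_inner_self_eq_norm_mul_norm] using hP x x

theorem sum_sum_inner_mul (x : E) :
    ∑ i, ∑ j, ⟪x, η i⟫ * ⟪x, η j⟫ * ⟪η i, η j⟫ = 4 * ‖x‖ ^ 2 := by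
  have h1 : ∀ i, ∑ j, ⟪x, η i⟫ * ⟪x, η j⟫ * ⟪η i, η j⟫ = 2 * ⟪x, η i⟫ ^ 2 := by
    intro i
    have := hP x (η i)
    calc _ = ⟪x, η i⟫ * ∑ j, ⟪x, η j⟫ * ⟪η i, η j⟫ := by
          rw [mul_sum]; exact sum_congr rfl fun j _ => by ring
      _ = _ := by rw [this]; ring
  simp only [h1, ← mul_sum]
  rw [sum_inner_sq hP]; ring

/-- The frame operator is twice the identity, so synthesis has the same norm as analysis. The
coefficient 1/4 in the arithmetic-geometric mean leaves half of `‖Z‖²` to be absorbed. -/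
theorem norm_sq_sum_smul_le (t : ι → ℝ) : ‖∑ i, t i • η i‖ ^ 2 ≤ 2 * ∑ i, t i ^ 2 := by
  set Z := ∑ i, t i • η i with hZ
  have h1 : ‖Z‖ ^ 2 = ∑ i, t i * ⟪Z, η i⟫ := by
    rw [← real_inner_self_eq_norm_sq]
    conv_lhs => rw [hZ, inner_sum]
    rw [← hZ]
    exact sum_congr rfl fun i _ => by rw [inner_smul_right]
  have h2 : ∑ i, t i * ⟪Z, η i⟫ ≤ ∑ i, (t i ^ 2 + 1 / 4 * ⟪Z, η i⟫ ^ 2) :=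
    sum_le_sum fun i _ => by nlinarith [sq_nonneg (t i - 1 / 2 * ⟪Z, η i⟫)]
  rw [sum_add_distrib, ← mul_sum, sum_inner_sq hP] at h2
  linarith

/-- The matrix is the Hessian of the weight divided by the weight. Its rows sum to zero by symmetry,
so only the cross terms in `t i * t j` survive. The convex rank-one part then has a favourable sign,
and the concave part costs at most `128 * 2`. -/
theorem sum_hessian_mul_sub_sq_le (hη : ∀ i, η (σ i) = -η i) (x : E) (t : ι → ℝ) :
    ∑ i, ∑ j, (-64 * ⟪η i, η j⟫ + 4096 * ⟪x, η i⟫ * ⟪x, η j⟫) * (t i - t j) ^ 2 ≤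
      256 * ∑ i, t i ^ 2 := by
  have hz : ∀ y : E, ∑ i, ⟪y, η i⟫ = 0 := sum_inner_eq_zero hη
  have hrow : ∀ i, ∑ j, (-64 * ⟪η i, η j⟫ + 4096 * ⟪x, η i⟫ * ⟪x, η j⟫) = 0 := by
    intro i
    rw [sum_add_distrib, ← mul_sum, ← mul_sum, hz, hz]; simp
  have e1 : ∑ i, ∑ j, (-64 * ⟪η i, η j⟫ + 4096 * ⟪x, η i⟫ * ⟪x, η j⟫) * t i ^ 2 = 0 := by
    simp only [← sum_mul, hrow]; simp
  have e2 : ∑ i, ∑ j, (-64 * ⟪η i, η j⟫ + 4096 * ⟪x, η i⟫ * ⟪x, η j⟫) * t j ^ 2 = 0 := by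
    rw [sum_comm, ← e1]
    refine sum_congr rfl fun i _ => sum_congr rfl fun j _ => ?_
    rw [real_inner_comm]; ring
  have e3 : ∑ i, ∑ j, ⟪η i, η j⟫ * (t i * t j) = ‖∑ i, t i • η i‖ ^ 2 := by
    rw [← real_inner_self_eq_norm_sq, sum_inner]
    refine sum_congr rfl fun i _ => ?_
    rw [inner_sum]
    refine sum_congr rfl fun j _ => ?_
    rw [inner_smul_left, inner_smul_right]; simp; ring
  have e4 : ∑ i, ∑ j, ⟪x, η i⟫ * ⟪x, η j⟫ * (t i * t j) = (∑ i, ⟪x, η i⟫ * t i) ^ 2 := by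
    rw [sq, sum_mul_sum]
    exact sum_congr rfl fun i _ => sum_congr rfl fun j _ => by ring
  have e5 : ∑ i, ∑ j, (-64 * ⟪η i, η j⟫ + 4096 * ⟪x, η i⟫ * ⟪x, η j⟫) * (t i - t j) ^ 2 =
      ∑ i, ∑ j, (-64 * ⟪η i, η j⟫ + 4096 * ⟪x, η i⟫ * ⟪x, η j⟫) * t i ^ 2 +
      ∑ i, ∑ j, (-64 * ⟪η i, η j⟫ + 4096 * ⟪x, η i⟫ * ⟪x, η j⟫) * t j ^ 2 +
      128 * ∑ i, ∑ j, ⟪η i, η j⟫ * (t i * t j) -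
      8192 * ∑ i, ∑ j, ⟪x, η i⟫ * ⟪x, η j⟫ * (t i * t j) := by
    simp only [mul_sum, ← sum_add_distrib, ← sum_sub_distrib]
    exact sum_congr rfl fun i _ => sum_congr rfl fun j _ => by ring
  rw [e5, e1, e2, e3, e4]
  nlinarith [norm_sq_sum_smul_le hP t, sq_nonneg (∑ i, ⟪x, η i⟫ * t i)]

/-- After expansion, every term odd in one of the two edges cancels and the tight frame identity
evaluates the other two. This exact evaluation is the reason for measuring balls in the norm of the
hidden graph. -/
theorem sum_sum_commutator_main (hη : ∀ i, η (σ i) = -η i) (x : E) :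
    ∑ i, ∑ j, (⟪x, η j⟫ - ⟪x, η i⟫) ^ 2 *
      (-64 * ⟪η i, η j⟫ + 4096 * ⟪x, η i⟫ * ⟪x, η j⟫) =
      512 * ‖x‖ ^ 2 - 32768 * ‖x‖ ^ 4 := by
  have hz : ∀ y : E, ∑ i, ⟪y, η i⟫ = 0 := sum_inner_eq_zero hη
  have a1 : ∑ i, ∑ j, ⟪x, η i⟫ ^ 2 * ⟪η i, η j⟫ = 0 := by simp only [← mul_sum, hz]; simp
  have a2 : ∑ i, ∑ j, ⟪x, η j⟫ ^ 2 * ⟪η i, η j⟫ = 0 := by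
    rw [sum_comm, ← a1]
    exact sum_congr rfl fun i _ => sum_congr rfl fun j _ => by
      rw [real_inner_comm (η i) (η j)]
  have a3 : ∑ i, ∑ j, ⟪x, η i⟫ ^ 3 * ⟪x, η j⟫ = 0 := by simp only [← mul_sum, hz]; simp
  have a4 : ∑ i, ∑ j, ⟪x, η i⟫ * ⟪x, η j⟫ ^ 3 = 0 := by
    simp only [← mul_sum, sum_inner_pow_three_eq_zero hη]; simp
  have a5 : ∑ i, ∑ j, ⟪x, η i⟫ ^ 2 * ⟪x, η j⟫ ^ 2 = 4 * ‖x‖ ^ 4 := by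
    rw [← sum_mul_sum, sum_inner_sq hP]; ring
  have a6 := sum_sum_inner_mul hP x
  have e : ∑ i, ∑ j, (⟪x, η j⟫ - ⟪x, η i⟫) ^ 2 *
      (-64 * ⟪η i, η j⟫ + 4096 * ⟪x, η i⟫ * ⟪x, η j⟫) =
      -64 * ∑ i, ∑ j, ⟪x, η i⟫ ^ 2 * ⟪η i, η j⟫ - 64 * ∑ i, ∑ j, ⟪x, η j⟫ ^ 2 * ⟪η i, η j⟫ +
      128 * ∑ i, ∑ j, ⟪x, η i⟫ * ⟪x, η j⟫ * ⟪η i, η j⟫ +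
      4096 * ∑ i, ∑ j, ⟪x, η i⟫ ^ 3 * ⟪x, η j⟫ + 4096 * ∑ i, ∑ j, ⟪x, η i⟫ * ⟪x, η j⟫ ^ 3 -
      8192 * ∑ i, ∑ j, ⟪x, η i⟫ ^ 2 * ⟪x, η j⟫ ^ 2 := by
    simp only [mul_sum, ← sum_add_distrib, ← sum_sub_distrib]
    exact sum_congr rfl fun i _ => sum_congr rfl fun j _ => by ring
  rw [e, a1, a2, a3, a4, a5, a6]; ring

end Frame

section WeightEstimates

variable {E : Type*} [NormedAddCommGroup E] [InnerProductSpace ℝ E] [FiniteDimensional ℝ E]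
variable {ι : Type*} [Fintype ι]

/-- Uniform Taylor bounds for the weight along a symmetric family of vectors. -/
structure WeightBounds (η : ι → E) (C : ℝ) : Prop where
  one_le : 1 ≤ C
  deriv : ∀ i x, ‖x‖ ≤ 3 → |dirDeriv (η i) weight x| ≤ C
  diff : ∀ i h x, 0 ≤ h → h ≤ 1 → ‖x‖ ≤ 3 → |fwdDiff (h • η i) weight x| ≤ C * h
  diff_sub : ∀ i h x, 0 ≤ h → h ≤ 1 → ‖x‖ ≤ 3 →
    |fwdDiff (h • η i) weight x - h * dirDeriv (η i) weight x| ≤ C * h ^ 2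
  diff₂ : ∀ i j h x, 0 ≤ h → h ≤ 1 → ‖x‖ ≤ 3 →
    |fwdDiff (h • η i) (fwdDiff (h • η j) weight) x| ≤ C * h ^ 2
  diff₂_sub : ∀ i j h x, 0 ≤ h → h ≤ 1 → ‖x‖ ≤ 3 →
    |fwdDiff (h • η i) (fwdDiff (h • η j) weight) x -
      h ^ 2 * dirDeriv (η i) (dirDeriv (η j) weight) x| ≤ C * h ^ 3
  sum_diff : ∀ h x, 0 ≤ h → h ≤ 1 → ‖x‖ ≤ 3 → |∑ i, fwdDiff (h • η i) weight x| ≤ C * h ^ 2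
  sum_diff₂ : ∀ h x, 0 ≤ h → h ≤ 1 → ‖x‖ ≤ 3 →
    |∑ i, ∑ j, fwdDiff (h • η i) (fwdDiff (h • η j) weight) x| ≤ C * h ^ 4

theorem exists_weightBounds {η : ι → E} {σ : Equiv.Perm ι} (hη : ∀ i, η (σ i) = -η i) :
    ∃ C, WeightBounds η C := by
  have hc := contDiff_weight (E := E)
  have mono : ∀ {a b u z : ℝ}, a ≤ b → 0 ≤ z → u ≤ a * z → u ≤ b * z :=
    fun hab hz hu => hu.trans (mul_le_mul_of_nonneg_right hab hz)
  obtain ⟨C1, -, h1⟩ := exists_uniform_const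
    (P := fun i C => ∀ x : E, ‖x‖ ≤ 3 → |dirDeriv (η i) weight x| ≤ C)
    (fun i a b hab H x hx => (H x hx).trans hab)
    (fun i => exists_abs_le_of_contDiff (contDiff_dirDeriv hc (η i)) 3)
  obtain ⟨C2, -, h2⟩ := exists_uniform_const
    (P := fun i C => ∀ h (x : E), 0 ≤ h → h ≤ 1 → ‖x‖ ≤ 3 → |iterDiff h [η i] weight x| ≤ C * h ^ 1)
    (fun i a b hab H h x hh hh1 hx => mono hab (by positivity) (H h x hh hh1 hx))
    (fun i => exists_abs_iterDiff_le [η i] hc 3)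
  obtain ⟨C3, -, h3⟩ := exists_uniform_const
    (P := fun i C => ∀ h (x : E), 0 ≤ h → h ≤ 1 → ‖x‖ ≤ 3 →
      |fwdDiff (h • η i) weight x - h * dirDeriv (η i) weight x| ≤ C * h ^ 2)
    (fun i a b hab H h x hh hh1 hx => mono hab (by positivity) (H h x hh hh1 hx))
    (fun i => exists_abs_fwdDiff_sub_dirDeriv_le hc (η i) 3)
  obtain ⟨C4, -, h4⟩ := exists_uniform_const
    (P := fun (q : ι × ι) C => ∀ h (x : E), 0 ≤ h → h ≤ 1 → ‖x‖ ≤ 3 →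
      |iterDiff h [η q.1, η q.2] weight x| ≤ C * h ^ 2)
    (fun i a b hab H h x hh hh1 hx => mono hab (by positivity) (H h x hh hh1 hx))
    (fun q => exists_abs_iterDiff_le [η q.1, η q.2] hc 3)
  obtain ⟨C5, -, h5⟩ := exists_uniform_const
    (P := fun (q : ι × ι) C => ∀ h (x : E), 0 ≤ h → h ≤ 1 → ‖x‖ ≤ 3 →
      |fwdDiff (h • η q.1) (fwdDiff (h • η q.2) weight) x -
      h ^ 2 * dirDeriv (η q.1) (dirDeriv (η q.2) weight) x| ≤ C * h ^ 3)
    (fun i a b hab H h x hh hh1 hx => mono hab (by positivity) (H h x hh hh1 hx))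
    (fun q => exists_abs_fwdDiff_fwdDiff_sub_le hc (η q.1) (η q.2) 3)
  obtain ⟨C6, h6⟩ := exists_abs_sum_fwdDiff_le hη hc 3
  obtain ⟨C7, h7⟩ := exists_abs_sum_sum_fwdDiff_le hη hc 3
  obtain ⟨C, hC⟩ := (Set.toFinite ({1, C1, C2, C3, C4, C5, C6, C7} : Set ℝ)).bddAbove
  refine ⟨C, ⟨hC (by simp), fun i x hx => (h1 i x hx).trans (hC (by simp)),
    fun i h x hh hh1 hx => ?_, fun i h x hh hh1 hx => ?_, fun i j h x hh hh1 hx => ?_,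
    fun i j h x hh hh1 hx => ?_, fun h x hh hh1 hx => ?_, fun h x hh hh1 hx => ?_⟩⟩
  · have := mono (hC (by simp)) (by positivity) (h2 i h x hh hh1 hx)
    rwa [pow_one] at this
  · exact mono (hC (by simp)) (by positivity) (h3 i h x hh hh1 hx)
  · exact mono (hC (by simp)) (by positivity) (h4 (i, j) h x hh hh1 hx)
  · exact mono (hC (by simp)) (by positivity) (h5 (i, j) h x hh hh1 hx)
  · exact mono (hC (by simp)) (by positivity) (h6 h x hh hh1 hx)
  · exact mono (hC (by simp)) (by positivity) (h7 h x hh hh1 hx)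

end WeightEstimates

end DiscreteCarleman

namespace DiscreteCarleman

open Finset
open scoped ContDiff RealInnerProductSpace

/-! ### The Carleman estimate on a symmetric lattice graph -/

section Carleman

variable {E : Type*} [NormedAddCommGroup E] [InnerProductSpace ℝ E]
variable {ι : Type*} [Fintype ι] {η : ι → E} {σ : Equiv.Perm ι} {C : ℝ}

/-- Each summand is `X + d² z / 2` up to a relative error `ε`. The linear terms sum to a fourth
difference of size `τ h⁴`, smaller than `τ³ h⁴` by `τ⁻² ≤ ε`. The cubic terms give the main part
through `sum_sum_commutator_main`. -/
theorem abs_commPotential_sub_le [FiniteDimensional ℝ E] (hη : ∀ i, η (σ i) = -η i)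
    (hP : ∀ x y : E, ∑ i, ⟪x, η i⟫ * ⟪y, η i⟫ = 2 * ⟪x, y⟫) (hC : WeightBounds η C) :
    ∃ K, ∀ h τ ε y, 0 ≤ h → 1 ≤ τ → 1 ≤ ε * τ → τ * h ≤ ε → 2 * C * ε ≤ 1 → ‖y‖ ≤ 3 →
      |commPotential (fun i => h • η i) (fun x => τ * weight x) y -
        1048576 * (64 * ‖y‖ ^ 4 - ‖y‖ ^ 2) * weight y ^ 3 * (τ ^ 3 * h ^ 4)| ≤
        K * ε * (τ ^ 3 * h ^ 4) := by
  have hC1 := hC.one_le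
  refine ⟨Fintype.card ι * (Fintype.card ι * (8 * (2 * C) ^ 5)) + C,
    fun h τ ε y hh hτ hετ hε hCε hy => ?_⟩
  have hτ0 : 0 ≤ τ := by linarith
  have hT0 : 0 ≤ τ * h := mul_nonneg hτ0 hh
  have hε0 : 0 ≤ ε := hT0.trans hε
  have hhε : h ≤ ε := (le_mul_of_one_le_left hh hτ).trans hε
  have hh1 : h ≤ 1 := by nlinarith
  set D : ι → ι → ℝ := fun i j => τ * weight (y + h • η j) - τ * weight (y + h • η i) with hD
  set X : ι → ι → ℝ := fun i j => τ * weight (y + h • η i) + τ * weight (y + h • η j) -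
    τ * weight y - τ * weight (y + h • η i + h • η j) with hX
  have hXe : ∀ i j, X i j = -(τ * fwdDiff (h • η i) (fwdDiff (h • η j) weight) y) := by
    intro i j; simp only [hX, fwdDiff]; ring
  have hDe : ∀ i j, D i j = τ * (fwdDiff (h • η j) weight y - fwdDiff (h • η i) weight y) := by
    intro i j; simp only [hD, fwdDiff]; ring
  set d : ι → ι → ℝ := fun i j =>
    τ * h * (dirDeriv (η j) weight y - dirDeriv (η i) weight y) with hd
  set z : ι → ι → ℝ := fun i j =>
    -(τ * h ^ 2 * dirDeriv (η i) (dirDeriv (η j) weight) y) with hz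
  have key : ∀ i j, |Real.cosh (D i j) * Real.sinh (X i j) - X i j - d i j ^ 2 * z i j / 2| ≤
      8 * (2 * C) ^ 5 * ε * ((τ * h) ^ 3 * h) := by
    intro i j
    refine abs_cosh_mul_sinh_sub_le (by linarith) hT0 hh hε hhε hCε ?_ ?_ ?_ ?_ ?_
    · rw [hDe, abs_mul, abs_of_nonneg hτ0]
      have := abs_sub (fwdDiff (h • η j) weight y) (fwdDiff (h • η i) weight y)
      have := hC.diff i h y hh hh1 hy
      have := hC.diff j h y hh hh1 hy
      calc _ ≤ τ * (C * h + C * h) := by gcongr; linarith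
        _ = _ := by ring
    · rw [hd, abs_mul, abs_of_nonneg hT0]
      have := abs_sub (dirDeriv (η j) weight y) (dirDeriv (η i) weight y)
      have := hC.deriv i y hy
      have := hC.deriv j y hy
      calc _ ≤ τ * h * (C + C) := by gcongr; linarith
        _ = _ := by ring
    · have e : D i j - d i j = τ * ((fwdDiff (h • η j) weight y - h * dirDeriv (η j) weight y) -
          (fwdDiff (h • η i) weight y - h * dirDeriv (η i) weight y)) := by
        rw [hDe]; simp only [hd]; ring
      rw [e, abs_mul, abs_of_nonneg hτ0]
      have := abs_sub (fwdDiff (h • η j) weight y - h * dirDeriv (η j) weight y)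
        (fwdDiff (h • η i) weight y - h * dirDeriv (η i) weight y)
      have := hC.diff_sub i h y hh hh1 hy
      have := hC.diff_sub j h y hh hh1 hy
      calc _ ≤ τ * (C * h ^ 2 + C * h ^ 2) := by gcongr; linarith
        _ = _ := by ring
    · rw [hXe, abs_neg, abs_mul, abs_of_nonneg hτ0]
      calc _ ≤ τ * (C * h ^ 2) := by gcongr; exact hC.diff₂ i j h y hh hh1 hy
        _ ≤ τ * (C * h ^ 2) + τ * (C * h ^ 2) := by
          have : 0 ≤ τ * (C * h ^ 2) := by positivity
          linarith
        _ = _ := by ring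
    · have e : X i j - z i j = -(τ * (fwdDiff (h • η i) (fwdDiff (h • η j) weight) y -
          h ^ 2 * dirDeriv (η i) (dirDeriv (η j) weight) y)) := by
        rw [hXe]; simp only [hz]; ring
      rw [e, abs_neg, abs_mul, abs_of_nonneg hτ0]
      calc _ ≤ τ * (C * h ^ 3) := by gcongr; exact hC.diff₂_sub i j h y hh hh1 hy
        _ ≤ τ * (C * h ^ 3) + τ * (C * h ^ 3) := by
          have : 0 ≤ τ * (C * h ^ 3) := by positivity
          linarith
        _ = _ := by ring
  have hmain : ∑ i, ∑ j, d i j ^ 2 * z i j / 2 =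
      1048576 * (64 * ‖y‖ ^ 4 - ‖y‖ ^ 2) * weight y ^ 3 * (τ ^ 3 * h ^ 4) := by
    have e1 : ∀ i j, d i j ^ 2 * z i j / 2 = -2048 * weight y ^ 3 * (τ ^ 3 * h ^ 4) *
        ((⟪y, η j⟫ - ⟪y, η i⟫) ^ 2 *
          (-64 * ⟪η i, η j⟫ + 4096 * ⟪y, η i⟫ * ⟪y, η j⟫)) := by
      intro i j
      simp only [hd, hz, dirDeriv_dirDeriv_weight]
      simp only [dirDeriv_weight]
      ring
    simp only [e1, ← mul_sum]
    rw [sum_sum_commutator_main hP hη]; ring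
  have hsum : |∑ i, ∑ j, X i j| ≤ C * ε * (τ ^ 3 * h ^ 4) := by
    simp only [hXe, sum_neg_distrib, ← mul_sum]
    rw [abs_neg, abs_mul, abs_of_nonneg hτ0]
    calc _ ≤ τ * (C * h ^ 4) := by gcongr; exact hC.sum_diff₂ h y hh hh1 hy
      _ = C * 1 * (τ * h ^ 4) := by ring
      _ ≤ C * (ε * τ * τ) * (τ * h ^ 4) := by
        gcongr
        exact one_le_mul_of_one_le_of_one_le hετ hτ
      _ = _ := by ring
  have e : commPotential (fun i => h • η i) (fun x => τ * weight x) y -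
      1048576 * (64 * ‖y‖ ^ 4 - ‖y‖ ^ 2) * weight y ^ 3 * (τ ^ 3 * h ^ 4) =
      ∑ i, ∑ j, (Real.cosh (D i j) * Real.sinh (X i j) - X i j - d i j ^ 2 * z i j / 2) +
        ∑ i, ∑ j, X i j := by
    rw [← hmain]
    simp only [sum_sub_distrib]
    simp only [commPotential, hD, hX]
    ring
  rw [e]
  refine (abs_add_le _ _).trans ?_
  rw [add_mul, add_mul]
  refine add_le_add ?_ hsum
  calc _ ≤ ∑ i : ι, ∑ j : ι, 8 * (2 * C) ^ 5 * ε * ((τ * h) ^ 3 * h) :=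
        (abs_sum_le_sum_abs _ _).trans (sum_le_sum fun i _ =>
          (abs_sum_le_sum_abs _ _).trans (sum_le_sum fun j _ => key i j))
    _ = _ := by simp only [sum_const, card_univ, nsmul_eq_mul]; ring

/-- The main part is `ψ (cosh - 1)` to second order, evaluated by the frame identity. The increments
of `ψ` sum to order `τ h⁴` over opposite edges, and their products with `cosh - 1` carry an extra
factor `h`. -/
theorem energyPotential_le [FiniteDimensional ℝ E]
    (hP : ∀ x y : E, ∑ i, ⟪x, η i⟫ * ⟪y, η i⟫ = 2 * ⟪x, y⟫) (hC : WeightBounds η C) :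
    ∃ K, ∀ h τ ε y, 0 ≤ h → 1 ≤ τ → 1 ≤ ε * τ → τ * h ≤ ε → 2 * C * ε ≤ 1 → ‖y‖ ≤ 3 →
      energyPotential (fun i => h • η i) (fun x => τ * weight x)
        (fun x => 384 * (τ * h ^ 2) * weight x) y ≤
        1572864 * ‖y‖ ^ 2 * weight y ^ 3 * (τ ^ 3 * h ^ 4) + K * ε * (τ ^ 3 * h ^ 4) := by
  have hC1 := hC.one_le
  refine ⟨Fintype.card ι * (384 * (C ^ 4 + C ^ 2) + 384 * C ^ 3) + 192 * C,
    fun h τ ε y hh hτ hετ hε hCε hy => ?_⟩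
  have hτ0 : 0 ≤ τ := by linarith
  have hT0 : 0 ≤ τ * h := mul_nonneg hτ0 hh
  have hε0 : 0 ≤ ε := hT0.trans hε
  have hhε : h ≤ ε := (le_mul_of_one_le_left hh hτ).trans hε
  have hε1 : ε ≤ 1 := by nlinarith
  have hh1 : h ≤ 1 := hhε.trans hε1
  have hg0 := weight_pos y
  have hg1 := weight_le_one y
  have hT2 : (τ * h) ^ 2 ≤ ε := by nlinarith
  set δ : ι → ℝ := fun i => fwdDiff (h • η i) weight y with hδ
  have hD : ∀ i, |τ * δ i| ≤ C * (τ * h) := by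
    intro i
    rw [abs_mul, abs_of_nonneg hτ0]
    calc _ ≤ τ * (C * h) := by gcongr; exact hC.diff i h y hh hh1 hy
      _ = _ := by ring
  have hD1 : ∀ i, |τ * δ i| ≤ 1 := fun i => (hD i).trans (by nlinarith)
  have hcosh : ∀ i, |Real.cosh (τ * δ i) - 1 - (τ * h * dirDeriv (η i) weight y) ^ 2 / 2| ≤
      (C ^ 4 + C ^ 2) * ε * (τ * h) ^ 2 := by
    intro i
    have e : Real.cosh (τ * δ i) - 1 - (τ * h * dirDeriv (η i) weight y) ^ 2 / 2 =
        (Real.cosh (τ * δ i) - 1 - (τ * δ i) ^ 2 / 2) +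
        1 / 2 * ((τ * (δ i - h * dirDeriv (η i) weight y)) *
          (τ * δ i + τ * h * dirDeriv (η i) weight y)) := by ring
    rw [e]
    refine (abs_add_le _ _).trans ?_
    have b1 : |Real.cosh (τ * δ i) - 1 - (τ * δ i) ^ 2 / 2| ≤ C ^ 4 * ε * (τ * h) ^ 2 := by
      refine (abs_cosh_sub_le (hD1 i)).trans ?_
      calc _ ≤ (C * (τ * h)) ^ 4 := by gcongr; exact hD i
        _ = C ^ 4 * (τ * h) ^ 2 * (τ * h) ^ 2 := by ring
        _ ≤ _ := by gcongr
    have b2 : |1 / 2 * ((τ * (δ i - h * dirDeriv (η i) weight y)) *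
          (τ * δ i + τ * h * dirDeriv (η i) weight y))| ≤ C ^ 2 * ε * (τ * h) ^ 2 := by
      rw [abs_mul, abs_mul, abs_mul, abs_of_nonneg hτ0, abs_of_pos (by norm_num : (0:ℝ) < 1 / 2)]
      have c1 : |δ i - h * dirDeriv (η i) weight y| ≤ C * h ^ 2 := hC.diff_sub i h y hh hh1 hy
      have c2 : |τ * δ i + τ * h * dirDeriv (η i) weight y| ≤ 2 * (C * (τ * h)) := by
        refine (abs_add_le _ _).trans ?_
        rw [two_mul]
        refine add_le_add (hD i) ?_
        rw [abs_mul, abs_of_nonneg hT0, mul_comm]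
        gcongr
        exact hC.deriv i y hy
      calc _ ≤ 1 / 2 * (τ * (C * h ^ 2) * (2 * (C * (τ * h)))) := by gcongr
        _ = C ^ 2 * h * (τ * h) ^ 2 := by ring
        _ ≤ _ := by gcongr
    linarith
  have hcosh' : ∀ i, |Real.cosh (τ * δ i) - 1| ≤ 2 * (C * (τ * h)) ^ 2 := by
    intro i
    have h1 := abs_cosh_sub_le (hD1 i)
    have h2 : |τ * δ i| ^ 4 ≤ |τ * δ i| ^ 2 :=
      pow_le_pow_of_le_one (abs_nonneg _) (hD1 i) (by norm_num)
    have h3 : |τ * δ i| ^ 2 ≤ (C * (τ * h)) ^ 2 := by gcongr; exact hD i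
    have h4 : |τ * δ i| ^ 2 = (τ * δ i) ^ 2 := sq_abs _
    rw [abs_le] at h1 ⊢
    constructor <;> nlinarith [h1.1, h1.2]
  have hmain : ∑ i, 384 * (τ * h ^ 2) * weight y *
      ((τ * h * dirDeriv (η i) weight y) ^ 2 / 2) =
      1572864 * ‖y‖ ^ 2 * weight y ^ 3 * (τ ^ 3 * h ^ 4) := by
    have e1 : ∀ i, 384 * (τ * h ^ 2) * weight y *
        ((τ * h * dirDeriv (η i) weight y) ^ 2 / 2) =
        786432 * weight y ^ 3 * (τ ^ 3 * h ^ 4) * ⟪y, η i⟫ ^ 2 := by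
      intro i; simp only [dirDeriv_weight]; ring
    simp only [e1, ← mul_sum]
    rw [sum_inner_sq hP]; ring
  have e : energyPotential (fun i => h • η i) (fun x => τ * weight x)
        (fun x => 384 * (τ * h ^ 2) * weight x) y =
      ∑ i, 384 * (τ * h ^ 2) * weight y * ((τ * h * dirDeriv (η i) weight y) ^ 2 / 2) +
      ∑ i, (384 * (τ * h ^ 2) * weight y *
        (Real.cosh (τ * δ i) - 1 - (τ * h * dirDeriv (η i) weight y) ^ 2 / 2) +
        192 * (τ * h ^ 2) * δ i * (Real.cosh (τ * δ i) - 1)) +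
      192 * (τ * h ^ 2) * ∑ i, δ i := by
    rw [energyPotential, mul_sum, ← sum_add_distrib, ← sum_add_distrib]
    refine sum_congr rfl fun i _ => ?_
    have : τ * weight (y + h • η i) - τ * weight y = τ * δ i := by
      simp only [hδ, fwdDiff]; ring
    rw [this]
    simp only [hδ, fwdDiff]; ring
  rw [e, hmain, add_assoc]
  gcongr
  rw [add_mul, add_mul]
  refine add_le_add ?_ ?_
  · have key : ∀ i, 384 * (τ * h ^ 2) * weight y *
        (Real.cosh (τ * δ i) - 1 - (τ * h * dirDeriv (η i) weight y) ^ 2 / 2) +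
        192 * (τ * h ^ 2) * δ i * (Real.cosh (τ * δ i) - 1) ≤
        (384 * (C ^ 4 + C ^ 2) + 384 * C ^ 3) * ε * (τ ^ 3 * h ^ 4) := by
      intro i
      rw [add_mul, add_mul]
      refine add_le_add ?_ ?_
      · calc _ ≤ 384 * (τ * h ^ 2) * 1 * ((C ^ 4 + C ^ 2) * ε * (τ * h) ^ 2) := by
              refine (le_abs_self _).trans ?_
              rw [abs_mul, abs_of_nonneg (by positivity)]
              gcongr
              exact hcosh i
          _ = _ := by ring
      · calc _ ≤ 192 * (τ * h ^ 2) * (C * h) * (2 * (C * (τ * h)) ^ 2) := by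
              refine (le_abs_self _).trans ?_
              rw [abs_mul, abs_mul, abs_of_nonneg (by positivity : 0 ≤ 192 * (τ * h ^ 2))]
              gcongr
              · exact hC.diff i h y hh hh1 hy
              · exact hcosh' i
          _ = 384 * C ^ 3 * h * (τ ^ 3 * h ^ 4) := by ring
          _ ≤ _ := by gcongr
    calc _ ≤ ∑ i : ι, (384 * (C ^ 4 + C ^ 2) + 384 * C ^ 3) * ε * (τ ^ 3 * h ^ 4) :=
          sum_le_sum fun i _ => key i
      _ = _ := by simp only [sum_const, card_univ, nsmul_eq_mul]; ring
  · calc _ ≤ 192 * (τ * h ^ 2) * (C * h ^ 2) := by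
          gcongr
          exact (le_abs_self _).trans (hC.sum_diff h y hh hh1 hy)
      _ = 192 * C * 1 * (τ * h ^ 4) := by ring
      _ ≤ 192 * C * (ε * τ * τ) * (τ * h ^ 4) := by
        gcongr
        exact one_le_mul_of_one_le_of_one_le hετ hτ
      _ = _ := by ring

/-- For the quadratic form in differences of `w` only the leading order `τ h²` matters. The constant
is 36 + 1 + 1, from `cosh D - 1`, from `sinh X - X` and from the Taylor remainder of the weight. -/
theorem abs_commCoeff_sub_le (hC : WeightBounds η C) {h τ ε : ℝ} {y : E} (hh : 0 ≤ h)
    (hτ : 1 ≤ τ) (hε : τ * h ≤ ε) (hCε : 3 * C * ε ≤ 1) (hy : ‖y‖ ≤ 3) (i j : ι) :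
    |commCoeff (fun i => h • η i) (fun x => τ * weight x) i j y -
      τ * h ^ 2 * dirDeriv (η i) (dirDeriv (η j) weight) y| ≤
      38 * C ^ 3 * ε * (τ * h ^ 2) := by
  have hC1 := hC.one_le
  have hτ0 : 0 ≤ τ := by linarith
  have hT0 : 0 ≤ τ * h := mul_nonneg hτ0 hh
  have hε0 : 0 ≤ ε := hT0.trans hε
  have hhε : h ≤ ε := (le_mul_of_one_le_left hh hτ).trans hε
  have hε1 : ε ≤ 1 := by nlinarith
  have hh1 : h ≤ 1 := hhε.trans hε1
  have hT2 : (τ * h) ^ 2 ≤ ε := by nlinarith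
  set X := τ * fwdDiff (h • η i) (fwdDiff (h • η j) weight) y with hX
  set D := τ * weight (y + h • η i + h • η j) - τ * weight y with hD
  have hXb : |X| ≤ C * (τ * h ^ 2) := by
    rw [hX, abs_mul, abs_of_nonneg hτ0]
    calc _ ≤ τ * (C * h ^ 2) := by gcongr; exact hC.diff₂ i j h y hh hh1 hy
      _ = _ := by ring
  have hDb : |D| ≤ 3 * C * (τ * h) := by
    have e : D = X + τ * fwdDiff (h • η i) weight y + τ * fwdDiff (h • η j) weight y := by
      simp only [hD, hX, fwdDiff]; ring
    have c1 : |τ * fwdDiff (h • η i) weight y| ≤ C * (τ * h) := by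
      rw [abs_mul, abs_of_nonneg hτ0]
      calc _ ≤ τ * (C * h) := by gcongr; exact hC.diff i h y hh hh1 hy
        _ = _ := by ring
    have c2 : |τ * fwdDiff (h • η j) weight y| ≤ C * (τ * h) := by
      rw [abs_mul, abs_of_nonneg hτ0]
      calc _ ≤ τ * (C * h) := by gcongr; exact hC.diff j h y hh hh1 hy
        _ = _ := by ring
    have c3 : C * (τ * h ^ 2) ≤ C * (τ * h) := by
      gcongr
      nlinarith
    rw [e]
    refine (abs_add_three _ _ _).trans ?_
    linarith
  have hD1 : |D| ≤ 1 := hDb.trans (by nlinarith)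
  have hX1 : |X| ≤ 1 := hXb.trans (by
    have : C * (τ * h ^ 2) ≤ C * ε := by gcongr; nlinarith
    nlinarith)
  have e : commCoeff (fun i => h • η i) (fun x => τ * weight x) i j y -
      τ * h ^ 2 * dirDeriv (η i) (dirDeriv (η j) weight) y =
      (Real.cosh D - 1) * Real.sinh X + (Real.sinh X - X) +
        τ * (fwdDiff (h • η i) (fwdDiff (h • η j) weight) y -
          h ^ 2 * dirDeriv (η i) (dirDeriv (η j) weight) y) := by
    have : commCoeff (fun i => h • η i) (fun x => τ * weight x) i j y =
        Real.cosh D * Real.sinh X := by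
      unfold commCoeff
      congr 2
      simp only [hX, fwdDiff]
      ring
    rw [this, hX]; ring
  have b1 : |(Real.cosh D - 1) * Real.sinh X| ≤ 36 * C ^ 3 * ε * (τ * h ^ 2) := by
    have h1 := abs_cosh_sub_le hD1
    have h2 : |D| ^ 4 ≤ |D| ^ 2 := pow_le_pow_of_le_one (abs_nonneg _) hD1 (by norm_num)
    have h3 : |D| ^ 2 ≤ (3 * C * (τ * h)) ^ 2 := by gcongr
    have h4 : |D| ^ 2 = D ^ 2 := sq_abs _
    have h5 : |Real.cosh D - 1| ≤ 2 * (3 * C * (τ * h)) ^ 2 := by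
      rw [abs_le] at h1 ⊢
      constructor <;> nlinarith [h1.1, h1.2]
    rw [abs_mul]
    calc _ ≤ 2 * (3 * C * (τ * h)) ^ 2 * (2 * (C * (τ * h ^ 2))) := by
          gcongr
          exact (abs_sinh_le hX1).trans (by linarith)
      _ = 36 * C ^ 3 * (τ * h) ^ 2 * (τ * h ^ 2) := by ring
      _ ≤ _ := by gcongr
  have b2 : |Real.sinh X - X| ≤ C ^ 3 * ε * (τ * h ^ 2) := by
    refine (abs_sinh_sub_le hX1).trans ?_
    calc _ ≤ (C * (τ * h ^ 2)) ^ 3 := by gcongr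
      _ = C ^ 3 * (τ * h) ^ 2 * (τ * h ^ 2) * h ^ 2 := by ring
      _ ≤ C ^ 3 * ε * (τ * h ^ 2) * 1 := by
        gcongr
        exact pow_le_one₀ hh hh1
      _ = _ := by ring
  have b3 : |τ * (fwdDiff (h • η i) (fwdDiff (h • η j) weight) y -
          h ^ 2 * dirDeriv (η i) (dirDeriv (η j) weight) y)| ≤ C ^ 3 * ε * (τ * h ^ 2) := by
    rw [abs_mul, abs_of_nonneg hτ0]
    calc _ ≤ τ * (C * h ^ 3) := by gcongr; exact hC.diff₂_sub i j h y hh hh1 hy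
      _ = C ^ 1 * h * (τ * h ^ 2) := by ring
      _ ≤ _ := by gcongr; norm_num
  rw [e]
  refine (abs_add_three _ _ _).trans ?_
  linarith

/-- The right-hand side is `2621440 r² (25.6 r² - 1) g³`, positive once `r² > 5 / 128`. At `r = 1 /
4` the coefficient of `g³` is exactly 98304. -/
theorem potential_margin {κ g₂ g r : ℝ} (hκ : κ = 98304 * g₂ ^ 3) (hg₂ : 0 < g₂) (hg : g₂ ≤ g)
    (hr : 1 / 4 ≤ r) :
    κ ≤ 1048576 * (64 * r ^ 4 - r ^ 2) * g ^ 3 - 1572864 * r ^ 2 * g ^ 3 := by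
  have q0 : 1 / 16 ≤ r ^ 2 := by nlinarith
  have q1 : 98304 ≤ 1048576 * (64 * r ^ 4 - r ^ 2) - 1572864 * r ^ 2 := by
    have : r ^ 4 = r ^ 2 * r ^ 2 := by ring
    nlinarith
  have q2 : g₂ ^ 3 ≤ g ^ 3 := pow_le_pow_left₀ hg₂.le hg 3
  have q3 : 0 ≤ g₂ ^ 3 := pow_nonneg hg₂.le 3
  rw [hκ]
  nlinarith [mul_le_mul q1 q2 q3 (by linarith)]

/-- The position map `X` only has to be equivariant and is quantified after the constants, so
shifted copies of the lattice, such as the two layers, are covered uniformly. -/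
theorem exists_carleman [FiniteDimensional ℝ E] {Λ : Type*} [AddCommGroup Λ] {v : ι → Λ}
    (hv : ∀ i, v (σ i) = -v i) (hη : ∀ i, η (σ i) = -η i)
    (hP : ∀ x y : E, ∑ i, ⟪x, η i⟫ * ⟪y, η i⟫ = 2 * ⟪x, y⟫) :
    ∃ c ε : ℝ, 0 < c ∧ 0 < ε ∧ ε ≤ 1 ∧ ∀ (h τ : ℝ) (X : Λ → E), 0 < h → 1 ≤ ε * τ → τ * h ≤ ε →
      (∀ l i, X (l + v i) = X l + h • η i) → ∀ w : Λ → ℝ, w.support.Finite →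
      (∀ l, w l ≠ 0 → 1 / 4 ≤ ‖X l‖ ∧ ‖X l‖ ≤ 2) →
      c * (τ ^ 3 * h ^ 4) * ∑' l, w l ^ 2 ≤
        ∑' l, (∑ i, (Real.exp (τ * weight (X l) - τ * weight (X (l + v i))) * w (l + v i) -
          w l)) ^ 2 := by
  obtain ⟨C, hC⟩ := exists_weightBounds hη
  obtain ⟨K₁, hK₁⟩ := abs_commPotential_sub_le hη hP hC
  obtain ⟨K₂, hK₂⟩ := energyPotential_le hP hC
  obtain ⟨B, hB1, hB⟩ := exists_uniform_const (P := fun i B => ‖η i‖ ≤ B)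
    (fun i a b hab H => H.trans hab) (fun i => ⟨_, le_rfl⟩)
  have hC1 := hC.one_le
  obtain ⟨g₂, hg₂⟩ : ∃ r : ℝ, r = Real.exp (-(32 * 2 ^ 2)) := ⟨_, rfl⟩
  obtain ⟨g₃, hg₃⟩ : ∃ r : ℝ, r = Real.exp (-(32 * 3 ^ 2)) := ⟨_, rfl⟩
  have hg₂0 : 0 < g₂ := hg₂ ▸ Real.exp_pos _
  have hg₃0 : 0 < g₃ := hg₃ ▸ Real.exp_pos _
  obtain ⟨κ, hκ⟩ : ∃ r : ℝ, r = 98304 * g₂ ^ 3 := ⟨_, rfl⟩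
  have hκ0 : 0 < κ := by rw [hκ]; positivity
  obtain ⟨N, hN⟩ : ∃ r : ℝ, r = ((Fintype.card ι : ℕ) : ℝ) := ⟨_, rfl⟩
  have hN0 : 0 ≤ N := hN ▸ Nat.cast_nonneg _
  obtain ⟨A₁, hA₁'⟩ : ∃ r : ℝ, r = 2 * (|K₁| + |K₂| + 36864) / κ := ⟨_, rfl⟩
  obtain ⟨A₂, hA₂'⟩ : ∃ r : ℝ, r = N * (152 * C ^ 3) / (128 * g₃) := ⟨_, rfl⟩
  have hA₁ : 0 ≤ A₁ := by rw [hA₁']; positivity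
  have hA₂ : 0 ≤ A₂ := by rw [hA₂']; positivity
  -- `ε` will be `A⁻¹`. The summands serve, in turn, `ε ≤ 1`, the validity of the Taylor bounds, the
  -- loss of at most half of the margin `κ`, the slack 128 in `ψ`, and the shortness of the edges.
  obtain ⟨A, hA⟩ : ∃ r : ℝ, r = 1 + 3 * C + A₁ + A₂ + 2 * B := ⟨_, rfl⟩
  have hA0 : 0 < A := by linarith
  have hAε : ∀ a, a ≤ A → a * A⁻¹ ≤ 1 := fun a ha => by
    rw [mul_inv_le_iff₀ hA0]; linarith
  have hε0 : 0 < A⁻¹ := inv_pos.2 hA0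
  obtain ⟨ε, hεdef⟩ : ∃ r : ℝ, r = A⁻¹ := ⟨_, rfl⟩
  rw [← hεdef] at hε0
  simp only [← hεdef] at hAε
  have ε1 : ε ≤ 1 := by simpa using hAε 1 (by linarith)
  have ε2 : 3 * C * ε ≤ 1 := hAε _ (by linarith)
  have ε3 : 2 * (|K₁| + |K₂| + 36864) * ε ≤ κ := by
    have := hAε A₁ (by linarith)
    rw [hA₁', div_mul_eq_mul_div, div_le_one hκ0] at this
    exact this
  have ε4 : N * (152 * C ^ 3) * ε ≤ 128 * g₃ := by
    have := hAε A₂ (by linarith)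
    rw [hA₂', div_mul_eq_mul_div, div_le_one (by positivity)] at this
    exact this
  have ε5 : 2 * B * ε ≤ 1 := hAε _ (by linarith)
  refine ⟨κ / 2, ε, by positivity, hε0, ε1, fun h τ X hh hετ hε hX w hw hsupp => ?_⟩
  have hτ : 1 ≤ τ := by
    by_contra hcon
    nlinarith
  have hτ0 : 0 ≤ τ := by linarith
  have hhε : h ≤ ε := (le_mul_of_one_le_left hh.le hτ).trans hε
  have hcomm : ∀ i j l, commCoeff v (fun l => τ * weight (X l)) i j l =
      commCoeff (fun i => h • η i) (fun x => τ * weight x) i j (X l) := by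
    intro i j l; simp only [commCoeff, hX]
  have hpot : ∀ l, commPotential v (fun l => τ * weight (X l)) l =
      commPotential (fun i => h • η i) (fun x => τ * weight x) (X l) := by
    intro l; simp only [commPotential, hX]
  have hen : ∀ l, energyPotential v (fun l => τ * weight (X l))
      (fun l => 384 * (τ * h ^ 2) * weight (X l)) l =
      energyPotential (fun i => h • η i) (fun x => τ * weight x)
        (fun x => 384 * (τ * h ^ 2) * weight x) (X l) := by
    intro l; simp only [energyPotential, hX]
  -- In the density `ψ`, 384 = 256 + 128: the first part is the bound for the Hessian form, the
  -- second pays for its Taylor error.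
  have hmain := tsum_sq_ge hv hw (fun l => τ * weight (X l))
    (fun l => 384 * (τ * h ^ 2) * weight (X l)) (fun l => by
    -- Beyond radius 3 the whole stencil misses the support of `w`, so both sides vanish.
    by_cases hl : ‖X l‖ ≤ 3
    · have hg : g₃ ≤ weight (X l) := hg₃ ▸ weight_anti hl
      set t : ι → ℝ := fun i => w (l + v i) - w l with ht
      have ht' : ∀ i j, w (l + v i) - w (l + v j) = t i - t j := fun i j => by simp [ht]
      simp only [hcomm, ht']
      have b1 : ∀ i j, commCoeff (fun i => h • η i) (fun x => τ * weight x) i j (X l) *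
          (t i - t j) ^ 2 ≤ τ * h ^ 2 * weight (X l) *
            ((-64 * ⟪η i, η j⟫ + 4096 * ⟪X l, η i⟫ * ⟪X l, η j⟫) * (t i - t j) ^ 2) +
          38 * C ^ 3 * ε * (τ * h ^ 2) * (2 * t i ^ 2 + 2 * t j ^ 2) := by
        intro i j
        have c1 := (abs_le.1 (abs_commCoeff_sub_le hC hh.le hτ hε ε2 hl i j)).2
        rw [dirDeriv_dirDeriv_weight] at c1
        have c2 : (t i - t j) ^ 2 ≤ 2 * t i ^ 2 + 2 * t j ^ 2 := by
          nlinarith [sq_nonneg (t i + t j)]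
        have c3 := mul_le_mul_of_nonneg_right c1 (sq_nonneg (t i - t j))
        have c4 := mul_le_mul_of_nonneg_left c2
          (by positivity : 0 ≤ 38 * C ^ 3 * ε * (τ * h ^ 2))
        linarith
      have b2 := sum_le_sum fun i (_ : i ∈ univ) => sum_le_sum fun j (_ : j ∈ univ) => b1 i j
      refine b2.trans ?_
      simp only [sum_add_distrib, ← mul_sum, sum_const, card_univ, nsmul_eq_mul]
      have b3 := sum_hessian_mul_sub_sq_le hP hη (X l) t
      have b4 : ∑ i, t i ^ 2 ≤
          ∑ i, Real.cosh (τ * weight (X (l + v i)) - τ * weight (X l)) * t i ^ 2 :=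
        sum_le_sum fun i _ => le_mul_of_one_le_left (sq_nonneg _) (Real.one_le_cosh _)
      have hg0 := weight_pos (X l)
      have hS : 0 ≤ ∑ i, t i ^ 2 := sum_nonneg fun i _ => sq_nonneg _
      calc _ ≤ τ * h ^ 2 * weight (X l) * (256 * ∑ i, t i ^ 2) +
            (N * (152 * C ^ 3) * ε) * (τ * h ^ 2) * ∑ i, t i ^ 2 := by
            refine add_le_add (mul_le_mul_of_nonneg_left b3 (by positivity)) (le_of_eq ?_)
            rw [hN]; ring
        _ ≤ τ * h ^ 2 * weight (X l) * (256 * ∑ i, t i ^ 2) +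
            (128 * weight (X l)) * (τ * h ^ 2) * ∑ i, t i ^ 2 := by
            have c1 := mul_le_mul_of_nonneg_right (ε4.trans
              (mul_le_mul_of_nonneg_left hg (by norm_num)))
              (by positivity : 0 ≤ τ * h ^ 2 * ∑ i, t i ^ 2)
            linarith
        _ = 384 * (τ * h ^ 2) * weight (X l) * ∑ i, t i ^ 2 := by ring
        _ ≤ _ := by gcongr
    · rw [not_le] at hl
      have hz : ∀ i, w (l + v i) = 0 := by
        intro i
        by_contra hcon
        have h1 := (hsupp _ hcon).2
        rw [hX] at h1
        have h2 : ‖X l‖ ≤ ‖X l + h • η i‖ + ‖h • η i‖ := by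
          simpa using norm_sub_le (X l + h • η i) (h • η i)
        have h3 : ‖h • η i‖ ≤ 1 := by
          rw [norm_smul, Real.norm_of_nonneg hh.le]
          nlinarith [hB i, norm_nonneg (η i)]
        linarith
      have hz0 : w l = 0 := by
        by_contra hcon
        linarith [(hsupp _ hcon).2]
      simp [hz, hz0])
  refine le_trans ?_ hmain
  have s0 : ∀ f : Λ → ℝ, Summable fun x => w x ^ 2 * f x :=
    fun f => summable_of_stencil (v := v) hw fun x h _ => by simp [h]
  have s1 : Summable fun x => w x ^ 2 :=
    summable_of_stencil (v := v) hw fun x h _ => by simp [h]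
  rw [← tsum_mul_left]
  refine Summable.tsum_le_tsum (fun l => ?_) (s1.mul_left _) (s0 _)
  by_cases hwl : w l = 0
  · simp [hwl]
  obtain ⟨hl1, hl2⟩ := hsupp l hwl
  rw [mul_comm]
  refine mul_le_mul_of_nonneg_left ?_ (sq_nonneg _)
  rw [hpot, hen]
  have p1 := (abs_le.1 (hK₁ h τ ε (X l) hh.le hτ hετ hε (by nlinarith) (by linarith))).1
  have p2 := hK₂ h τ ε (X l) hh.le hτ hετ hε (by nlinarith) (by linarith)
  have hg : g₂ ≤ weight (X l) := hg₂ ▸ weight_anti hl2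
  have hg0 := weight_pos (X l)
  have hg1 := weight_le_one (X l)
  have hu : 0 ≤ τ ^ 3 * h ^ 4 := by positivity
  -- The square of `ψ` has only two powers of `τ`; the missing one is supplied by `1 ≤ ε * τ`.
  have p3 : (384 * (τ * h ^ 2) * weight (X l)) ^ 2 / 4 ≤ 36864 * ε * (τ ^ 3 * h ^ 4) := by
    calc _ = 36864 * 1 * (τ ^ 2 * h ^ 4) * weight (X l) ^ 2 := by ring
      _ ≤ 36864 * (ε * τ) * (τ ^ 2 * h ^ 4) * 1 := by
        gcongr
        exact pow_le_one₀ hg0.le hg1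
      _ = _ := by ring
  have p4 := potential_margin hκ hg₂0 hg hl1
  have p5 := mul_le_mul_of_nonneg_right p4 hu
  have p6 := mul_le_mul_of_nonneg_right ε3 hu
  have p7 : K₁ * ε * (τ ^ 3 * h ^ 4) ≤ |K₁| * ε * (τ ^ 3 * h ^ 4) := by
    gcongr; exact le_abs_self _
  have p8 : K₂ * ε * (τ ^ 3 * h ^ 4) ≤ |K₂| * ε * (τ ^ 3 * h ^ 4) := by
    gcongr; exact le_abs_self _
  linarith

end Carleman

end DiscreteCarleman

namespace DiscreteCarleman

open Finset
open scoped ContDiff RealInnerProductSpace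

/-! ### Masses and a discrete Caccioppoli inequality -/

section Caccioppoli

variable {Λ : Type*}

/-- The squared `ℓ²` norm on a set. -/
noncomputable def mass (A : Set Λ) (u : Λ → ℝ) : ℝ := ∑' l, A.indicator (fun l => u l ^ 2) l

theorem summable_indicator {A : Set Λ} (hA : A.Finite) (f : Λ → ℝ) : Summable (A.indicator f) :=
  summable_of_hasFiniteSupport (hA.subset Set.support_indicator_subset)

theorem mass_nonneg (A : Set Λ) (u : Λ → ℝ) : 0 ≤ mass A u :=
  tsum_nonneg fun l => Set.indicator_nonneg (fun _ _ => sq_nonneg _) l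

theorem mass_mono {A B : Set Λ} (hAB : A ⊆ B) (hB : B.Finite) (u : Λ → ℝ) :
    mass A u ≤ mass B u :=
  Summable.tsum_le_tsum (fun l => Set.indicator_le_indicator_of_subset hAB
    (fun _ => sq_nonneg _) l) (summable_indicator (hB.subset hAB) _) (summable_indicator hB _)

variable [AddCommGroup Λ]

theorem mass_comp_add_le {A B : Set Λ} (a : Λ) (hAB : ∀ l ∈ A, l + a ∈ B) (hB : B.Finite)
    (u : Λ → ℝ) : mass A (fun l => u (l + a)) ≤ mass B u := by
  have hB' : Function.HasFiniteSupport fun l => B.indicator (fun l => u l ^ 2) (l + a) :=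
    (hB.preimage (add_left_injective a).injOn).subset fun l hl => by
      by_contra hc
      exact hl (Set.indicator_of_notMem (s := B) hc _)
  have hA : A.Finite := (hB.preimage (add_left_injective a).injOn).subset hAB
  have key : ∀ l, A.indicator (fun l => u (l + a) ^ 2) l ≤
      B.indicator (fun l => u l ^ 2) (l + a) := by
    intro l
    by_cases h : l ∈ A
    · rw [Set.indicator_of_mem h, Set.indicator_of_mem (hAB l h)]
    · rw [Set.indicator_of_notMem h]
      exact Set.indicator_nonneg (fun _ _ => sq_nonneg _) _
  exact (Summable.tsum_le_tsum key (summable_indicator hA _)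
    (summable_of_hasFiniteSupport hB')).trans_eq (tsum_shift a _)

variable {ι : Type*} [Fintype ι]

/-- The graph Laplacian with the edge vectors `v i`. -/
def lap (v : ι → Λ) (u : Λ → ℝ) (l : Λ) : ℝ := ∑ i, (u (l + v i) - u l)

variable {v : ι → Λ} {σ : Equiv.Perm ι}

theorem sum_tsum_shift_perm (hv : ∀ i, v (σ i) = -v i) (f : Λ → Λ → ℝ) :
    ∑ i, ∑' l, f l (l + v i) = ∑ i, ∑' l, f (l + v i) l := by
  rw [← Equiv.sum_comp σ]
  refine sum_congr rfl fun i _ => ?_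
  rw [← tsum_shift (v i)]
  exact tsum_congr fun l => by rw [hv, add_neg_cancel_right]

/-- A discrete Caccioppoli inequality. -/
theorem caccioppoli (hv : ∀ i, v (σ i) = -v i) {Z u g : Λ → ℝ} {A : Set Λ} {h κ : ℝ}
    (hA : A.Finite) (hZ1 : ∀ l, |Z l| ≤ 1) (hZA : ∀ l, Z l ≠ 0 → l ∈ A)
    (hZA' : ∀ l i, Z (l + v i) ≠ 0 → l ∈ A) (hκ : ∀ l i, |Z (l + v i) - Z l| ≤ κ)
    (hu : ∀ l ∈ A, |lap v u l| ≤ h ^ 2 * g l) :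
    ∑' l, ∑ i, (Z (l + v i) * u (l + v i) - Z l * u l) ^ 2 ≤
      (h ^ 2 + Fintype.card ι * κ ^ 2) * (mass A u + mass A g) := by
  have hZ : Z.support.Finite := hA.subset hZA
  have st : ∀ {f : Λ → ℝ}, (∀ x, Z x = 0 → (∀ i, Z (x + v i) = 0) → f x = 0) → Summable f :=
    fun hf => summable_of_stencil (v := v) hZ hf
  have sA := fun f : Λ → ℝ => summable_indicator hA f
  set F : Λ → ℝ := fun l => Z l ^ 2 * u l with hF
  -- Discrete form of `|∇(Zu)|² = ∇(Z²u)·∇u + |∇Z|²u²`; the first product is then summed by parts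
  -- onto the Laplacian of `u`.
  have e1 : ∀ l i, (Z (l + v i) * u (l + v i) - Z l * u l) ^ 2 =
      F (l + v i) * u (l + v i) - F (l + v i) * u l - F l * u (l + v i) + F l * u l +
        (Z (l + v i) - Z l) ^ 2 * (u l * u (l + v i)) := by
    intro l i; simp only [hF]; ring
  have s1 : ∀ i, Summable fun l => F (l + v i) * u (l + v i) := fun i =>
    st fun l h0 h1 => by simp [hF, h1]
  have s2 : ∀ i, Summable fun l => F (l + v i) * u l := fun i =>
    st fun l h0 h1 => by simp [hF, h1]
  have s3 : ∀ i, Summable fun l => F l * u (l + v i) := fun i =>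
    st fun l h0 h1 => by simp [hF, h0]
  have s4 : Summable fun l => F l * u l := st fun l h0 h1 => by simp [hF, h0]
  have s5 : ∀ i, Summable fun l => (Z (l + v i) - Z l) ^ 2 * (u l * u (l + v i)) := fun i =>
    st fun l h0 h1 => by simp [h0, h1]
  have s6 : ∀ i, Summable fun l => (Z (l + v i) - Z l) ^ 2 * u l ^ 2 := fun i =>
    st fun l h0 h1 => by simp [h0, h1]
  have s7 : ∀ i, Summable fun l => (Z (l + v i) - Z l) ^ 2 * u (l + v i) ^ 2 := fun i =>
    st fun l h0 h1 => by simp [h0, h1]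
  have s8 : Summable fun l => F l * lap v u l := st fun l h0 h1 => by simp [hF, h0]
  have c1 : ∑ i, ∑' l, F (l + v i) * u l = ∑ i, ∑' l, F l * u (l + v i) :=
    (sum_tsum_shift_perm hv fun a b => F a * u b).symm
  have c2 : ∑ i, ∑' l, (Z (l + v i) - Z l) ^ 2 * u (l + v i) ^ 2 =
      ∑ i, ∑' l, (Z (l + v i) - Z l) ^ 2 * u l ^ 2 := by
    rw [← sum_tsum_shift_perm hv fun a b => (Z a - Z b) ^ 2 * u a ^ 2]
    refine sum_congr rfl fun i _ => tsum_congr fun l => by ring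
  have hgrad : ∑' l, ∑ i, (Z (l + v i) * u (l + v i) - Z l * u l) ^ 2 =
      -2 * ∑' l, F l * lap v u l +
        ∑ i, ∑' l, (Z (l + v i) - Z l) ^ 2 * (u l * u (l + v i)) := by
    have e2 : ∀ i, ∑' l, (Z (l + v i) * u (l + v i) - Z l * u l) ^ 2 =
        ∑' l, F (l + v i) * u (l + v i) - ∑' l, F (l + v i) * u l - ∑' l, F l * u (l + v i) +
          ∑' l, F l * u l + ∑' l, (Z (l + v i) - Z l) ^ 2 * (u l * u (l + v i)) := by
      intro i
      rw [← (s1 i).tsum_sub (s2 i), ← ((s1 i).sub (s2 i)).tsum_sub (s3 i),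
        ← (((s1 i).sub (s2 i)).sub (s3 i)).tsum_add s4,
        ← ((((s1 i).sub (s2 i)).sub (s3 i)).add s4).tsum_add (s5 i)]
      exact tsum_congr fun l => e1 l i
    have e3 : ∀ i, ∑' l, F (l + v i) * u (l + v i) = ∑' l, F l * u l := fun i =>
      tsum_shift (v i) fun l => F l * u l
    have e4 : ∑' l, F l * lap v u l =
        ∑ i, ∑' l, F l * u (l + v i) - ∑ i : ι, ∑' l, F l * u l := by
      rw [← Summable.tsum_finsetSum fun i _ => s3 i, ← Summable.tsum_finsetSum fun i _ => s4,
        ← Summable.tsum_sub (summable_sum fun i _ => s3 i) (summable_sum fun i _ => s4)]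
      refine tsum_congr fun l => ?_
      rw [lap, mul_sum, ← sum_sub_distrib]
      exact sum_congr rfl fun i _ => by ring
    rw [Summable.tsum_finsetSum fun i _ => st fun l h0 h1 => by simp [h0, h1]]
    simp only [e2, e3, sum_add_distrib, sum_sub_distrib]
    rw [c1, e4]; ring
  have hcross : ∑ i, ∑' l, (Z (l + v i) - Z l) ^ 2 * (u l * u (l + v i)) ≤
      Fintype.card ι * κ ^ 2 * mass A u := by
    have b1 : ∑ i, ∑' l, (Z (l + v i) - Z l) ^ 2 * (u l * u (l + v i)) ≤
        ∑ i, (1 / 2 * ∑' l, (Z (l + v i) - Z l) ^ 2 * u l ^ 2 +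
          1 / 2 * ∑' l, (Z (l + v i) - Z l) ^ 2 * u (l + v i) ^ 2) := by
      refine sum_le_sum fun i _ => ?_
      rw [← tsum_mul_left, ← tsum_mul_left,
        ← ((s6 i).mul_left _).tsum_add ((s7 i).mul_left _)]
      refine (s5 i).tsum_le_tsum (fun l => ?_) (((s6 i).mul_left _).add ((s7 i).mul_left _))
      nlinarith [mul_nonneg (sq_nonneg (Z (l + v i) - Z l)) (sq_nonneg (u l - u (l + v i)))]
    have b2 : ∀ i, ∑' l, (Z (l + v i) - Z l) ^ 2 * u l ^ 2 ≤ κ ^ 2 * mass A u := by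
      intro i
      rw [mass, ← tsum_mul_left]
      refine (s6 i).tsum_le_tsum (fun l => ?_) ((sA _).mul_left _)
      by_cases hl : l ∈ A
      · rw [Set.indicator_of_mem hl]
        exact mul_le_mul_of_nonneg_right
          (sq_le_sq' (abs_le.1 (hκ l i)).1 (abs_le.1 (hκ l i)).2) (sq_nonneg _)
      · have h0 : Z l = 0 := by by_contra hc; exact hl (hZA l hc)
        have h1 : Z (l + v i) = 0 := by by_contra hc; exact hl (hZA' l i hc)
        simp [h0, h1, hl]
    refine b1.trans ?_
    rw [sum_add_distrib, ← mul_sum, ← mul_sum, c2]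
    calc _ = ∑ i, ∑' l, (Z (l + v i) - Z l) ^ 2 * u l ^ 2 := by ring
      _ ≤ ∑ i : ι, κ ^ 2 * mass A u := sum_le_sum fun i _ => b2 i
      _ = _ := by simp only [sum_const, card_univ, nsmul_eq_mul]; ring
  have hlap : -2 * ∑' l, F l * lap v u l ≤ h ^ 2 * (mass A u + mass A g) := by
    rw [mass, mass, ← (sA _).tsum_add (sA _), ← tsum_mul_left, ← tsum_mul_left]
    refine (s8.mul_left _).tsum_le_tsum (fun l => ?_) (((sA _).add (sA _)).mul_left _)
    by_cases hl : l ∈ A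
    · rw [Set.indicator_of_mem hl, Set.indicator_of_mem hl]
      have b1 : |F l| ≤ |u l| := by
        simp only [hF]
        rw [abs_mul, abs_pow]
        exact mul_le_of_le_one_left (abs_nonneg _) (pow_le_one₀ (abs_nonneg _) (hZ1 l))
      have b2 : |F l * lap v u l| ≤ |u l| * (h ^ 2 * g l) := by
        rw [abs_mul]
        exact mul_le_mul b1 (hu l hl) (abs_nonneg _) (abs_nonneg _)
      have b3 := neg_le_of_abs_le b2
      have b4 := sq_abs (u l)
      nlinarith [mul_nonneg (sq_nonneg h) (sq_nonneg (|u l| - g l))]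
    · have h0 : Z l = 0 := by by_contra hc; exact hl (hZA l hc)
      simp [hF, h0, hl]
  rw [hgrad]
  have : 0 ≤ Fintype.card ι * κ ^ 2 * mass A g := mul_nonneg (by positivity) (mass_nonneg _ _)
  linarith

end Caccioppoli

/-! ### Smooth radial cutoff functions -/

section Cutoff

variable {E : Type*} [NormedAddCommGroup E] [InnerProductSpace ℝ E]

theorem exists_ball_cutoff {a b : ℝ} (ha : 0 < a) (hab : a < b) :
    ∃ χ : E → ℝ, ContDiff ℝ ∞ χ ∧ (∀ x, 0 ≤ χ x) ∧ (∀ x, χ x ≤ 1) ∧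
      (∀ x, ‖x‖ ≤ a → χ x = 1) ∧ ∀ x, b ≤ ‖x‖ → χ x = 0 := by
  let f : ContDiffBump (0 : E) := ⟨a, b, ha, hab⟩
  refine ⟨f, f.contDiff, fun x => f.nonneg, fun x => f.le_one, fun x hx => ?_, fun x hx => ?_⟩
  · exact f.one_of_mem_closedBall (by simpa [f] using hx)
  · exact f.zero_of_le_dist (by simpa [f] using hx)

theorem exists_annulus_cutoff {a b c d : ℝ} (ha : 0 < a) (hab : a < b) (hbc : b ≤ c)
    (hcd : c < d) : ∃ χ : E → ℝ, ContDiff ℝ ∞ χ ∧ (∀ x, 0 ≤ χ x) ∧ (∀ x, χ x ≤ 1) ∧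
      (∀ x, ‖x‖ ≤ a → χ x = 0) ∧ (∀ x, b ≤ ‖x‖ → ‖x‖ ≤ c → χ x = 1) ∧
      ∀ x, d ≤ ‖x‖ → χ x = 0 := by
  obtain ⟨f, hf, hf0, hf1, hfa, hfb⟩ := exists_ball_cutoff (E := E) ha hab
  obtain ⟨g, hg, hg0, hg1, hgc, hgd⟩ :=
    exists_ball_cutoff (E := E) (ha.trans (hab.trans_le hbc)) hcd
  refine ⟨fun x => g x * (1 - f x), hg.mul (contDiff_const.sub hf), fun x => ?_, fun x => ?_,
    fun x hx => ?_, fun x hx hx' => ?_, fun x hx => ?_⟩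
  · exact mul_nonneg (hg0 x) (by linarith [hf1 x])
  · exact mul_le_one₀ (hg1 x) (by linarith [hf1 x]) (by linarith [hf0 x])
  · simp [hfa x hx]
  · simp [hfb x hx, hgc x hx']
  · simp [hgd x hx]

variable [FiniteDimensional ℝ E] {ι : Type*} [Fintype ι] {η : ι → E} {σ : Equiv.Perm ι}

/-- The bounds become global in `x` because outside radius 3 an edge of length at most 1 cannot
reach the support of `χ`. -/
theorem exists_cutoff_bound (hη : ∀ i, η (σ i) = -η i) {χ : E → ℝ} (hχ : ContDiff ℝ ∞ χ)
    (h2 : ∀ x, 2 ≤ ‖x‖ → χ x = 0) :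
    ∃ C, 1 ≤ C ∧ ∀ h, 0 ≤ h → h ≤ 1 → (∀ i, h * ‖η i‖ ≤ 1) → ∀ x,
      (∀ i, |χ (x + h • η i) - χ x| ≤ C * h) ∧ |∑ i, (χ (x + h • η i) - χ x)| ≤ C * h ^ 2 := by
  obtain ⟨C₁, -, hC₁⟩ := exists_uniform_const
    (P := fun i C => ∀ h (x : E), 0 ≤ h → h ≤ 1 → ‖x‖ ≤ 3 → |iterDiff h [η i] χ x| ≤ C * h ^ 1)
    (fun i a b hab H h x hh hh1 hx => (H h x hh hh1 hx).trans
      (mul_le_mul_of_nonneg_right hab (by positivity)))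
    (fun i => exists_abs_iterDiff_le [η i] hχ 3)
  obtain ⟨C₂, hC₂⟩ := exists_abs_sum_fwdDiff_le hη hχ 3
  refine ⟨max 1 (max C₁ C₂), le_max_left _ _, fun h hh hh1 hηh x => ?_⟩
  by_cases hx : ‖x‖ ≤ 3
  · constructor
    · intro i
      have := hC₁ i h x hh hh1 hx
      rw [pow_one] at this
      exact this.trans (mul_le_mul_of_nonneg_right
        ((le_max_left _ _).trans (le_max_right _ _)) hh)
    · exact (hC₂ h x hh hh1 hx).trans (mul_le_mul_of_nonneg_right
        ((le_max_right _ _).trans (le_max_right _ _)) (by positivity))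
  · rw [not_le] at hx
    have h0 : χ x = 0 := h2 x (by linarith)
    have h1 : ∀ i, χ (x + h • η i) = 0 := by
      intro i
      apply h2
      have e1 : ‖x‖ ≤ ‖x + h • η i‖ + ‖h • η i‖ := by
        simpa using norm_sub_le (x + h • η i) (h • η i)
      rw [norm_smul, Real.norm_of_nonneg hh] at e1
      linarith [hηh i]
    have hm : (0 : ℝ) ≤ max 1 (max C₁ C₂) := zero_le_one.trans (le_max_left _ _)
    simp only [h0, h1, sub_zero, abs_zero, sum_const_zero]
    exact ⟨fun _ => by positivity, by positivity⟩

end Cutoff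

end DiscreteCarleman

namespace DiscreteCarleman

open Finset
open scoped ContDiff RealInnerProductSpace

/-! ### The Carleman estimate for one layer, with cutoff errors -/

section Layer

variable {E : Type*} [NormedAddCommGroup E]

/-- The value of the weight at the outer cutoff region. -/
noncomputable def outerWeight : ℝ := Real.exp (-(32 * (13 / 10) ^ 2))

variable {Λ : Type*}

/-- The region of the inner cutoff. -/
def innerRegion (X : Λ → E) : Set Λ := {l | ‖X l‖ ≤ 23 / 50}

/-- The region of the outer cutoff. -/
def outerRegion (X : Λ → E) : Set Λ := {l | 13 / 10 ≤ ‖X l‖ ∧ ‖X l‖ ≤ 37 / 20}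

theorem mem_innerRegion {X : Λ → E} {l : Λ} : l ∈ innerRegion X ↔ ‖X l‖ ≤ 23 / 50 := Iff.rfl

theorem mem_outerRegion {X : Λ → E} {l : Λ} :
    l ∈ outerRegion X ↔ 13 / 10 ≤ ‖X l‖ ∧ ‖X l‖ ≤ 37 / 20 := Iff.rfl

/-- The cutoff function times the exponential weight. -/
noncomputable def cutWeight (χ : E → ℝ) (τ : ℝ) (x : E) : ℝ := χ x * Real.exp (τ * weight x)

theorem exp_weight_sq_le {τ : ℝ} (hτ : 0 ≤ τ) (x : E) :
    Real.exp (τ * weight x) ^ 2 ≤ Real.exp (2 * τ) := by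
  rw [← Real.exp_nat_mul]
  refine Real.exp_le_exp.2 ?_
  push_cast
  nlinarith [weight_le_one x]

theorem exp_weight_sq_le_outer {τ : ℝ} (hτ : 0 ≤ τ) {x : E} (hx : 13 / 10 ≤ ‖x‖) :
    Real.exp (τ * weight x) ^ 2 ≤ Real.exp (2 * τ * outerWeight) := by
  rw [← Real.exp_nat_mul]
  refine Real.exp_le_exp.2 ?_
  push_cast
  have : weight x ≤ outerWeight := weight_le (by norm_num) hx
  nlinarith

variable [InnerProductSpace ℝ E]

/-- Smooth cutoff functions to the annulus in which the Carleman estimate is applied. -/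
structure IsCutoff (χ : E → ℝ) : Prop where
  smooth : ContDiff ℝ ∞ χ
  nonneg : ∀ x, 0 ≤ χ x
  le_one : ∀ x, χ x ≤ 1
  zero_in : ∀ x, ‖x‖ ≤ 3 / 10 → χ x = 0
  one : ∀ x, 2 / 5 ≤ ‖x‖ → ‖x‖ ≤ 7 / 5 → χ x = 1
  zero_out : ∀ x, 17 / 10 ≤ ‖x‖ → χ x = 0

theorem exists_isCutoff : ∃ χ : E → ℝ, IsCutoff χ := by
  obtain ⟨χ, h1, h2, h3, h4, h5, h6⟩ := exists_annulus_cutoff (E := E)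
    (by norm_num : (0 : ℝ) < 3 / 10) (by norm_num : (3 / 10 : ℝ) < 2 / 5)
    (by norm_num : (2 / 5 : ℝ) ≤ 7 / 5) (by norm_num : (7 / 5 : ℝ) < 17 / 10)
  exact ⟨χ, h1, h2, h3, h4, h5, h6⟩

/-- Bound for the commutator of the Laplacian with the cutoff at one vertex. -/
theorem commutator_sq_le {ι : Type*} [Fintype ι] {a : ℝ} {b t : ι → ℝ} {C h u : ℝ}
    (hb : ∀ i, |b i - a| ≤ C * h) (hs : |∑ i, (b i - a)| ≤ C * h ^ 2) :
    (∑ i, (b i - a) * t i + u * ∑ i, (b i - a)) ^ 2 ≤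
      2 * (C ^ 2 * h ^ 2) * (Fintype.card ι * ∑ i, t i ^ 2 + h ^ 2 * u ^ 2) := by
  have h1 : (∑ i, (b i - a) * t i) ^ 2 ≤ Fintype.card ι * ∑ i, ((b i - a) * t i) ^ 2 := by
    simpa using sq_sum_le_card_mul_sum_sq (s := univ) (f := fun i => (b i - a) * t i)
  have h2 : ∑ i, ((b i - a) * t i) ^ 2 ≤ (C * h) ^ 2 * ∑ i, t i ^ 2 := by
    rw [mul_sum]
    refine sum_le_sum fun i _ => ?_
    rw [mul_pow]
    exact mul_le_mul_of_nonneg_right (sq_le_sq' (abs_le.1 (hb i)).1 (abs_le.1 (hb i)).2)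
      (sq_nonneg _)
  have h3 : (∑ i, (b i - a)) ^ 2 ≤ (C * h ^ 2) ^ 2 :=
    sq_le_sq' (abs_le.1 hs).1 (abs_le.1 hs).2
  have h4 : (0 : ℝ) ≤ Fintype.card ι := Nat.cast_nonneg _
  have h5 := mul_le_mul_of_nonneg_left h2 h4
  have h6 := mul_le_mul_of_nonneg_left h3 (sq_nonneg u)
  nlinarith [sq_nonneg (∑ i, (b i - a) * t i - u * ∑ i, (b i - a))]

variable [AddCommGroup Λ]
variable {ι : Type*} [Fintype ι] {v : ι → Λ} {η : ι → E} {σ : Equiv.Perm ι}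

set_option maxHeartbeats 1000000 in
-- The Carleman estimate is applied to `cutWeight χ τ (X l) * u l`. The commutator with `χ` lives on
-- two shells, where the weight is at most 1 and at most `outerWeight`. It has a factor `h²` and
-- involves squared differences of `u`, for which the Caccioppoli inequality gives another `h²`. All
-- terms then carry `h⁴`, which cancels.
theorem exists_layer_estimate [FiniteDimensional ℝ E] (hv : ∀ i, v (σ i) = -v i)
    (hη : ∀ i, η (σ i) = -η i)
    (hP : ∀ x y : E, ∑ i, ⟪x, η i⟫ * ⟪y, η i⟫ = 2 * ⟪x, y⟫) {χ : E → ℝ} (hχ : IsCutoff χ) :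
    ∃ K ε : ℝ, 0 < K ∧ 0 < ε ∧ ε ≤ 1 ∧ ∀ (h τ : ℝ) (X : Λ → E), 0 < h → 1 ≤ ε * τ → τ * h ≤ ε →
      (∀ l i, X (l + v i) = X l + h • η i) → (∀ r : ℝ, {l | ‖X l‖ ≤ r}.Finite) →
      ∀ u g : Λ → ℝ, (∀ l, ‖X l‖ ≤ 3 → |lap v u l| ≤ h ^ 2 * g l) →
      τ ^ 3 * ∑' l, (cutWeight χ τ (X l) * u l) ^ 2 ≤
        K * (∑' l, (cutWeight χ τ (X l) * g l) ^ 2 +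
          Real.exp (2 * τ) * (mass (innerRegion X) u + mass (innerRegion X) g) +
          Real.exp (2 * τ * outerWeight) *
            (mass (outerRegion X) u + mass (outerRegion X) g)) := by
  obtain ⟨c, ε, hc, hε0, hε1, hcarl⟩ := exists_carleman hv hη hP
  -- Both `ζ₁` and `ζ₂` equal 1 around one transition zone of `χ`, so there the differences of `ζ u`
  -- are those of `u`. Their supports lie in the inner and outer regions with room for one edge.
  obtain ⟨ζ₁, s₁, p₁, q₁, one₁, zero₁⟩ := exists_ball_cutoff (E := E)
    (by norm_num : (0 : ℝ) < 21 / 50) (by norm_num : (21 / 50 : ℝ) < 9 / 20)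
  obtain ⟨ζ₂, s₂, p₂, q₂, zero₂, one₂, zero₂'⟩ := exists_annulus_cutoff (E := E)
    (by norm_num : (0 : ℝ) < 33 / 25) (by norm_num : (33 / 25 : ℝ) < 69 / 50)
    (by norm_num : (69 / 50 : ℝ) ≤ 43 / 25) (by norm_num : (43 / 25 : ℝ) < 9 / 5)
  obtain ⟨C, hC1, hC⟩ := exists_cutoff_bound hη hχ.smooth
    (fun x hx => hχ.zero_out x (by linarith))
  obtain ⟨C₁, hC11, hC₁⟩ := exists_cutoff_bound hη s₁ (fun x hx => zero₁ x (by linarith))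
  obtain ⟨C₂, hC21, hC₂⟩ := exists_cutoff_bound hη s₂ (fun x hx => zero₂' x (by linarith))
  obtain ⟨B, hB1, hB⟩ := exists_uniform_const (P := fun i B => ‖η i‖ ≤ B)
    (fun i a b hab H => H.trans hab) (fun i => ⟨_, le_rfl⟩)
  obtain ⟨N, hN⟩ : ∃ N : ℝ, N = ((Fintype.card ι : ℕ) : ℝ) := ⟨_, rfl⟩
  have hN0 : 0 ≤ N := hN ▸ Nat.cast_nonneg _
  obtain ⟨D₁, hD₁⟩ : ∃ D, D = N * (1 + N * C₁ ^ 2) + 1 := ⟨_, rfl⟩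
  obtain ⟨D₂, hD₂⟩ : ∃ D, D = N * (1 + N * C₂ ^ 2) + 1 := ⟨_, rfl⟩
  have hD₁0 : 0 ≤ D₁ := by rw [hD₁]; positivity
  have hD₂0 : 0 ≤ D₂ := by rw [hD₂]; positivity
  -- The bound `1 / (100 * B)` makes edges no longer than 1/100, which is less than the gaps between
  -- the nested radii.
  refine ⟨(2 + 4 * C ^ 2 * (D₁ + D₂)) / c, min ε (1 / (100 * B)), by positivity,
    lt_min hε0 (by positivity), (min_le_left _ _).trans hε1,
    fun h τ X hh hετ hτh hX hfin u g hu => ?_⟩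
  have hτpos : 0 < τ := by
    by_contra hcon
    have : 0 < min ε (1 / (100 * B)) := lt_min hε0 (by positivity)
    nlinarith
  have hετ' : 1 ≤ ε * τ :=
    hετ.trans (mul_le_mul_of_nonneg_right (min_le_left _ _) hτpos.le)
  have hτh' : τ * h ≤ ε := hτh.trans (min_le_left _ _)
  have hτ1 : 1 ≤ τ := by nlinarith
  have hhB : h ≤ 1 / (100 * B) :=
    (le_mul_of_one_le_left hh.le hτ1).trans (hτh.trans (min_le_right _ _))
  have hh1 : h ≤ 1 := (le_mul_of_one_le_left hh.le hτ1).trans (hτh'.trans hε1)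
  have hηh : ∀ i, h * ‖η i‖ ≤ 1 / 100 := by
    intro i
    calc h * ‖η i‖ ≤ 1 / (100 * B) * B := by gcongr; exact hB i
      _ = 1 / 100 := by field_simp
  have hηh' : ∀ i, h * ‖η i‖ ≤ 1 := fun i => (hηh i).trans (by norm_num)
  have hn : ∀ l i, ‖X (l + v i)‖ ≤ ‖X l‖ + 1 / 100 := by
    intro l i
    rw [hX]
    refine (norm_add_le _ _).trans ?_
    rw [norm_smul, Real.norm_of_nonneg hh.le]
    linarith [hηh i]
  have hn' : ∀ l i, ‖X l‖ ≤ ‖X (l + v i)‖ + 1 / 100 := by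
    intro l i
    have e1 : ‖X l‖ ≤ ‖X l + h • η i‖ + ‖h • η i‖ := by
      simpa using norm_sub_le (X l + h • η i) (h • η i)
    rw [norm_smul, Real.norm_of_nonneg hh.le, ← hX] at e1
    linarith [hηh i]
  have hIn : (innerRegion X).Finite := hfin _
  have hOut : (outerRegion X).Finite := (hfin (37 / 20)).subset fun l hl => hl.2
  have hsmall : {l | ‖X l‖ ≤ 2}.Finite := hfin 2
  have sm : ∀ {f : Λ → ℝ}, (∀ l, 2 < ‖X l‖ → f l = 0) → Summable f := fun hf =>
    summable_of_hasFiniteSupport (hsmall.subset fun l hl => by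
      by_contra hcon
      exact hl (hf l (not_le.1 hcon)))
  have hcac₁ := caccioppoli hv (Z := fun l => ζ₁ (X l)) (u := u) (g := g) (h := h) (κ := C₁ * h)
    hIn (fun l => by rw [abs_of_nonneg (p₁ _)]; exact q₁ _)
    (fun l hl => by
      by_contra hcon
      simp only [mem_innerRegion, not_le] at hcon
      exact hl (zero₁ _ (by linarith)))
    (fun l i hl => by
      by_contra hcon
      simp only [mem_innerRegion, not_le] at hcon
      exact hl (zero₁ _ (by linarith [hn' l i])))
    (fun l i => by rw [hX]; exact (hC₁ h hh.le hh1 hηh' _).1 i)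
    (fun l hl => hu l (by
      simp only [mem_innerRegion] at hl
      linarith))
  have hcac₂ := caccioppoli hv (Z := fun l => ζ₂ (X l)) (u := u) (g := g) (h := h) (κ := C₂ * h)
    hOut (fun l => by rw [abs_of_nonneg (p₂ _)]; exact q₂ _)
    (fun l hl => by
      by_contra hcon
      simp only [mem_outerRegion, not_and_or, not_le] at hcon
      rcases hcon with hcon | hcon
      · exact hl (zero₂ _ (by linarith))
      · exact hl (zero₂' _ (by linarith)))
    (fun l i hl => by
      by_contra hcon
      simp only [mem_outerRegion, not_and_or, not_le] at hcon
      rcases hcon with hcon | hcon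
      · exact hl (zero₂ _ (by linarith [hn l i]))
      · exact hl (zero₂' _ (by linarith [hn' l i])))
    (fun l i => by rw [hX]; exact (hC₂ h hh.le hh1 hηh' _).1 i)
    (fun l hl => hu l (by
      simp only [mem_outerRegion] at hl
      linarith [hl.2]))
  obtain ⟨G₁, hG₁⟩ : ∃ G : Λ → ℝ, G = fun l => ∑ i,
    (ζ₁ (X (l + v i)) * u (l + v i) - ζ₁ (X l) * u l) ^ 2 := ⟨_, rfl⟩
  obtain ⟨G₂, hG₂⟩ : ∃ G : Λ → ℝ, G = fun l => ∑ i,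
    (ζ₂ (X (l + v i)) * u (l + v i) - ζ₂ (X l) * u l) ^ 2 := ⟨_, rfl⟩
  rw [← hG₁, ← hN] at hcac₁
  rw [← hG₂, ← hN] at hcac₂
  have hG₁0 : ∀ l, 0 ≤ G₁ l := fun l => by rw [hG₁]; exact sum_nonneg fun i _ => sq_nonneg _
  have hG₂0 : ∀ l, 0 ≤ G₂ l := fun l => by rw [hG₂]; exact sum_nonneg fun i _ => sq_nonneg _
  obtain ⟨I₁, hI₁⟩ : ∃ I : Λ → ℝ, I = (innerRegion X).indicator (fun l => u l ^ 2) := ⟨_, rfl⟩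
  obtain ⟨I₂, hI₂⟩ : ∃ I : Λ → ℝ, I = (outerRegion X).indicator (fun l => u l ^ 2) := ⟨_, rfl⟩
  have hI₁0 : ∀ l, 0 ≤ I₁ l := fun l => by
    rw [hI₁]; exact Set.indicator_nonneg (fun _ _ => sq_nonneg _) _
  have hI₂0 : ∀ l, 0 ≤ I₂ l := fun l => by
    rw [hI₂]; exact Set.indicator_nonneg (fun _ _ => sq_nonneg _) _
  have hpt : ∀ l, (∑ i, (Real.exp (τ * weight (X l) - τ * weight (X (l + v i))) *
      (cutWeight χ τ (X (l + v i)) * u (l + v i)) - cutWeight χ τ (X l) * u l)) ^ 2 ≤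
      2 * h ^ 4 * (cutWeight χ τ (X l) * g l) ^ 2 +
      4 * (C ^ 2 * h ^ 2) * (Real.exp (2 * τ) * (N * G₁ l + h ^ 2 * I₁ l) +
        Real.exp (2 * τ * outerWeight) * (N * G₂ l + h ^ 2 * I₂ l)) := by
    intro l
    -- Undoing the conjugation leaves the Laplacian of `χ u`, which is expanded by the discrete
    -- Leibniz rule.
    have e1 : ∑ i, (Real.exp (τ * weight (X l) - τ * weight (X (l + v i))) *
        (cutWeight χ τ (X (l + v i)) * u (l + v i)) - cutWeight χ τ (X l) * u l) =
        Real.exp (τ * weight (X l)) * (χ (X l) * lap v u l +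
          (∑ i, (χ (X (l + v i)) - χ (X l)) * (u (l + v i) - u l) +
            u l * ∑ i, (χ (X (l + v i)) - χ (X l)))) := by
      rw [lap, mul_sum, mul_sum, ← sum_add_distrib, ← sum_add_distrib, mul_sum]
      refine sum_congr rfl fun i _ => ?_
      have : Real.exp (τ * weight (X l) - τ * weight (X (l + v i))) *
          Real.exp (τ * weight (X (l + v i))) = Real.exp (τ * weight (X l)) := by
        rw [← Real.exp_add]; congr 1; ring
      simp only [cutWeight]
      linear_combination (χ (X (l + v i)) * u (l + v i)) * this
    obtain ⟨P, hPdef⟩ : ∃ P, P = ∑ i, (χ (X (l + v i)) - χ (X l)) * (u (l + v i) - u l) +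
            u l * ∑ i, (χ (X (l + v i)) - χ (X l)) := ⟨_, rfl⟩
    rw [e1, ← hPdef]
    have hexp := Real.exp_pos (τ * weight (X l))
    have b1 : (Real.exp (τ * weight (X l)) * (χ (X l) * lap v u l)) ^ 2 ≤
        h ^ 4 * (cutWeight χ τ (X l) * g l) ^ 2 := by
      by_cases hl : ‖X l‖ ≤ 3
      · have := hu l hl
        have h2 : lap v u l ^ 2 ≤ (h ^ 2 * g l) ^ 2 :=
          sq_le_sq' (abs_le.1 this).1 (abs_le.1 this).2
        calc _ = (Real.exp (τ * weight (X l)) * χ (X l)) ^ 2 * lap v u l ^ 2 := by ring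
          _ ≤ (Real.exp (τ * weight (X l)) * χ (X l)) ^ 2 * (h ^ 2 * g l) ^ 2 :=
            mul_le_mul_of_nonneg_left h2 (sq_nonneg _)
          _ = _ := by rw [cutWeight]; ring
      · rw [hχ.zero_out (X l) (by linarith)]
        simp only [zero_mul, mul_zero, ne_eq, OfNat.ofNat_ne_zero, not_false_eq_true, zero_pow]
        positivity
    have b2 : (Real.exp (τ * weight (X l)) * P) ^ 2 ≤
        2 * (C ^ 2 * h ^ 2) * (Real.exp (2 * τ) * (N * G₁ l + h ^ 2 * I₁ l) +
        Real.exp (2 * τ * outerWeight) * (N * G₂ l + h ^ 2 * I₂ l)) := by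
      have hP2 : P ^ 2 ≤ 2 * (C ^ 2 * h ^ 2) *
          (N * ∑ i, (u (l + v i) - u l) ^ 2 + h ^ 2 * u l ^ 2) := by
        rw [hPdef, hN]
        refine commutator_sq_le (fun i => ?_) ?_
        · rw [hX]; exact (hC h hh.le hh1 hηh' _).1 i
        · simp only [hX]; exact (hC h hh.le hh1 hηh' _).2
      have r1 : 0 ≤ Real.exp (2 * τ) * (N * G₁ l + h ^ 2 * I₁ l) := by
        have := hG₁0 l; have := hI₁0 l; positivity
      have r2 : 0 ≤ Real.exp (2 * τ * outerWeight) * (N * G₂ l + h ^ 2 * I₂ l) := by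
        have := hG₂0 l; have := hI₂0 l; positivity
      have r3 : 0 ≤ 2 * (C ^ 2 * h ^ 2) := by positivity
      have hzero : (∀ i, χ (X (l + v i)) = χ (X l)) →
          (Real.exp (τ * weight (X l)) * P) ^ 2 ≤
          2 * (C ^ 2 * h ^ 2) * (Real.exp (2 * τ) * (N * G₁ l + h ^ 2 * I₁ l) +
          Real.exp (2 * τ * outerWeight) * (N * G₂ l + h ^ 2 * I₂ l)) := by
        intro hz
        have : P = 0 := by simp [hPdef, hz]
        rw [this, mul_zero, zero_pow two_ne_zero]
        exact mul_nonneg r3 (add_nonneg r1 r2)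
      -- The dividing radii are those of `χ` displaced by the edge length 1/100. In the first, third
      -- and fifth zones `χ` is constant on the stencil and the commutator vanishes.
      rcases le_total ‖X l‖ (29 / 100) with t1 | t1
      · refine hzero fun i => ?_
        rw [hχ.zero_in _ (by linarith [hn l i]), hχ.zero_in _ (by linarith)]
      rcases le_total ‖X l‖ (41 / 100) with t2 | t2
      · have e2 : G₁ l = ∑ i, (u (l + v i) - u l) ^ 2 := by
          rw [hG₁]
          refine sum_congr rfl fun i _ => ?_
          rw [one₁ _ (by linarith [hn l i]), one₁ _ (by linarith), one_mul, one_mul]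
        have e3 : I₁ l = u l ^ 2 := by
          rw [hI₁]
          exact Set.indicator_of_mem (mem_innerRegion.2 (by linarith)) _
        rw [← e2, ← e3] at hP2
        rw [mul_pow]
        calc _ ≤ Real.exp (2 * τ) * (2 * (C ^ 2 * h ^ 2) * (N * G₁ l + h ^ 2 * I₁ l)) :=
              mul_le_mul (exp_weight_sq_le hτpos.le _) hP2 (sq_nonneg _) (Real.exp_pos _).le
          _ = 2 * (C ^ 2 * h ^ 2) * (Real.exp (2 * τ) * (N * G₁ l + h ^ 2 * I₁ l)) := by ring
          _ ≤ _ := mul_le_mul_of_nonneg_left (le_add_of_nonneg_right r2) r3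
      rcases le_total ‖X l‖ (139 / 100) with t3 | t3
      · refine hzero fun i => ?_
        rw [hχ.one _ (by linarith [hn' l i]) (by linarith [hn l i]),
          hχ.one _ (by linarith) (by linarith)]
      rcases le_total ‖X l‖ (171 / 100) with t4 | t4
      · have e2 : G₂ l = ∑ i, (u (l + v i) - u l) ^ 2 := by
          rw [hG₂]
          refine sum_congr rfl fun i _ => ?_
          rw [one₂ _ (by linarith [hn' l i]) (by linarith [hn l i]),
            one₂ _ (by linarith) (by linarith), one_mul, one_mul]
        have e3 : I₂ l = u l ^ 2 := by
          rw [hI₂]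
          exact Set.indicator_of_mem (mem_outerRegion.2 ⟨by linarith, by linarith⟩) _
        rw [← e2, ← e3] at hP2
        rw [mul_pow]
        calc _ ≤ Real.exp (2 * τ * outerWeight) *
              (2 * (C ^ 2 * h ^ 2) * (N * G₂ l + h ^ 2 * I₂ l)) :=
              mul_le_mul (exp_weight_sq_le_outer hτpos.le (by linarith)) hP2 (sq_nonneg _)
                (Real.exp_pos _).le
          _ = 2 * (C ^ 2 * h ^ 2) *
              (Real.exp (2 * τ * outerWeight) * (N * G₂ l + h ^ 2 * I₂ l)) := by ring
          _ ≤ _ := mul_le_mul_of_nonneg_left (le_add_of_nonneg_left r1) r3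
      · refine hzero fun i => ?_
        rw [hχ.zero_out _ (by linarith [hn' l i]), hχ.zero_out _ (by linarith)]
    have b3 : (Real.exp (τ * weight (X l)) * (χ (X l) * lap v u l + P)) ^ 2 ≤
        2 * (Real.exp (τ * weight (X l)) * (χ (X l) * lap v u l)) ^ 2 +
        2 * (Real.exp (τ * weight (X l)) * P) ^ 2 := by
      nlinarith [sq_nonneg (Real.exp (τ * weight (X l)) * (χ (X l) * lap v u l) -
        Real.exp (τ * weight (X l)) * P)]
    linarith
  have hcw : ∀ l, 2 < ‖X l‖ → cutWeight χ τ (X l) = 0 := fun l hl => by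
    rw [cutWeight, hχ.zero_out _ (by linarith), zero_mul]
  have hcar := hcarl h τ X hh hετ' hτh' hX (fun l => cutWeight χ τ (X l) * u l)
    (hsmall.subset fun l hl => by
      by_contra hcon
      exact hl (by simp [hcw l (not_le.1 hcon)]))
    (fun l hl => by
      have h0 : χ (X l) ≠ 0 := fun h0 => hl (by simp [cutWeight, h0])
      constructor
      · by_contra hcon
        exact h0 (hχ.zero_in _ (by linarith))
      · by_contra hcon
        exact h0 (hχ.zero_out _ (by linarith)))
  have sG₁ : Summable G₁ := summable_of_hasFiniteSupport <| (hfin (9 / 20 + 1 / 100)).subset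
    fun l hl => by
      by_contra hcon
      simp only [Set.mem_ofPred_eq, not_le] at hcon
      refine hl ?_
      rw [hG₁]
      refine sum_eq_zero fun i _ => ?_
      rw [zero₁ _ (by linarith [hn' l i]), zero₁ _ (by linarith)]; ring
  have sG₂ : Summable G₂ := summable_of_hasFiniteSupport <| (hfin (9 / 5 + 1 / 100)).subset
    fun l hl => by
      by_contra hcon
      simp only [Set.mem_ofPred_eq, not_le] at hcon
      refine hl ?_
      rw [hG₂]
      refine sum_eq_zero fun i _ => ?_
      rw [zero₂' _ (by linarith [hn' l i]), zero₂' _ (by linarith)]; ring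
  have sI₁ : Summable I₁ := by rw [hI₁]; exact summable_indicator hIn _
  have sI₂ : Summable I₂ := by rw [hI₂]; exact summable_indicator hOut _
  have sg : Summable fun l => (cutWeight χ τ (X l) * g l) ^ 2 :=
    sm fun l hl => by simp [hcw l hl]
  have slhs : Summable fun l => (∑ i, (Real.exp (τ * weight (X l) - τ * weight (X (l + v i))) *
      (cutWeight χ τ (X (l + v i)) * u (l + v i)) - cutWeight χ τ (X l) * u l)) ^ 2 :=
    sm fun l hl => by
      have h0 := hcw l hl
      have h1 : ∀ i, cutWeight χ τ (X (l + v i)) = 0 := fun i => by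
        rw [cutWeight, hχ.zero_out _ (by linarith [hn' l i]), zero_mul]
      simp [h0, h1]
  have sA := ((sG₁.mul_left N).add (sI₁.mul_left (h ^ 2))).mul_left (Real.exp (2 * τ))
  have sB := ((sG₂.mul_left N).add (sI₂.mul_left (h ^ 2))).mul_left
    (Real.exp (2 * τ * outerWeight))
  have hsum := slhs.tsum_le_tsum hpt
    ((sg.mul_left (2 * h ^ 4)).add ((sA.add sB).mul_left (4 * (C ^ 2 * h ^ 2))))
  rw [(sg.mul_left (2 * h ^ 4)).tsum_add ((sA.add sB).mul_left (4 * (C ^ 2 * h ^ 2))),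
    tsum_mul_left, tsum_mul_left, sA.tsum_add sB, tsum_mul_left, tsum_mul_left,
    (sG₁.mul_left N).tsum_add (sI₁.mul_left (h ^ 2)),
    (sG₂.mul_left N).tsum_add (sI₂.mul_left (h ^ 2)), tsum_mul_left, tsum_mul_left,
    tsum_mul_left, tsum_mul_left] at hsum
  have m1 : ∑' l, I₁ l = mass (innerRegion X) u := by rw [hI₁]; rfl
  have m2 : ∑' l, I₂ l = mass (outerRegion X) u := by rw [hI₂]; rfl
  rw [m1, m2] at hsum
  have n1 := mass_nonneg (innerRegion X) g
  have n2 := mass_nonneg (outerRegion X) g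
  have n3 := mass_nonneg (innerRegion X) u
  have n4 := mass_nonneg (outerRegion X) u
  have k1 : N * ∑' l, G₁ l + h ^ 2 * mass (innerRegion X) u ≤
      h ^ 2 * D₁ * (mass (innerRegion X) u + mass (innerRegion X) g) := by
    have := mul_le_mul_of_nonneg_left hcac₁ hN0
    have : 0 ≤ h ^ 2 * mass (innerRegion X) g := by positivity
    rw [hD₁]
    linarith
  have k2 : N * ∑' l, G₂ l + h ^ 2 * mass (outerRegion X) u ≤
      h ^ 2 * D₂ * (mass (outerRegion X) u + mass (outerRegion X) g) := by
    have := mul_le_mul_of_nonneg_left hcac₂ hN0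
    have : 0 ≤ h ^ 2 * mass (outerRegion X) g := by positivity
    rw [hD₂]
    linarith
  obtain ⟨S, hS⟩ : ∃ S, S = ∑' l, (cutWeight χ τ (X l) * g l) ^ 2 := ⟨_, rfl⟩
  have hS0 : 0 ≤ S := hS ▸ tsum_nonneg fun l => sq_nonneg _
  obtain ⟨T, hT⟩ : ∃ T, T = ∑' l, (cutWeight χ τ (X l) * u l) ^ 2 := ⟨_, rfl⟩
  obtain ⟨M₁, hM₁⟩ : ∃ M, M = Real.exp (2 * τ) *
    (mass (innerRegion X) u + mass (innerRegion X) g) := ⟨_, rfl⟩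
  obtain ⟨M₂, hM₂⟩ : ∃ M, M = Real.exp (2 * τ * outerWeight) *
    (mass (outerRegion X) u + mass (outerRegion X) g) := ⟨_, rfl⟩
  have hM₁0 : 0 ≤ M₁ := by rw [hM₁]; positivity
  have hM₂0 : 0 ≤ M₂ := by rw [hM₂]; positivity
  have k3 := mul_le_mul_of_nonneg_left k1 (Real.exp_pos (2 * τ)).le
  have k4 := mul_le_mul_of_nonneg_left k2 (Real.exp_pos (2 * τ * outerWeight)).le
  have k5 : Real.exp (2 * τ) * (N * ∑' l, G₁ l + h ^ 2 * mass (innerRegion X) u) ≤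
      h ^ 2 * D₁ * M₁ := by rw [hM₁]; linarith
  have k6 : Real.exp (2 * τ * outerWeight) *
      (N * ∑' l, G₂ l + h ^ 2 * mass (outerRegion X) u) ≤ h ^ 2 * D₂ * M₂ := by
    rw [hM₂]; linarith
  rw [← hS] at hsum
  rw [← hT] at hcar
  rw [← hS, ← hT, ← hM₁, ← hM₂, div_mul_eq_mul_div, le_div_iff₀ hc]
  have h4 : 0 < h ^ 4 := by positivity
  have k7 : (C ^ 2 * h ^ 2) * (h ^ 2 * D₁ * M₁ + h ^ 2 * D₂ * M₂) ≤
      h ^ 4 * (C ^ 2 * (D₁ + D₂)) * (M₁ + M₂) := by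
    have : 0 ≤ h ^ 4 * C ^ 2 * (D₁ * M₂ + D₂ * M₁) := by positivity
    linarith
  have k8 := mul_le_mul_of_nonneg_left (add_le_add k5 k6)
    (by positivity : 0 ≤ 4 * (C ^ 2 * h ^ 2))
  have k9 : h ^ 4 * (τ ^ 3 * T * c) ≤ h ^ 4 *
      (2 * S + 4 * (C ^ 2 * (D₁ + D₂)) * (M₁ + M₂)) := by linarith
  have k10 := le_of_mul_le_mul_left k9 h4
  have k11 : 0 ≤ C ^ 2 * (D₁ + D₂) * S := by positivity
  linarith

end Layer

end DiscreteCarleman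

namespace DiscreteCarleman

open Finset
open scoped ContDiff RealInnerProductSpace

/-! ### Elimination of one layer and comparison of weights -/

section TwoLayers

variable {Λ : Type*} [AddCommGroup Λ] {ι : Type*} [Fintype ι]

/-- The bound for the hidden Laplacian of one layer in terms of both layers. -/
def neighborBound (e : ι → Λ) (M : ℝ) (u w : Λ → ℝ) (l : Λ) : ℝ :=
  M * (∑ m, |w (l + e m)| + Fintype.card ι * |u l|)

/-- Each difference from `l` to `l + e m - e n` is split at the intermediate vertex `l + e m` of the
other layer. The sum over `n` is then the equation at that vertex, and the sum over `m` the equation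
at `l`, taken once for every `n`. -/
theorem abs_lap_le_neighborBound {e : ι → Λ} {u w V W : Λ → ℝ} {h M : ℝ} {l : Λ}
    (hA : ∑ m, (w (l + e m) - u l) = -(h ^ 2 * (V l * u l)))
    (hB : ∀ m, ∑ n, (u (l + e m - e n) - w (l + e m)) =
      -(h ^ 2 * (W (l + e m) * w (l + e m))))
    (hV : |V l| ≤ M) (hW : ∀ m, |W (l + e m)| ≤ M) :
    |lap (fun q : ι × ι => e q.1 - e q.2) u l| ≤ h ^ 2 * neighborBound e M u w l := by
  have e1 : lap (fun q : ι × ι => e q.1 - e q.2) u l =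
      -(h ^ 2 * (∑ m, W (l + e m) * w (l + e m) + Fintype.card ι * (V l * u l))) := by
    have e2 : ∀ m, ∑ n, (u (l + (e m - e n)) - u l) =
        ∑ n, (u (l + e m - e n) - w (l + e m)) + Fintype.card ι * (w (l + e m) - u l) := by
      intro m
      have : (Fintype.card ι : ℝ) * (w (l + e m) - u l) = ∑ n : ι, (w (l + e m) - u l) := by
        rw [sum_const, card_univ, nsmul_eq_mul]
      rw [this, ← sum_add_distrib]
      refine sum_congr rfl fun n _ => ?_
      rw [add_sub_assoc]; ring
    rw [lap, Fintype.sum_prod_type]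
    simp only [e2, hB, sum_add_distrib, ← mul_sum, hA, sum_neg_distrib]
    ring
  rw [e1, abs_neg, abs_mul, abs_of_nonneg (sq_nonneg h), neighborBound]
  refine mul_le_mul_of_nonneg_left ?_ (sq_nonneg h)
  refine (abs_add_le _ _).trans ?_
  rw [mul_add, mul_sum]
  refine add_le_add ((abs_sum_le_sum_abs _ _).trans (sum_le_sum fun m _ => ?_)) ?_
  · rw [abs_mul]
    exact mul_le_mul_of_nonneg_right (hW m) (abs_nonneg _)
  · rw [abs_mul, abs_mul, abs_of_nonneg (Nat.cast_nonneg _)]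
    have := mul_le_mul_of_nonneg_right hV (abs_nonneg (u l))
    have := mul_le_mul_of_nonneg_left this (Nat.cast_nonneg (α := ℝ) (Fintype.card ι))
    linarith

theorem neighborBound_sq_le (e : ι → Λ) (M : ℝ) (u w : Λ → ℝ) (l : Λ) :
    neighborBound e M u w l ^ 2 ≤
      2 * M ^ 2 * Fintype.card ι * ∑ m, w (l + e m) ^ 2 +
        2 * M ^ 2 * Fintype.card ι ^ 2 * u l ^ 2 := by
  have h1 : (∑ m, |w (l + e m)|) ^ 2 ≤ Fintype.card ι * ∑ m, w (l + e m) ^ 2 := by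
    simpa using sq_sum_le_card_mul_sum_sq (s := univ) (f := fun m => |w (l + e m)|)
  have h2 : (∑ m, |w (l + e m)| + Fintype.card ι * |u l|) ^ 2 ≤
      2 * (∑ m, |w (l + e m)|) ^ 2 + 2 * Fintype.card ι ^ 2 * u l ^ 2 := by
    rw [← sq_abs (u l)]
    nlinarith [sq_nonneg (∑ m, |w (l + e m)| - Fintype.card ι * |u l|)]
  rw [neighborBound, mul_pow]
  have h3 := mul_le_mul_of_nonneg_left (h2.trans (add_le_add_left
    (mul_le_mul_of_nonneg_left h1 zero_le_two) _)) (sq_nonneg M)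
  linarith

variable {E : Type*} [NormedAddCommGroup E]

/-- The preimage of a closed ball. -/
def ballSet (X : Λ → E) (r : ℝ) : Set Λ := {l | ‖X l‖ ≤ r}

omit [AddCommGroup Λ] in
theorem mem_ballSet {X : Λ → E} {r : ℝ} {l : Λ} : l ∈ ballSet X r ↔ ‖X l‖ ≤ r := Iff.rfl

theorem mass_neighborBound_le {e : ι → Λ} {M : ℝ} {u w : Λ → ℝ} {A : Set Λ} {A' B : Set Λ}
    (hAA' : A ⊆ A') (hA' : A'.Finite) (hB : B.Finite) (hAB : ∀ l ∈ A, ∀ m, l + e m ∈ B) :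
    mass A (neighborBound e M u w) ≤
      2 * M ^ 2 * Fintype.card ι ^ 2 * (mass A' u + mass B w) := by
  have hA : A.Finite := hA'.subset hAA'
  have sA := fun f : Λ → ℝ => summable_indicator hA f
  have h1 : mass A (neighborBound e M u w) ≤
      2 * M ^ 2 * Fintype.card ι * ∑ m, mass A (fun l => w (l + e m)) +
        2 * M ^ 2 * Fintype.card ι ^ 2 * mass A u := by
    unfold mass
    rw [← Summable.tsum_finsetSum fun m _ => sA _, ← tsum_mul_left, ← tsum_mul_left,
      ← ((summable_sum fun m _ => sA _).mul_left _).tsum_add ((sA _).mul_left _)]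
    refine (sA _).tsum_le_tsum (fun l => ?_)
      (((summable_sum fun m _ => sA _).mul_left _).add ((sA _).mul_left _))
    by_cases hl : l ∈ A
    · simp only [Set.indicator_of_mem hl]
      exact neighborBound_sq_le e M u w l
    · simp [Set.indicator_of_notMem hl]
  have h2 : ∑ m, mass A (fun l => w (l + e m)) ≤ Fintype.card ι * mass B w := by
    calc _ ≤ ∑ m : ι, mass B w :=
          sum_le_sum fun m _ => mass_comp_add_le (e m) (fun l hl => hAB l hl m) hB w
      _ = _ := by simp
  have h3 := mass_mono hAA' hA' u
  have h4 := mul_le_mul_of_nonneg_left h2 (by positivity : 0 ≤ 2 * M ^ 2 * (Fintype.card ι : ℝ))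
  have h5 := mul_le_mul_of_nonneg_left h3
    (by positivity : 0 ≤ 2 * M ^ 2 * (Fintype.card ι : ℝ) ^ 2)
  linarith

variable [InnerProductSpace ℝ E]

/-- Adjacent weights differ at most by the factor `e < 3`, but the values of `χ` are not comparable
near the boundary of its support. Where `χ y` may be below 1, the indicators take over: for `‖y‖ ≤
2/5` the trivial bound suffices, and for `‖y‖ ≥ 7/5` the point `x` is already in the outer zone or
outside the support. -/
theorem cutWeight_sq_le {χ : E → ℝ} (hχ : IsCutoff χ) {τ : ℝ} (hτ : 0 ≤ τ) {x y : E}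
    (hyx : ‖y‖ ≤ ‖x‖ + 1 / 100)
    (hw : ‖y‖ ≤ 2 → τ * weight x ≤ τ * weight y + 1) :
    cutWeight χ τ x ^ 2 ≤ 9 * cutWeight χ τ y ^ 2 +
      {z : E | ‖z‖ ≤ 1 / 2}.indicator (fun _ => Real.exp (2 * τ)) y +
      {z : E | ‖z‖ ≤ 2}.indicator (fun _ => Real.exp (2 * τ * outerWeight)) y := by
  have i1 : 0 ≤ {z : E | ‖z‖ ≤ 1 / 2}.indicator (fun _ => Real.exp (2 * τ)) y :=
    Set.indicator_nonneg (fun _ _ => (Real.exp_pos _).le) _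
  have i2 : 0 ≤ {z : E | ‖z‖ ≤ 2}.indicator (fun _ => Real.exp (2 * τ * outerWeight)) y :=
    Set.indicator_nonneg (fun _ _ => (Real.exp_pos _).le) _
  have i3 : 0 ≤ 9 * cutWeight χ τ y ^ 2 := by positivity
  have hle : cutWeight χ τ x ^ 2 ≤ Real.exp (τ * weight x) ^ 2 := by
    rw [cutWeight, mul_pow]
    exact mul_le_of_le_one_left (sq_nonneg _) (pow_le_one₀ (hχ.nonneg x) (hχ.le_one x))
  rcases le_total ‖y‖ (2 / 5) with h1 | h1
  · rw [Set.indicator_of_mem (show y ∈ {z : E | ‖z‖ ≤ 1 / 2} from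
      show ‖y‖ ≤ 1 / 2 by linarith)]
    linarith [exp_weight_sq_le hτ x]
  rcases le_total ‖y‖ (7 / 5) with h2 | h2
  · have h3 : Real.exp (τ * weight x) ≤ 3 * Real.exp (τ * weight y) := by
      calc _ ≤ Real.exp (1 + τ * weight y) := Real.exp_le_exp.2 (by linarith [hw (by linarith)])
        _ = Real.exp 1 * Real.exp (τ * weight y) := Real.exp_add _ _
        _ ≤ _ := by gcongr; exact Real.exp_one_lt_three.le
    have h4 : cutWeight χ τ y = Real.exp (τ * weight y) := by
      rw [cutWeight, hχ.one y h1 h2, one_mul]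
    have h5 : Real.exp (τ * weight x) ^ 2 ≤ (3 * Real.exp (τ * weight y)) ^ 2 := by gcongr
    rw [h4]
    linarith
  rcases le_total ‖x‖ (17 / 10) with h3 | h3
  · rw [Set.indicator_of_mem (show y ∈ {z : E | ‖z‖ ≤ 2} from show ‖y‖ ≤ 2 by linarith)]
    linarith [exp_weight_sq_le_outer hτ (x := x) (by linarith)]
  · have : cutWeight χ τ x = 0 := by rw [cutWeight, hχ.zero_out x h3, zero_mul]
    rw [this]
    linarith [sq_nonneg (cutWeight χ τ y)]

omit [AddCommGroup Λ] in
theorem summable_cutWeight {χ : E → ℝ} (hχ : IsCutoff χ) {X : Λ → E}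
    (hX : (ballSet X 2).Finite) (τ : ℝ) (f : Λ → ℝ) :
    Summable fun l => (cutWeight χ τ (X l) * f l) ^ 2 :=
  summable_of_hasFiniteSupport <| hX.subset fun l hl => by
    by_contra hcon
    rw [mem_ballSet, not_le] at hcon
    exact hl (by simp [cutWeight, hχ.zero_out (X l) (by linarith)])

/-- The coupling is bounded by the weighted masses of both layers with a constant free of `τ`, so
that it can be absorbed by `τ³`. -/
theorem tsum_cutWeight_neighborBound_le {χ : E → ℝ} (hχ : IsCutoff χ) {τ : ℝ} (hτ : 0 ≤ τ)
    {e : ι → Λ} {M : ℝ} {u w : Λ → ℝ} {X Y : Λ → E} (hX : (ballSet X 2).Finite)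
    (hY : (ballSet Y 2).Finite)
    (hYX : ∀ l m, ‖Y (l + e m)‖ ≤ ‖X l‖ + 1 / 100)
    (hw : ∀ l m, ‖Y (l + e m)‖ ≤ 2 → τ * weight (X l) ≤ τ * weight (Y (l + e m)) + 1) :
    ∑' l, (cutWeight χ τ (X l) * neighborBound e M u w l) ^ 2 ≤
      18 * M ^ 2 * Fintype.card ι ^ 2 *
        (∑' l, (cutWeight χ τ (X l) * u l) ^ 2 + ∑' l, (cutWeight χ τ (Y l) * w l) ^ 2 +
          Real.exp (2 * τ) * mass (ballSet Y (1 / 2)) w +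
          Real.exp (2 * τ * outerWeight) * mass (ballSet Y 2) w) := by
  have hY' : (ballSet Y (1 / 2)).Finite := hY.subset fun l hl => by
    rw [mem_ballSet] at hl ⊢; linarith
  have sX := summable_cutWeight hχ hX τ
  have sY := summable_cutWeight hχ hY τ
  set F : Λ → ℝ := fun l => 9 * (cutWeight χ τ (Y l) * w l) ^ 2 +
    Real.exp (2 * τ) * (ballSet Y (1 / 2)).indicator (fun l => w l ^ 2) l +
    Real.exp (2 * τ * outerWeight) * (ballSet Y 2).indicator (fun l => w l ^ 2) l with hF
  have s1 : Summable fun l => 9 * (cutWeight χ τ (Y l) * w l) ^ 2 := (sY w).mul_left 9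
  have s2 := (summable_indicator hY' fun l => w l ^ 2).mul_left (Real.exp (2 * τ))
  have s3 := (summable_indicator hY fun l => w l ^ 2).mul_left (Real.exp (2 * τ * outerWeight))
  have sF : Summable F := (s1.add s2).add s3
  have hFsum : ∑' l, F l = 9 * ∑' l, (cutWeight χ τ (Y l) * w l) ^ 2 +
      Real.exp (2 * τ) * mass (ballSet Y (1 / 2)) w +
      Real.exp (2 * τ * outerWeight) * mass (ballSet Y 2) w := by
    rw [hF, (s1.add s2).tsum_add s3, s1.tsum_add s2, tsum_mul_left, tsum_mul_left,
      tsum_mul_left]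
    rfl
  have hpt : ∀ l m, (cutWeight χ τ (X l) * w (l + e m)) ^ 2 ≤ F (l + e m) := by
    intro l m
    have h1 := mul_le_mul_of_nonneg_right
      (cutWeight_sq_le hχ hτ (hYX l m) (hw l m)) (sq_nonneg (w (l + e m)))
    rw [mul_pow]
    refine h1.trans (le_of_eq ?_)
    simp only [hF]
    have i1 : {z : E | ‖z‖ ≤ 1 / 2}.indicator (fun _ => Real.exp (2 * τ)) (Y (l + e m)) *
        w (l + e m) ^ 2 = Real.exp (2 * τ) *
          (ballSet Y (1 / 2)).indicator (fun l => w l ^ 2) (l + e m) := by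
      by_cases h : ‖Y (l + e m)‖ ≤ 1 / 2
      · rw [Set.indicator_of_mem (show Y (l + e m) ∈ {z : E | ‖z‖ ≤ 1 / 2} from h),
          Set.indicator_of_mem (mem_ballSet.2 h)]
      · rw [Set.indicator_of_notMem (show Y (l + e m) ∉ {z : E | ‖z‖ ≤ 1 / 2} from h),
          Set.indicator_of_notMem (mt mem_ballSet.1 h), zero_mul, mul_zero]
    have i2 : {z : E | ‖z‖ ≤ 2}.indicator (fun _ => Real.exp (2 * τ * outerWeight))
        (Y (l + e m)) * w (l + e m) ^ 2 = Real.exp (2 * τ * outerWeight) *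
          (ballSet Y 2).indicator (fun l => w l ^ 2) (l + e m) := by
      by_cases h : ‖Y (l + e m)‖ ≤ 2
      · rw [Set.indicator_of_mem (show Y (l + e m) ∈ {z : E | ‖z‖ ≤ 2} from h),
          Set.indicator_of_mem (mem_ballSet.2 h)]
      · rw [Set.indicator_of_notMem (show Y (l + e m) ∉ {z : E | ‖z‖ ≤ 2} from h),
          Set.indicator_of_notMem (mt mem_ballSet.1 h), zero_mul, mul_zero]
    rw [add_mul, add_mul, i1, i2, mul_pow]
    ring
  have hm : ∑ m, ∑' l, (cutWeight χ τ (X l) * w (l + e m)) ^ 2 ≤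
      Fintype.card ι * ∑' l, F l := by
    calc _ ≤ ∑ m : ι, ∑' l, F l := by
          refine sum_le_sum fun m _ => ?_
          rw [← tsum_shift (e m) F]
          exact (sX _).tsum_le_tsum (fun l => hpt l m) (sF.comp_injective (add_left_injective (e m)))
      _ = _ := by simp
  have h1 : ∑' l, (cutWeight χ τ (X l) * neighborBound e M u w l) ^ 2 ≤
      2 * M ^ 2 * Fintype.card ι * ∑ m, ∑' l, (cutWeight χ τ (X l) * w (l + e m)) ^ 2 +
        2 * M ^ 2 * Fintype.card ι ^ 2 * ∑' l, (cutWeight χ τ (X l) * u l) ^ 2 := by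
    rw [← Summable.tsum_finsetSum fun m _ => sX _, ← tsum_mul_left, ← tsum_mul_left,
      ← ((summable_sum fun m _ => sX _).mul_left _).tsum_add ((sX _).mul_left _)]
    refine (sX _).tsum_le_tsum (fun l => ?_)
      (((summable_sum fun m _ => sX _).mul_left _).add ((sX _).mul_left _))
    have := mul_le_mul_of_nonneg_left (neighborBound_sq_le e M u w l)
      (sq_nonneg (cutWeight χ τ (X l)))
    simp only [mul_pow, ← mul_sum]
    linarith
  have h2 := mul_le_mul_of_nonneg_left hm
    (by positivity : 0 ≤ 2 * M ^ 2 * (Fintype.card ι : ℝ))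
  rw [hFsum] at h2
  have n1 : 0 ≤ ∑' l, (cutWeight χ τ (X l) * u l) ^ 2 := tsum_nonneg fun l => sq_nonneg _
  have n2 := mul_nonneg (Real.exp_pos (2 * τ)).le (mass_nonneg (ballSet Y (1 / 2)) w)
  have n3 := mul_nonneg (Real.exp_pos (2 * τ * outerWeight)).le (mass_nonneg (ballSet Y 2) w)
  have n4 : 0 ≤ M ^ 2 * (Fintype.card ι : ℝ) ^ 2 := by positivity
  have k1 := mul_nonneg n4 n1
  have k2 := mul_nonneg n4 n2
  have k3 := mul_nonneg n4 n3
  linarith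

/-- The value of the weight on the unit sphere. -/
noncomputable def unitWeight : ℝ := Real.exp (-(32 * 1 ^ 2))

theorem outerWeight_lt_unitWeight : outerWeight < unitWeight :=
  Real.exp_lt_exp.2 (by norm_num)

omit [AddCommGroup Λ] in
/-- Recovering the mass on the unit ball from the weighted mass. -/
theorem mass_ball_one_le {χ : E → ℝ} (hχ : IsCutoff χ) {τ : ℝ} (hτ : 0 ≤ τ) {X : Λ → E}
    (hX : (ballSet X 2).Finite) (u : Λ → ℝ) :
    mass (ballSet X 1) u ≤ mass (ballSet X (1 / 2)) u +
      Real.exp (-(2 * τ * unitWeight)) * ∑' l, (cutWeight χ τ (X l) * u l) ^ 2 := by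
  have f1 : (ballSet X 1).Finite := hX.subset fun l hl => by
    rw [mem_ballSet] at hl ⊢; linarith
  have f2 : (ballSet X (1 / 2)).Finite := hX.subset fun l hl => by
    rw [mem_ballSet] at hl ⊢; linarith
  have s := summable_cutWeight hχ hX τ u
  unfold mass
  rw [← tsum_mul_left, ← (summable_indicator f2 _).tsum_add (s.mul_left _)]
  refine (summable_indicator f1 _).tsum_le_tsum (fun l => ?_)
    ((summable_indicator f2 _).add (s.mul_left _))
  have p1 : 0 ≤ Real.exp (-(2 * τ * unitWeight)) * (cutWeight χ τ (X l) * u l) ^ 2 := by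
    positivity
  by_cases h1 : l ∈ ballSet X 1
  · rw [Set.indicator_of_mem h1]
    by_cases h2 : l ∈ ballSet X (1 / 2)
    · rw [Set.indicator_of_mem h2]; linarith
    · rw [Set.indicator_of_notMem h2, zero_add]
      rw [mem_ballSet] at h1
      rw [mem_ballSet, not_le] at h2
      rw [cutWeight, hχ.one _ (by linarith) (by linarith), one_mul, mul_pow, ← mul_assoc]
      refine le_mul_of_one_le_left (sq_nonneg _) ?_
      rw [← Real.exp_nat_mul, ← Real.exp_add]
      refine Real.one_le_exp ?_
      have : unitWeight ≤ weight (X l) := weight_anti h1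
      push_cast
      nlinarith
  · rw [Set.indicator_of_notMem h1]
    exact add_nonneg (Set.indicator_nonneg (fun _ _ => sq_nonneg _) _) p1

end TwoLayers

end DiscreteCarleman

namespace DiscreteCarleman

open Finset
open scoped ContDiff RealInnerProductSpace

/-! ### The coupled estimate for both layers -/

section Coupled

variable {Λ : Type*} [AddCommGroup Λ] {ι : Type*} [Fintype ι]
variable {E : Type*} [NormedAddCommGroup E] [InnerProductSpace ℝ E] [FiniteDimensional ℝ E]

/-- The vertex of the layer with base point `p` belonging to a lattice vector, at mesh size `h`. -/
def layerPoint (pos : Λ →+ E) (h : ℝ) (p : E) (l : Λ) : E := h • (p + pos l)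

omit [FiniteDimensional ℝ E] in
theorem finite_ballSet_layerPoint {pos : Λ →+ E} (hfin : ∀ r : ℝ, {l | ‖pos l‖ ≤ r}.Finite)
    {h : ℝ} (hh : 0 < h) (p : E) (r : ℝ) : (ballSet (layerPoint pos h p) r).Finite := by
  refine (hfin (r / h + ‖p‖)).subset fun l hl => ?_
  rw [mem_ballSet, layerPoint, norm_smul, Real.norm_of_nonneg hh.le, mul_comm,
    ← le_div_iff₀ hh] at hl
  have : ‖pos l‖ ≤ ‖p + pos l‖ + ‖p‖ := by
    simpa using norm_sub_le (p + pos l) p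
  exact this.trans (by linarith)

/-- The layer estimate is used with the hidden edges `e m - e n` over ordered pairs, reversal being
the exchange of the two indices. It needs the hidden inequality up to radius 3; the neighbours of
such points stay within radius 4, where the equation holds. -/
theorem exists_one_sided_estimate {e : ι → Λ} {pos : Λ →+ E}
    (hP : ∀ x y : E, ∑ q : ι × ι, ⟪x, pos (e q.1 - e q.2)⟫ * ⟪y, pos (e q.1 - e q.2)⟫ = 2 * ⟪x, y⟫)
    (hfin : ∀ r : ℝ, {l | ‖pos l‖ ≤ r}.Finite) (p₁ p₂ : E) (M : ℝ)
    {χ : E → ℝ} (hχ : IsCutoff χ) :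
    ∃ K ε : ℝ, 0 < K ∧ 0 < ε ∧ ε ≤ 1 ∧ ∀ h τ : ℝ, 0 < h → 1 ≤ ε * τ → τ * h ≤ ε →
      ∀ u w V W : Λ → ℝ, (∀ l, |V l| ≤ M) → (∀ l, |W l| ≤ M) →
      (∀ l, ‖layerPoint pos h p₁ l‖ ≤ 4 → ∑ m, (w (l + e m) - u l) = -(h ^ 2 * (V l * u l))) →
      (∀ l, ‖layerPoint pos h p₂ l‖ ≤ 4 → ∑ m, (u (l - e m) - w l) = -(h ^ 2 * (W l * w l))) →
      τ ^ 3 * ∑' l, (cutWeight χ τ (layerPoint pos h p₁ l) * u l) ^ 2 ≤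
        K * (∑' l, (cutWeight χ τ (layerPoint pos h p₁ l) * u l) ^ 2 +
          ∑' l, (cutWeight χ τ (layerPoint pos h p₂ l) * w l) ^ 2 +
          Real.exp (2 * τ) * (mass (ballSet (layerPoint pos h p₁) (1 / 2)) u +
            mass (ballSet (layerPoint pos h p₂) (1 / 2)) w) +
          Real.exp (2 * τ * outerWeight) * (mass (ballSet (layerPoint pos h p₁) 2) u +
            mass (ballSet (layerPoint pos h p₂) 2) w)) := by
  obtain ⟨K, ε, hK, hε0, hε1, hlayer⟩ := exists_layer_estimate
    (v := fun q : ι × ι => e q.1 - e q.2) (η := fun q : ι × ι => pos (e q.1 - e q.2))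
    (σ := Equiv.prodComm ι ι) (fun q => (neg_sub _ _).symm)
    (fun q => by rw [← map_neg, neg_sub]; rfl) hP hχ
  obtain ⟨B, hB1, hB⟩ := exists_uniform_const (P := fun m B => ‖p₂ - p₁ + pos (e m)‖ ≤ B)
    (fun m a b hab H => H.trans hab) (fun m => ⟨_, le_rfl⟩)
  obtain ⟨C, hC1, hC⟩ := exists_uniform_const
    (P := fun m C => ∀ h (x : E), 0 ≤ h → h ≤ 1 → ‖x‖ ≤ 2 →
      |iterDiff h [-(p₂ - p₁ + pos (e m))] weight x| ≤ C * h ^ 1)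
    (fun m a b hab H h x hh hh1 hx => (H h x hh hh1 hx).trans
      (mul_le_mul_of_nonneg_right hab (by positivity)))
    (fun m => exists_abs_iterDiff_le [-(p₂ - p₁ + pos (e m))] contDiff_weight 2)
  obtain ⟨D, hD⟩ : ∃ D : ℝ, D = 18 * M ^ 2 * (Fintype.card ι : ℝ) ^ 2 := ⟨_, rfl⟩
  have hD0 : 0 ≤ D := by rw [hD]; positivity
  -- The second bound makes edges between the layers no longer than 1/100 and the variation of `τ *
  -- weight` along such an edge at most 1.
  obtain ⟨ε', hε'⟩ : ∃ δ : ℝ, δ = min ε (1 / (100 * B * C)) := ⟨_, rfl⟩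
  have hε'0 : 0 < ε' := by rw [hε']; exact lt_min hε0 (by positivity)
  have hε'1 : ε' ≤ ε := by rw [hε']; exact min_le_left _ _
  have hε'B : 100 * B * C * ε' ≤ 1 := by
    have : ε' ≤ 1 / (100 * B * C) := by rw [hε']; exact min_le_right _ _
    rwa [le_div_iff₀ (by positivity), mul_comm] at this
  refine ⟨K * (1 + 2 * D), ε', by positivity, hε'0, hε'1.trans hε1,
    fun h τ hh hετ hτh u w V W hV hW hA hBeq => ?_⟩
  have hτpos : 0 < τ := by
    by_contra hcon
    nlinarith
  have hτ1 : 1 ≤ τ := by nlinarith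
  have hhε : h ≤ ε' := (le_mul_of_one_le_left hh.le hτ1).trans hτh
  have hh1 : h ≤ 1 := by linarith
  have hBC : B ≤ B * C := le_mul_of_one_le_right (by linarith) hC1
  have hCB : C ≤ B * C := le_mul_of_one_le_left (by linarith) hB1
  have hhB : h * B ≤ 1 / 100 := by nlinarith
  have hτC : τ * (C * h) ≤ 1 := by nlinarith [mul_pos hτpos hh]
  have hXY : ∀ l m, layerPoint pos h p₁ l =
      layerPoint pos h p₂ (l + e m) + h • -(p₂ - p₁ + pos (e m)) := by
    intro l m
    simp only [layerPoint, map_add]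
    module
  have hb : ∀ m, ‖h • -(p₂ - p₁ + pos (e m))‖ ≤ 1 / 100 := by
    intro m
    rw [norm_smul, norm_neg, Real.norm_of_nonneg hh.le]
    exact (mul_le_mul_of_nonneg_left (hB m) hh.le).trans hhB
  have hYX : ∀ l m, ‖layerPoint pos h p₂ (l + e m)‖ ≤ ‖layerPoint pos h p₁ l‖ + 1 / 100 := by
    intro l m
    have h1 : layerPoint pos h p₂ (l + e m) =
        layerPoint pos h p₁ l - h • -(p₂ - p₁ + pos (e m)) := by
      rw [hXY l m, add_sub_cancel_right]
    rw [h1]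
    exact (norm_sub_le _ _).trans (by linarith [hb m])
  have hw : ∀ l m, ‖layerPoint pos h p₂ (l + e m)‖ ≤ 2 →
      τ * weight (layerPoint pos h p₁ l) ≤ τ * weight (layerPoint pos h p₂ (l + e m)) + 1 := by
    intro l m hl
    have h1 := (abs_le.1 (hC m h _ hh.le hh1 hl)).2
    simp only [iterDiff, fwdDiff, pow_one, ← hXY] at h1
    nlinarith
  have f₁ := finite_ballSet_layerPoint hfin hh p₁
  have f₂ := finite_ballSet_layerPoint hfin hh p₂
  have hlap : ∀ l, ‖layerPoint pos h p₁ l‖ ≤ 3 →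
      |lap (fun q : ι × ι => e q.1 - e q.2) u l| ≤ h ^ 2 * neighborBound e M u w l := by
    intro l hl
    refine abs_lap_le_neighborBound (V := V) (W := W) (hA l (by linarith)) (fun m => ?_) (hV l)
      fun m => hW _
    exact hBeq _ (by linarith [hYX l m])
  have key := hlayer h τ (layerPoint pos h p₁) hh
    (hετ.trans (mul_le_mul_of_nonneg_right hε'1 hτpos.le)) (hτh.trans hε'1)
    (fun l q => by simp only [layerPoint, map_add]; module) f₁ u (neighborBound e M u w) hlap
  have c1 := tsum_cutWeight_neighborBound_le (M := M) (u := u) (w := w) hχ hτpos.le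
    (f₁ 2) (f₂ 2) hYX hw
  have cin := mass_neighborBound_le (e := e) (M := M) (u := u) (w := w)
    (A := innerRegion (layerPoint pos h p₁)) (A' := ballSet (layerPoint pos h p₁) (1 / 2))
    (B := ballSet (layerPoint pos h p₂) (1 / 2))
    (fun l hl => by rw [mem_innerRegion] at hl; rw [mem_ballSet]; linarith) (f₁ _) (f₂ _)
    (fun l hl m => by rw [mem_innerRegion] at hl; rw [mem_ballSet]; linarith [hYX l m])
  have cout := mass_neighborBound_le (e := e) (M := M) (u := u) (w := w)
    (A := outerRegion (layerPoint pos h p₁)) (A' := ballSet (layerPoint pos h p₁) 2)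
    (B := ballSet (layerPoint pos h p₂) 2)
    (fun l hl => by rw [mem_outerRegion] at hl; rw [mem_ballSet]; linarith [hl.2]) (f₁ _) (f₂ _)
    (fun l hl m => by rw [mem_outerRegion] at hl; rw [mem_ballSet]; linarith [hYX l m, hl.2])
  have uin : mass (innerRegion (layerPoint pos h p₁)) u ≤
      mass (ballSet (layerPoint pos h p₁) (1 / 2)) u :=
    mass_mono (fun l hl => by rw [mem_innerRegion] at hl; rw [mem_ballSet]; linarith) (f₁ _) u
  have uout : mass (outerRegion (layerPoint pos h p₁)) u ≤
      mass (ballSet (layerPoint pos h p₁) 2) u :=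
    mass_mono (fun l hl => by rw [mem_outerRegion] at hl; rw [mem_ballSet]; linarith [hl.2])
      (f₁ _) u
  refine key.trans ?_
  rw [mul_assoc K]
  refine mul_le_mul_of_nonneg_left ?_ hK.le
  rw [← hD] at c1
  have hD' : 2 * M ^ 2 * (Fintype.card ι : ℝ) ^ 2 ≤ D := by
    rw [hD]
    have : 0 ≤ M ^ 2 * (Fintype.card ι : ℝ) ^ 2 := by positivity
    linarith
  have nA : 0 ≤ ∑' l, (cutWeight χ τ (layerPoint pos h p₁ l) * u l) ^ 2 :=
    tsum_nonneg fun l => sq_nonneg _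
  have nB : 0 ≤ ∑' l, (cutWeight χ τ (layerPoint pos h p₂ l) * w l) ^ 2 :=
    tsum_nonneg fun l => sq_nonneg _
  have n1 := mass_nonneg (ballSet (layerPoint pos h p₁) (1 / 2)) u
  have n2 := mass_nonneg (ballSet (layerPoint pos h p₂) (1 / 2)) w
  have n3 := mass_nonneg (ballSet (layerPoint pos h p₁) 2) u
  have n4 := mass_nonneg (ballSet (layerPoint pos h p₂) 2) w
  generalize ∑' l, (cutWeight χ τ (layerPoint pos h p₁ l) * u l) ^ 2 = a at *
  generalize ∑' l, (cutWeight χ τ (layerPoint pos h p₂ l) * w l) ^ 2 = b at *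
  generalize mass (ballSet (layerPoint pos h p₁) (1 / 2)) u = m₁ at *
  generalize mass (ballSet (layerPoint pos h p₂) (1 / 2)) w = m₂ at *
  generalize mass (ballSet (layerPoint pos h p₁) 2) u = m₃ at *
  generalize mass (ballSet (layerPoint pos h p₂) 2) w = m₄ at *
  have x1 := Real.exp_pos (2 * τ)
  have x2 := Real.exp_pos (2 * τ * outerWeight)
  generalize Real.exp (2 * τ) = r₁ at *
  generalize Real.exp (2 * τ * outerWeight) = r₂ at *
  have d1 : mass (innerRegion (layerPoint pos h p₁)) u +
      mass (innerRegion (layerPoint pos h p₁)) (neighborBound e M u w) ≤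
      (1 + D) * (m₁ + m₂) := by
    have := mul_le_mul_of_nonneg_right hD' (add_nonneg n1 n2)
    linarith
  have d2 : mass (outerRegion (layerPoint pos h p₁)) u +
      mass (outerRegion (layerPoint pos h p₁)) (neighborBound e M u w) ≤
      (1 + D) * (m₃ + m₄) := by
    have := mul_le_mul_of_nonneg_right hD' (add_nonneg n3 n4)
    linarith
  have d3 := mul_le_mul_of_nonneg_left d1 x1.le
  have d4 := mul_le_mul_of_nonneg_left d2 x2.le
  have q1 : 0 ≤ D * (r₁ * m₁) := by positivity
  have q2 : 0 ≤ D * (r₂ * m₃) := by positivity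
  have q3 : 0 ≤ D * a := by positivity
  have q4 : 0 ≤ D * b := by positivity
  linarith

theorem exists_two_layer_estimate {e : ι → Λ} {pos : Λ →+ E}
    (hP : ∀ x y : E, ∑ q : ι × ι, ⟪x, pos (e q.1 - e q.2)⟫ * ⟪y, pos (e q.1 - e q.2)⟫ = 2 * ⟪x, y⟫)
    (hfin : ∀ r : ℝ, {l | ‖pos l‖ ≤ r}.Finite) (p₁ p₂ : E) (M : ℝ) :
    ∃ K ε : ℝ, 1 ≤ K ∧ 0 < ε ∧ ε ≤ 1 ∧ ∀ h τ : ℝ, 0 < h → 1 ≤ ε * τ → τ * h ≤ ε →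
      ∀ u w V W : Λ → ℝ, (∀ l, |V l| ≤ M) → (∀ l, |W l| ≤ M) →
      (∀ l, ‖layerPoint pos h p₁ l‖ ≤ 4 → ∑ m, (w (l + e m) - u l) = -(h ^ 2 * (V l * u l))) →
      (∀ l, ‖layerPoint pos h p₂ l‖ ≤ 4 → ∑ m, (u (l - e m) - w l) = -(h ^ 2 * (W l * w l))) →
      mass (ballSet (layerPoint pos h p₁) 1) u + mass (ballSet (layerPoint pos h p₂) 1) w ≤
        K * (Real.exp (2 * τ) * (mass (ballSet (layerPoint pos h p₁) (1 / 2)) u +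
            mass (ballSet (layerPoint pos h p₂) (1 / 2)) w) +
          Real.exp (-(2 * τ * (unitWeight - outerWeight))) *
            (mass (ballSet (layerPoint pos h p₁) 2) u +
              mass (ballSet (layerPoint pos h p₂) 2) w)) := by
  obtain ⟨χ, hχ⟩ := exists_isCutoff (E := E)
  obtain ⟨K₁, ε₁, hK₁, hε₁0, hε₁1, H₁⟩ := exists_one_sided_estimate hP hfin p₁ p₂ M hχ
  -- Seen from the second layer, the base points are exchanged and the edges are `-e m`; the frame
  -- identity is insensitive to the sign.
  obtain ⟨K₂, ε₂, hK₂, hε₂0, hε₂1, H₂⟩ := exists_one_sided_estimate (e := fun m => -e m)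
    (fun x y => by
      rw [← hP x y]
      refine sum_congr rfl fun q _ => ?_
      rw [show -e q.1 - -e q.2 = -(e q.1 - e q.2) by abel, map_neg, inner_neg_right,
        inner_neg_right, neg_mul_neg]) hfin p₂ p₁ M hχ
  obtain ⟨K, hK⟩ : ∃ K, K = K₁ + K₂ := ⟨_, rfl⟩
  have hK0 : 0 < K := by rw [hK]; positivity
  obtain ⟨ε, hε⟩ : ∃ δ : ℝ, δ = min (min ε₁ ε₂) (1 / (1 + K)) := ⟨_, rfl⟩
  have hε0 : 0 < ε := by rw [hε]; exact lt_min (lt_min hε₁0 hε₂0) (by positivity)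
  have b1 : ε ≤ ε₁ := by rw [hε]; exact (min_le_left _ _).trans (min_le_left _ _)
  have b2 : ε ≤ ε₂ := by rw [hε]; exact (min_le_left _ _).trans (min_le_right _ _)
  have b3 : ε * (1 + K) ≤ 1 := by
    have : ε ≤ 1 / (1 + K) := by rw [hε]; exact min_le_right _ _
    rwa [le_div_iff₀ (by positivity)] at this
  refine ⟨1 + K, ε, by linarith, hε0, b1.trans hε₁1,
    fun h τ hh hετ hτh u w V W hV hW hA hB => ?_⟩
  have hτ0 : 0 < τ := by
    by_contra hcon
    nlinarith
  have hτ1 : 1 ≤ τ := by nlinarith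
  have hτK : 1 + K ≤ τ := by
    have : ε * (1 + K) ≤ ε * τ := b3.trans hετ
    exact le_of_mul_le_mul_left this hε0
  have f₁ := finite_ballSet_layerPoint hfin hh p₁
  have f₂ := finite_ballSet_layerPoint hfin hh p₂
  have h₁ := H₁ h τ hh (hετ.trans (mul_le_mul_of_nonneg_right b1 hτ0.le)) (hτh.trans b1)
    u w V W hV hW hA hB
  have h₂ := H₂ h τ hh (hετ.trans (mul_le_mul_of_nonneg_right b2 hτ0.le)) (hτh.trans b2)
    w u W V hW hV (fun l hl => by simpa only [sub_eq_add_neg] using hB l hl)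
    (fun l hl => by simpa only [sub_neg_eq_add] using hA l hl)
  have g₁ := mass_ball_one_le hχ hτ0.le (f₁ 2) u
  have g₂ := mass_ball_one_le hχ hτ0.le (f₂ 2) w
  have nA : 0 ≤ ∑' l, (cutWeight χ τ (layerPoint pos h p₁ l) * u l) ^ 2 :=
    tsum_nonneg fun l => sq_nonneg _
  have nB : 0 ≤ ∑' l, (cutWeight χ τ (layerPoint pos h p₂ l) * w l) ^ 2 :=
    tsum_nonneg fun l => sq_nonneg _
  have n1 := mass_nonneg (ballSet (layerPoint pos h p₁) (1 / 2)) u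
  have n2 := mass_nonneg (ballSet (layerPoint pos h p₂) (1 / 2)) w
  have n3 := mass_nonneg (ballSet (layerPoint pos h p₁) 2) u
  have n4 := mass_nonneg (ballSet (layerPoint pos h p₂) 2) w
  have x1 : 1 ≤ Real.exp (2 * τ) := Real.one_le_exp (by linarith)
  have x2 : Real.exp (-(2 * τ * unitWeight)) ≤ 1 := Real.exp_le_one_iff.2 (by
    have : 0 < unitWeight := Real.exp_pos _
    have : 0 < 2 * τ * unitWeight := by positivity
    linarith)
  have x3 : Real.exp (-(2 * τ * unitWeight)) * Real.exp (2 * τ * outerWeight) =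
      Real.exp (-(2 * τ * (unitWeight - outerWeight))) := by
    rw [← Real.exp_add]; congr 1; ring
  have x4 := Real.exp_pos (-(2 * τ * unitWeight))
  have x5 := Real.exp_pos (-(2 * τ * (unitWeight - outerWeight)))
  have x6 := Real.exp_pos (2 * τ * outerWeight)
  generalize ∑' l, (cutWeight χ τ (layerPoint pos h p₁ l) * u l) ^ 2 = a at *
  generalize ∑' l, (cutWeight χ τ (layerPoint pos h p₂ l) * w l) ^ 2 = b at *
  generalize mass (ballSet (layerPoint pos h p₁) (1 / 2)) u = m₁ at *
  generalize mass (ballSet (layerPoint pos h p₂) (1 / 2)) w = m₂ at *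
  generalize mass (ballSet (layerPoint pos h p₁) 2) u = m₃ at *
  generalize mass (ballSet (layerPoint pos h p₂) 2) w = m₄ at *
  generalize Real.exp (2 * τ) = r₁ at *
  generalize Real.exp (2 * τ * outerWeight) = r₂ at *
  generalize Real.exp (-(2 * τ * unitWeight)) = r₃ at *
  generalize Real.exp (-(2 * τ * (unitWeight - outerWeight))) = r₄ at *
  have hr₁ : 0 < r₁ := by linarith
  obtain ⟨S, hS⟩ : ∃ S, S = r₁ * (m₁ + m₂) + r₂ * (m₃ + m₄) := ⟨_, rfl⟩
  have k1 : τ ^ 3 * (a + b) ≤ K * (a + b + S) := by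
    rw [hK, hS]; linarith
  -- The entry `1 / (1 + K)` in `ε` forces `τ ≥ 1 + K`. After the absorption of `K * (a + b)`, one
  -- copy of `a + b` remains on the left.
  have k2 : 1 + K ≤ τ ^ 3 := hτK.trans (by
    calc τ = τ ^ 1 := (pow_one τ).symm
      _ ≤ τ ^ 3 := pow_le_pow_right₀ hτ1 (by norm_num))
  have k3 := mul_le_mul_of_nonneg_right k2 (add_nonneg nA nB)
  have k4 : a + b ≤ K * S := by linarith
  have k5 := mul_le_mul_of_nonneg_left k4 x4.le
  have k6 : r₃ * (K * S) = K * ((r₃ * r₁) * (m₁ + m₂) + (r₃ * r₂) * (m₃ + m₄)) := by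
    rw [hS]; ring
  have k7 : r₃ * r₁ * (m₁ + m₂) ≤ r₁ * (m₁ + m₂) :=
    mul_le_mul_of_nonneg_right (mul_le_of_le_one_left hr₁.le x2) (by linarith)
  have k8 : m₁ + m₂ ≤ r₁ * (m₁ + m₂) := le_mul_of_one_le_left (by linarith) x1
  have k9 := mul_le_mul_of_nonneg_left k7 hK0.le
  have k10 : 0 ≤ r₄ * (m₃ + m₄) := by positivity
  rw [x3] at k6
  linarith

end Coupled

end DiscreteCarleman

/-! ### The Euclidean structure of the hidden graph -/

namespace HexagonalFrame

open Finset Matrix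
open scoped RealInnerProductSpace

variable {d : ℕ} (Γ : HexagonalFrame d)

theorem disjoint_layers {h : ℝ} (hh : h ≠ 0) {x : Fin d → ℝ} (h₁ : x ∈ Γ.layer₁ h)
    (h₂ : x ∈ Γ.layer₂ h) : False := by
  obtain ⟨l, hl, rfl⟩ := h₁
  obtain ⟨l', hl', he⟩ := h₂
  rw [← smul_add, ← smul_add] at he
  have h3 : Γ.p₁ + l = Γ.p₂ + l' := smul_right_injective _ hh he
  refine Γ.sub_notMem ?_
  have h4 : Γ.p₂ - Γ.p₁ = l - l' := by
    rw [sub_eq_sub_iff_add_eq_add, ← h3, add_comm]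
  rw [h4]
  exact sub_mem hl hl'

section Span

/-- Every step from the first layer to the second adds `v ⬝ᵥ (p₂ - p₁ + e m)`, which does not depend
on `m`, and every step back subtracts the same number. So along a walk `v ⬝ᵥ x` depends on the layer
only. -/
theorem dotProduct_invariant {v : Fin d → ℝ} (hv : ∀ m n, v ⬝ᵥ (Γ.e m - Γ.e n) = 0)
    {x y : Γ.Vertex 1} (w : (Γ.graph 1 one_pos).Walk x y)
    (hx : (x.1 ∈ Γ.layer₁ 1 → v ⬝ᵥ x.1 = v ⬝ᵥ Γ.p₁) ∧
      (x.1 ∈ Γ.layer₂ 1 → ∀ m, v ⬝ᵥ x.1 = v ⬝ᵥ (Γ.p₂ + Γ.e m))) :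
    (y.1 ∈ Γ.layer₁ 1 → v ⬝ᵥ y.1 = v ⬝ᵥ Γ.p₁) ∧
      (y.1 ∈ Γ.layer₂ 1 → ∀ m, v ⬝ᵥ y.1 = v ⬝ᵥ (Γ.p₂ + Γ.e m)) := by
  induction w with
  | nil => exact hx
  | cons hadj p ih =>
    refine ih ?_
    rcases hadj with ⟨⟨l, hl, hxl⟩, m, hy⟩ | ⟨⟨l, hl, hxl⟩, m, hy⟩
    · have h1 := hx.1 ⟨l, hl, hxl⟩
      refine ⟨fun hy1 => ?_, fun _ m' => ?_⟩
      · refine (Γ.disjoint_layers one_ne_zero hy1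
          ⟨l + Γ.e m, add_mem hl (Γ.e_mem m), ?_⟩).elim
        rw [hy, hxl]; module
      · have h2 := hv m m'
        simp only [one_smul, dotProduct_sub, dotProduct_add, hy, h1] at h2 ⊢
        linarith
    · have h1 := hx.2 ⟨l, hl, hxl⟩ m
      refine ⟨fun _ => ?_, fun hy2 => ?_⟩
      · simp only [one_smul, dotProduct_sub, dotProduct_add, hy, h1]
        ring
      · refine (Γ.disjoint_layers one_ne_zero
          ⟨l - Γ.e m, sub_mem hl (Γ.e_mem m), ?_⟩ hy2).elim
        rw [hy, hxl]; module

/-- A walk from `p₁` to `p₁` plus a basis vector shows that `v` is orthogonal to the basis. This is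
the one point where connectedness itself is exploited; it yields the invertibility of the Gram
matrix. -/
theorem eq_zero_of_dotProduct_sub (hconn : (Γ.graph 1 one_pos).Connected) {v : Fin d → ℝ}
    (hv : ∀ m n, v ⬝ᵥ (Γ.e m - Γ.e n) = 0) : v = 0 := by
  have hx₀ : Γ.p₁ ∈ Γ.layer₁ 1 := ⟨0, zero_mem _, by simp⟩
  have hb : ∀ i, v ⬝ᵥ Γ.basis i = 0 := by
    intro i
    have hy₀ : Γ.p₁ + Γ.basis i ∈ Γ.layer₁ 1 :=
      ⟨Γ.basis i, Submodule.subset_span (Set.mem_range_self i), by simp⟩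
    obtain ⟨w⟩ := hconn.preconnected ⟨Γ.p₁, Or.inl hx₀⟩ ⟨Γ.p₁ + Γ.basis i, Or.inl hy₀⟩
    have h1 := (Γ.dotProduct_invariant hv w
      ⟨fun _ => rfl, fun h2 => (Γ.disjoint_layers one_ne_zero hx₀ h2).elim⟩).1 hy₀
    simpa [dotProduct_add] using h1
  have hlin : dotProductBilin ℝ ℝ v = 0 := Γ.basis.ext fun i => by
    simpa using hb i
  have : v ⬝ᵥ v = 0 := by
    have := LinearMap.congr_fun hlin v
    simpa using this
  exact dotProduct_self_eq_zero.1 this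

end Span

/-- The Gram matrix of the hidden edge vectors. -/
def gram : Matrix (Fin d) (Fin d) ℝ :=
  (Matrix.of Γ.hiddenEdge).transpose * Matrix.of Γ.hiddenEdge

theorem dotProduct_gram_mulVec (x y : Fin d → ℝ) :
    x ⬝ᵥ Γ.gram *ᵥ y = ∑ q, (Γ.hiddenEdge q ⬝ᵥ x) * (Γ.hiddenEdge q ⬝ᵥ y) := by
  rw [gram, ← mulVec_mulVec, dotProduct_mulVec, vecMul_transpose]
  rfl

theorem isUnit_det_gram (hconn : (Γ.graph 1 one_pos).Connected) : IsUnit Γ.gram.det := by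
  rw [isUnit_iff_ne_zero]
  intro h0
  obtain ⟨v, hv0, hv⟩ := exists_mulVec_eq_zero_iff.2 h0
  refine hv0 (Γ.eq_zero_of_dotProduct_sub hconn ?_)
  have h1 := Γ.dotProduct_gram_mulVec v v
  rw [hv, dotProduct_zero, eq_comm, sum_eq_zero_iff_of_nonneg fun q _ => mul_self_nonneg _] at h1
  have h2 : ∀ m n, m < n → v ⬝ᵥ (Γ.e m - Γ.e n) = 0 := by
    intro m n hmn
    have := h1 ⟨(m, n), hmn⟩ (mem_univ _)
    rw [mul_self_eq_zero, dotProduct_comm] at this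
    exact this
  intro m n
  rcases lt_trichotomy m n with hmn | rfl | hmn
  · exact h2 m n hmn
  · simp
  · rw [← neg_sub, dotProduct_neg, h2 n m hmn, neg_zero]

/-- The linear map which turns the norm of the hidden graph into a Euclidean norm. -/
noncomputable def toEuclidean :
    (Fin d → ℝ) →ₗ[ℝ] EuclideanSpace ℝ {q : Fin Γ.k × Fin Γ.k // q.1 < q.2} :=
  (WithLp.linearEquiv 2 ℝ _).symm.toLinearMap ∘ₗ
    (Matrix.of Γ.hiddenEdge * Γ.gram⁻¹).mulVecLin

theorem toEuclidean_apply (x : Fin d → ℝ) (q : {q : Fin Γ.k × Fin Γ.k // q.1 < q.2}) :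
    Γ.toEuclidean x q = Γ.hiddenEdge q ⬝ᵥ (Γ.gram⁻¹ *ᵥ x) := by
  change ((Matrix.of Γ.hiddenEdge * Γ.gram⁻¹) *ᵥ x) q = _
  rw [← mulVec_mulVec]
  rfl

variable {Γ}

/-- With `A` the matrix of hidden edges and `G = AᵀA`, the map is `x ↦ A G⁻¹ x`, so the inner
product is `xᵀ G⁻¹ G G⁻¹ y`. -/
theorem inner_toEuclidean (hconn : (Γ.graph 1 one_pos).Connected) (x y : Fin d → ℝ) :
    ⟪Γ.toEuclidean x, Γ.toEuclidean y⟫ = (Γ.gram⁻¹ *ᵥ x) ⬝ᵥ y := by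
  have h1 : ⟪Γ.toEuclidean x, Γ.toEuclidean y⟫ =
      ∑ q, (Γ.hiddenEdge q ⬝ᵥ (Γ.gram⁻¹ *ᵥ x)) * (Γ.hiddenEdge q ⬝ᵥ (Γ.gram⁻¹ *ᵥ y)) := by
    rw [PiLp.inner_apply]
    refine sum_congr rfl fun q _ => ?_
    rw [toEuclidean_apply, toEuclidean_apply]
    simp [mul_comm]
  rw [h1, ← dotProduct_gram_mulVec, mulVec_mulVec,
    mul_nonsing_inv _ (Γ.isUnit_det_gram hconn), one_mulVec]

theorem norm_toEuclidean (hconn : (Γ.graph 1 one_pos).Connected) (x : Fin d → ℝ) :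
    ‖Γ.toEuclidean x‖ = onePointNorm Γ.hiddenEdge x := by
  rw [@norm_eq_sqrt_real_inner _ _ _ (Γ.toEuclidean x), inner_toEuclidean hconn, onePointNorm,
    dotProduct_comm]
  rfl

theorem toEuclidean_injective (hconn : (Γ.graph 1 one_pos).Connected) :
    LinearMap.ker Γ.toEuclidean = ⊥ := by
  rw [LinearMap.ker_eq_bot']
  intro x hx
  have h1 : Γ.gram⁻¹ *ᵥ x = 0 := by
    refine Γ.eq_zero_of_dotProduct_sub hconn ?_
    intro m n
    rw [← inner_toEuclidean hconn, hx, inner_zero_left]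
  calc x = Γ.gram *ᵥ (Γ.gram⁻¹ *ᵥ x) := by
        rw [mulVec_mulVec, mul_nonsing_inv _ (Γ.isUnit_det_gram hconn), one_mulVec]
    _ = 0 := by rw [h1, mulVec_zero]

theorem sum_prod_eq_two_mul_sum_lt {k : ℕ} (F : Fin k × Fin k → ℝ)
    (hsymm : ∀ q, F q.swap = F q) (hdiag : ∀ m, F (m, m) = 0) :
    ∑ q, F q = 2 * ∑ q : {q : Fin k × Fin k // q.1 < q.2}, F q.1 := by
  have h1 : ∑ q : {q : Fin k × Fin k // q.1 < q.2}, F q.1 =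
      ∑ q : Fin k × Fin k, if q.1 < q.2 then F q else 0 := by
    rw [← sum_filter]
    exact (sum_subtype _ (by simp) F).symm
  have h2 : ∑ q : Fin k × Fin k, (if q.2 < q.1 then F q else 0) =
      ∑ q : Fin k × Fin k, if q.1 < q.2 then F q else 0 := by
    rw [← Equiv.sum_comp (Equiv.prodComm (Fin k) (Fin k))]
    exact sum_congr rfl fun q _ => by simp [hsymm q]
  have h3 : ∀ q, F q = (if q.1 < q.2 then F q else 0) + if q.2 < q.1 then F q else 0 := by
    rintro ⟨m, n⟩
    rcases lt_trichotomy m n with h | rfl | h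
    · simp [h, h.not_gt]
    · simp [hdiag]
    · simp [h, h.not_gt]
  rw [sum_congr rfl fun q _ => h3 q, sum_add_distrib, h2, h1]
  ring

/-- The inner product of `toEuclidean x` with the image of the edge `q` is the `q`-th coordinate of
`toEuclidean x`. The pairs `m < n` therefore give the inner product once, and the reversed pairs
give it a second time. -/
theorem parseval_toEuclidean (hconn : (Γ.graph 1 one_pos).Connected) (x y : Fin d → ℝ) :
    ∑ q : Fin Γ.k × Fin Γ.k, ⟪Γ.toEuclidean x, Γ.toEuclidean (Γ.e q.1 - Γ.e q.2)⟫ *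
      ⟪Γ.toEuclidean y, Γ.toEuclidean (Γ.e q.1 - Γ.e q.2)⟫ =
      2 * ⟪Γ.toEuclidean x, Γ.toEuclidean y⟫ := by
  rw [sum_prod_eq_two_mul_sum_lt]
  · congr 1
    rw [PiLp.inner_apply]
    refine sum_congr rfl fun q _ => ?_
    rw [toEuclidean_apply, toEuclidean_apply, inner_toEuclidean hconn, inner_toEuclidean hconn,
      dotProduct_comm, dotProduct_comm (Γ.gram⁻¹ *ᵥ y)]
    simp only [hiddenEdge, RCLike.inner_apply, conj_trivial]
    ring
  · intro q
    rw [Prod.fst_swap, Prod.snd_swap, ← neg_sub (Γ.e q.1) (Γ.e q.2), map_neg, inner_neg_right,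
      inner_neg_right, neg_mul_neg]
  · intro m
    simp

end HexagonalFrame

/-! ### Transfer between the vertices and two copies of the lattice -/

namespace HexagonalFrame

open Finset DiscreteCarleman
open scoped RealInnerProductSpace

variable {d : ℕ} (Γ : HexagonalFrame d)

/-- The vertex of the first layer belonging to a lattice vector. -/
def vertex₁ (h : ℝ) (l : Γ.lattice) : Γ.Vertex h :=
  ⟨h • Γ.p₁ + h • l.1, Or.inl ⟨l.1, l.2, rfl⟩⟩

/-- The vertex of the second layer belonging to a lattice vector. -/
def vertex₂ (h : ℝ) (l : Γ.lattice) : Γ.Vertex h :=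
  ⟨h • Γ.p₂ + h • l.1, Or.inr ⟨l.1, l.2, rfl⟩⟩

/-- An edge vector as an element of the lattice. -/
def latticeEdge (m : Fin Γ.k) : Γ.lattice := ⟨Γ.e m, Γ.e_mem m⟩

variable {Γ}

theorem vertex₁_injective {h : ℝ} (hh : 0 < h) : Function.Injective (Γ.vertex₁ h) := by
  intro l l' he
  have h1 := congrArg Subtype.val he
  exact Subtype.ext (smul_right_injective _ hh.ne' (add_left_cancel h1))

theorem vertex₂_injective {h : ℝ} (hh : 0 < h) : Function.Injective (Γ.vertex₂ h) := by
  intro l l' he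
  have h1 := congrArg Subtype.val he
  exact Subtype.ext (smul_right_injective _ hh.ne' (add_left_cancel h1))

theorem latticeEdge_injective : Function.Injective Γ.latticeEdge := fun _ _ he =>
  Γ.e_injective (congrArg Subtype.val he)

/-- The vertices are parametrized by two copies of the lattice. -/
noncomputable def vertexEquiv {h : ℝ} (hh : 0 < h) : Γ.lattice ⊕ Γ.lattice ≃ Γ.Vertex h :=
  Equiv.ofBijective (Sum.elim (Γ.vertex₁ h) (Γ.vertex₂ h)) <| by
    refine ⟨(vertex₁_injective hh).sumElim (vertex₂_injective hh) fun l l' he => ?_, ?_⟩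
    · exact Γ.disjoint_layers hh.ne' ⟨l.1, l.2, rfl⟩ ⟨l'.1, l'.2, congrArg Subtype.val he⟩
    · rintro ⟨x, ⟨l, hl, rfl⟩ | ⟨l, hl, rfl⟩⟩
      · exact ⟨Sum.inl ⟨l, hl⟩, rfl⟩
      · exact ⟨Sum.inr ⟨l, hl⟩, rfl⟩

theorem vertexEquiv_inl {h : ℝ} (hh : 0 < h) (l : Γ.lattice) :
    vertexEquiv hh (Sum.inl l) = Γ.vertex₁ h l := rfl

theorem vertexEquiv_inr {h : ℝ} (hh : 0 < h) (l : Γ.lattice) :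
    vertexEquiv hh (Sum.inr l) = Γ.vertex₂ h l := rfl

theorem neighborSet_vertex₁ {h : ℝ} (hh : 0 < h) (l : Γ.lattice) :
    (Γ.graph h hh).neighborSet (Γ.vertex₁ h l) =
      Set.range fun m => Γ.vertex₂ h (l + Γ.latticeEdge m) := by
  ext y
  rw [SimpleGraph.mem_neighborSet, Set.mem_range]
  constructor
  · rintro (⟨-, m, hy⟩ | ⟨h2, -⟩)
    · refine ⟨m, Subtype.ext ?_⟩
      rw [hy]
      change h • Γ.p₂ + h • (l.1 + Γ.e m) = h • Γ.p₁ + h • l.1 + h • (Γ.p₂ - Γ.p₁ + Γ.e m)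
      module
    · exact (Γ.disjoint_layers hh.ne' ⟨l.1, l.2, rfl⟩ h2).elim
  · rintro ⟨m, rfl⟩
    refine Or.inl ⟨⟨l.1, l.2, rfl⟩, m, ?_⟩
    change h • Γ.p₂ + h • (l.1 + Γ.e m) = h • Γ.p₁ + h • l.1 + h • (Γ.p₂ - Γ.p₁ + Γ.e m)
    module

theorem neighborSet_vertex₂ {h : ℝ} (hh : 0 < h) (l : Γ.lattice) :
    (Γ.graph h hh).neighborSet (Γ.vertex₂ h l) =
      Set.range fun m => Γ.vertex₁ h (l - Γ.latticeEdge m) := by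
  ext y
  rw [SimpleGraph.mem_neighborSet, Set.mem_range]
  constructor
  · rintro (⟨h2, -⟩ | ⟨-, m, hy⟩)
    · exact (Γ.disjoint_layers hh.ne' h2 ⟨l.1, l.2, rfl⟩).elim
    · refine ⟨m, Subtype.ext ?_⟩
      rw [hy]
      change h • Γ.p₁ + h • (l.1 - Γ.e m) = h • Γ.p₂ + h • l.1 - h • (Γ.p₂ - Γ.p₁ + Γ.e m)
      module
  · rintro ⟨m, rfl⟩
    refine Or.inr ⟨⟨l.1, l.2, rfl⟩, m, ?_⟩
    change h • Γ.p₁ + h • (l.1 - Γ.e m) = h • Γ.p₂ + h • l.1 - h • (Γ.p₂ - Γ.p₁ + Γ.e m)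
    module

theorem laplacian_vertex₁ {h : ℝ} (hh : 0 < h) (u : Γ.Vertex h → ℝ) (l : Γ.lattice) :
    Γ.laplacian h hh u (Γ.vertex₁ h l) =
      ∑ m, (u (Γ.vertex₂ h (l + Γ.latticeEdge m)) - u (Γ.vertex₁ h l)) := by
  rw [laplacian, neighborSet_vertex₁, finsum_mem_range, finsum_eq_sum_of_fintype]
  exact (vertex₂_injective hh).comp ((add_right_injective l).comp latticeEdge_injective)

theorem laplacian_vertex₂ {h : ℝ} (hh : 0 < h) (u : Γ.Vertex h → ℝ) (l : Γ.lattice) :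
    Γ.laplacian h hh u (Γ.vertex₂ h l) =
      ∑ m, (u (Γ.vertex₁ h (l - Γ.latticeEdge m)) - u (Γ.vertex₂ h l)) := by
  rw [laplacian, neighborSet_vertex₂, finsum_mem_range, finsum_eq_sum_of_fintype]
  exact (vertex₁_injective hh).comp ((sub_right_injective).comp latticeEdge_injective)

theorem laplacian_eq_of_schrodinger {h : ℝ} (hh : 0 < h) {V u : Γ.Vertex h → ℝ} {x : Γ.Vertex h}
    (hx : Γ.schrodinger h hh V u x = 0) : Γ.laplacian h hh u x = -(h ^ 2 * (V x * u x)) := by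
  have h2 : h ^ 2 ≠ 0 := by positivity
  rw [schrodinger] at hx
  field_simp at hx
  linarith

variable (Γ) in
/-- The lattice vectors as points of the Euclidean space on which the hidden graph lives. -/
noncomputable def latticePos : Γ.lattice →+ LinearMap.range Γ.toEuclidean :=
  Γ.toEuclidean.rangeRestrict.toAddMonoidHom.comp Γ.lattice.subtype.toAddMonoidHom

/-- The frame identity concerns vectors in the range of `toEuclidean`; in the surrounding coordinate
space it would in general involve the projection onto that range. Hence the range serves as the
Euclidean space. -/
theorem parseval_latticePos (hconn : (Γ.graph 1 one_pos).Connected)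
    (x y : LinearMap.range Γ.toEuclidean) :
    ∑ q : Fin Γ.k × Fin Γ.k, ⟪x, Γ.latticePos (Γ.latticeEdge q.1 - Γ.latticeEdge q.2)⟫ *
      ⟪y, Γ.latticePos (Γ.latticeEdge q.1 - Γ.latticeEdge q.2)⟫ = 2 * ⟪x, y⟫ := by
  obtain ⟨_, x, rfl⟩ := x
  obtain ⟨_, y, rfl⟩ := y
  exact parseval_toEuclidean hconn x y

/-- An injective linear map in finite dimension has bounded preimages of bounded sets, and a lattice
meets a bounded set in finitely many points. -/
theorem finite_latticePos (hconn : (Γ.graph 1 one_pos).Connected) (r : ℝ) :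
    {l : Γ.lattice | ‖Γ.latticePos l‖ ≤ r}.Finite := by
  obtain ⟨K, -, hK⟩ := LinearMap.exists_antilipschitzWith Γ.toEuclidean
    (toEuclidean_injective hconn)
  have hb := hK.isBounded_preimage (Metric.isBounded_closedBall (x := 0) (r := r))
  have hf := ZSpan.setFinite_inter Γ.basis hb
  refine Set.Finite.of_finite_image (f := Subtype.val) (hf.subset ?_)
    Subtype.val_injective.injOn
  rintro _ ⟨l, hl, rfl⟩
  exact ⟨mem_closedBall_zero_iff.2 hl, l.2⟩

theorem norm_layerPoint (hconn : (Γ.graph 1 one_pos).Connected) (h : ℝ) (p : Fin d → ℝ)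
    (l : Γ.lattice) :
    ‖layerPoint Γ.latticePos h (Γ.toEuclidean.rangeRestrict p) l‖ =
      onePointNorm Γ.hiddenEdge (h • p + h • l.1) := by
  rw [← norm_toEuclidean hconn, ← smul_add, map_smul, map_add]
  rfl

/-- The points of the first layer as points of the Euclidean space of the hidden graph. -/
noncomputable abbrev point₁ (Γ : HexagonalFrame d) (h : ℝ) :
    Γ.lattice → LinearMap.range Γ.toEuclidean :=
  layerPoint Γ.latticePos h (Γ.toEuclidean.rangeRestrict Γ.p₁)

/-- The points of the second layer as points of the Euclidean space of the hidden graph. -/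
noncomputable abbrev point₂ (Γ : HexagonalFrame d) (h : ℝ) :
    Γ.lattice → LinearMap.range Γ.toEuclidean :=
  layerPoint Γ.latticePos h (Γ.toEuclidean.rangeRestrict Γ.p₂)

theorem vertex₁_mem_ball (hconn : (Γ.graph 1 one_pos).Connected) {h r : ℝ} {l : Γ.lattice} :
    (Γ.vertex₁ h l).1 ∈ Γ.ball r ↔ l ∈ ballSet (Γ.point₁ h) r := by
  rw [mem_ballSet, norm_layerPoint hconn]
  rfl

theorem vertex₂_mem_ball (hconn : (Γ.graph 1 one_pos).Connected) {h r : ℝ} {l : Γ.lattice} :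
    (Γ.vertex₂ h l).1 ∈ Γ.ball r ↔ l ∈ ballSet (Γ.point₂ h) r := by
  rw [mem_ballSet, norm_layerPoint hconn]
  rfl

/-- The squared `ℓ²` norm over a ball, split into the two layers. -/
noncomputable def ballMass (h : ℝ) (u : Γ.Vertex h → ℝ) (r : ℝ) : ℝ :=
  mass (ballSet (Γ.point₁ h) r) (fun l => u (Γ.vertex₁ h l)) +
    mass (ballSet (Γ.point₂ h) r) (fun l => u (Γ.vertex₂ h l))

theorem ballMass_nonneg (h : ℝ) (u : Γ.Vertex h → ℝ) (r : ℝ) : 0 ≤ ballMass h u r :=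
  add_nonneg (mass_nonneg _ _) (mass_nonneg _ _)

theorem l2Norm_eq_sqrt_ballMass (hconn : (Γ.graph 1 one_pos).Connected) {h : ℝ} (hh : 0 < h)
    (u : Γ.Vertex h → ℝ) (r : ℝ) : Γ.l2Norm h u r = √(ballMass h u r) := by
  have hf₁ : (ballSet (Γ.point₁ h) r).Finite :=
    finite_ballSet_layerPoint (finite_latticePos hconn) hh _ r
  have hf₂ : (ballSet (Γ.point₂ h) r).Finite :=
    finite_ballSet_layerPoint (finite_latticePos hconn) hh _ r
  let S : Set (Γ.Vertex h) := {x | x.1 ∈ Γ.ball r}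
  have p₁ : ballSet (Γ.point₁ h) r = Γ.vertex₁ h ⁻¹' S :=
    Set.ext fun l => (vertex₁_mem_ball hconn).symm
  have p₂ : ballSet (Γ.point₂ h) r = Γ.vertex₂ h ⁻¹' S :=
    Set.ext fun l => (vertex₂_mem_ball hconn).symm
  have h₁ : (fun l => S.indicator (fun x => u x ^ 2) (Γ.vertex₁ h l)) =
      (ballSet (Γ.point₁ h) r).indicator fun l => u (Γ.vertex₁ h l) ^ 2 := by
    funext l
    rw [p₁]
    exact (Set.indicator_comp_right (g := fun x => u x ^ 2) (Γ.vertex₁ h)).symm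
  have h₂ : (fun l => S.indicator (fun x => u x ^ 2) (Γ.vertex₂ h l)) =
      (ballSet (Γ.point₂ h) r).indicator fun l => u (Γ.vertex₂ h l) ^ 2 := by
    funext l
    rw [p₂]
    exact (Set.indicator_comp_right (g := fun x => u x ^ 2) (Γ.vertex₂ h)).symm
  have hsum : ∑' x : S, u x.1 ^ 2 = ballMass h u r := by
    rw [tsum_subtype S fun x => u x ^ 2, ← (vertexEquiv hh).tsum_eq, Summable.tsum_sum]
    · simp only [vertexEquiv_inl, vertexEquiv_inr, h₁, h₂]
      rfl
    · simp only [Function.comp_def, vertexEquiv_inl, h₁]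
      exact summable_indicator hf₁ _
    · simp only [Function.comp_def, vertexEquiv_inr, h₂]
      exact summable_indicator hf₂ _
  rw [l2Norm, ← hsum]
  rfl

theorem l2Norm_mono (hconn : (Γ.graph 1 one_pos).Connected) {h : ℝ} (hh : 0 < h)
    (u : Γ.Vertex h → ℝ) {r s : ℝ} (hrs : r ≤ s) : Γ.l2Norm h u r ≤ Γ.l2Norm h u s := by
  rw [l2Norm_eq_sqrt_ballMass hconn hh, l2Norm_eq_sqrt_ballMass hconn hh]
  refine Real.sqrt_le_sqrt (add_le_add ?_ ?_)
  · exact mass_mono (fun l (hl : _ ≤ _) => hl.trans hrs)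
      (finite_ballSet_layerPoint (finite_latticePos hconn) hh _ s) _
  · exact mass_mono (fun l (hl : _ ≤ _) => hl.trans hrs)
      (finite_ballSet_layerPoint (finite_latticePos hconn) hh _ s) _

theorem exists_ballMass_estimate (hconn : (Γ.graph 1 one_pos).Connected) (M : ℝ) :
    ∃ K ε : ℝ, 1 ≤ K ∧ 0 < ε ∧ ε ≤ 1 ∧ ∀ (h : ℝ) (hh : 0 < h) (τ : ℝ), 1 ≤ ε * τ → τ * h ≤ ε →
      ∀ V u : Γ.Vertex h → ℝ, (∀ x, |V x| ≤ M) →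
        (∀ x : Γ.Vertex h, x.1 ∈ Γ.ball 4 → Γ.schrodinger h hh V u x = 0) →
        ballMass h u 1 ≤ K * (Real.exp (2 * τ) * ballMass h u (1 / 2) +
          Real.exp (-(2 * τ * (unitWeight - outerWeight))) * ballMass h u 2) := by
  obtain ⟨K, ε, hK, hε, hε1, H⟩ := exists_two_layer_estimate (e := Γ.latticeEdge)
    (parseval_latticePos hconn) (finite_latticePos hconn) (Γ.toEuclidean.rangeRestrict Γ.p₁)
    (Γ.toEuclidean.rangeRestrict Γ.p₂) M
  refine ⟨K, ε, hK, hε, hε1, fun h hh τ hτ hτh V u hV hu => ?_⟩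
  refine H h τ hh hτ hτh (fun l => u (Γ.vertex₁ h l)) (fun l => u (Γ.vertex₂ h l))
    (fun l => V (Γ.vertex₁ h l)) (fun l => V (Γ.vertex₂ h l)) (fun l => hV _) (fun l => hV _)
    (fun l hl => ?_) (fun l hl => ?_)
  · rw [← laplacian_vertex₁ hh]
    exact laplacian_eq_of_schrodinger hh (hu _ ((vertex₁_mem_ball hconn).2 hl))
  · rw [← laplacian_vertex₂ hh]
    exact laplacian_eq_of_schrodinger hh (hu _ ((vertex₂_mem_ball hconn).2 hl))

theorem exists_three_balls_exp (hconn : (Γ.graph 1 one_pos).Connected) (M : ℝ) :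
    ∃ δ₀ c₂ τ₀ C : ℝ, 0 < δ₀ ∧ δ₀ < 1 ∧ 0 < c₂ ∧ 1 < τ₀ ∧ 1 < C ∧
      ∀ (h : ℝ) (hh : 0 < h), ∀ τ : ℝ, τ₀ < τ → τ < δ₀ * h⁻¹ →
      ∀ V u : Γ.Vertex h → ℝ, (∀ x, |V x| ≤ M) →
        (∀ x : Γ.Vertex h, x.1 ∈ Γ.ball 4 → Γ.schrodinger h hh V u x = 0) →
        Γ.l2Norm h u 1 ≤
          C * (Real.exp τ * Γ.l2Norm h u (1 / 2) + Real.exp (-c₂ * τ) * Γ.l2Norm h u 2) := by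
  obtain ⟨K, ε, hK, hε, hε1, H⟩ := exists_ballMass_estimate hconn M
  -- Halving `ε` makes `δ₀` strictly less than 1; `1 + 1 / ε` ensures both `1 ≤ ε * τ` and `τ₀ > 1`.
  -- After taking square roots, `K ≤ (K + 1) ^ 2` and `a² + b² ≤ (a + b)²` suffice.
  refine ⟨ε / 2, unitWeight - outerWeight, 1 + 1 / ε, K + 1, by positivity, by linarith,
    sub_pos.2 outerWeight_lt_unitWeight, by linarith [one_div_pos.2 hε], by linarith, ?_⟩
  intro h hh τ hτ hτh V u hV hu
  have h1 : 1 ≤ ε * τ := by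
    have := mul_le_mul_of_nonneg_left hτ.le hε.le
    rw [mul_add, mul_one_div_cancel hε.ne'] at this
    linarith
  have h2 : τ * h ≤ ε := by
    have := mul_lt_mul_of_pos_right hτh hh
    rw [mul_assoc, inv_mul_cancel₀ hh.ne'] at this
    linarith
  have h3 := H h hh τ h1 h2 V u hV hu
  rw [l2Norm_eq_sqrt_ballMass hconn hh, l2Norm_eq_sqrt_ballMass hconn hh,
    l2Norm_eq_sqrt_ballMass hconn hh]
  set c := unitWeight - outerWeight
  set N₁ := ballMass h u 1
  have ha := ballMass_nonneg h u (1 / 2)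
  have hb := ballMass_nonneg h u 2
  set a := ballMass h u (1 / 2)
  set b := ballMass h u 2
  set R := Real.exp τ * √a + Real.exp (-c * τ) * √b with hR
  have hRnn : 0 ≤ R := by positivity
  have h4 : Real.exp (2 * τ) * a + Real.exp (-(2 * τ * c)) * b ≤ R ^ 2 := by
    have e1 : Real.exp (2 * τ) * a = (Real.exp τ * √a) ^ 2 := by
      rw [mul_pow, Real.sq_sqrt ha, ← Real.exp_nat_mul]
      norm_num
    have e2 : Real.exp (-(2 * τ * c)) * b = (Real.exp (-c * τ) * √b) ^ 2 := by
      rw [mul_pow, Real.sq_sqrt hb, ← Real.exp_nat_mul]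
      congr 2
      push_cast
      ring
    rw [e1, e2, hR]
    have := mul_nonneg (mul_nonneg (Real.exp_nonneg τ) (Real.sqrt_nonneg a))
      (mul_nonneg (Real.exp_nonneg (-c * τ)) (Real.sqrt_nonneg b))
    nlinarith
  refine Real.sqrt_le_iff.2 ⟨by positivity, h3.trans ?_⟩
  rw [mul_pow]
  exact mul_le_mul (by nlinarith) h4 (by positivity) (by positivity)

end HexagonalFrame

/-- Optimizing the exponential parameter in an inequality `N ≤ C (e^{c₁ τ} a + e^{-c₂ τ} b)`. -/
theorem le_rpow_mul_rpow_add_of_forall_exp {N a b c₁ c₂ C τ₀ T : ℝ} (hc₁ : 0 < c₁) (hc₂ : 0 < c₂)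
    (hC : 1 ≤ C) (ha : 0 ≤ a) (hb : 0 ≤ b) (hNb : N ≤ b) (hT : τ₀ < T)
    (H : ∀ τ, τ₀ < τ → τ ≤ T → N ≤ C * (Real.exp (c₁ * τ) * a + Real.exp (-c₂ * τ) * b)) :
    N ≤ (2 * C + Real.exp (c₂ * τ₀)) *
      (a ^ (c₂ / (c₁ + c₂)) * b ^ (1 - c₂ / (c₁ + c₂)) + Real.exp (-c₂ * T) * b) := by
  have hc : 0 < c₁ + c₂ := by positivity
  set α := c₂ / (c₁ + c₂) with hα
  have hX : 0 ≤ a ^ α * b ^ (1 - α) := by positivity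
  have hY : 0 ≤ Real.exp (-c₂ * T) * b := by positivity
  have hE := Real.exp_pos (c₂ * τ₀)
  -- The two exponentials balance at `s = log (b / a) / (c₁ + c₂)`. In the first case the balance
  -- lies at or beyond `T` (or `a` vanishes), and `τ = T` is used.
  rcases le_or_gt (Real.exp ((c₁ + c₂) * T) * a) b with hab | hab
  · have h1 : Real.exp (c₁ * T) * a ≤ Real.exp (-c₂ * T) * b := by
      have := mul_le_mul_of_nonneg_left hab (Real.exp_nonneg (-c₂ * T))
      rwa [← mul_assoc, ← Real.exp_add, show -c₂ * T + (c₁ + c₂) * T = c₁ * T by ring] at this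
    calc N ≤ C * (Real.exp (c₁ * T) * a + Real.exp (-c₂ * T) * b) := H T hT le_rfl
      _ ≤ 2 * C * (Real.exp (-c₂ * T) * b) := by
        have := mul_le_mul_of_nonneg_left h1 (show 0 ≤ C by linarith)
        linarith
      _ ≤ _ := mul_le_mul (by linarith) (by linarith) hY (by positivity)
  · have ha' : 0 < a := by
      rcases ha.eq_or_lt with h0 | h0
      · rw [← h0, mul_zero] at hab
        linarith
      · exact h0
    -- The case `b = 0` is settled by `N ≤ b`, so that logarithms may be taken.
    rcases hb.eq_or_lt with h0 | hb'
    · rw [← h0] at hNb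
      exact hNb.trans (by positivity)
    have hlog : Real.log b < (c₁ + c₂) * T + Real.log a := by
      have := Real.log_lt_log hb' hab
      rwa [Real.log_mul (Real.exp_ne_zero _) ha'.ne', Real.log_exp] at this
    set s := (Real.log b - Real.log a) / (c₁ + c₂) with hs
    have hsT : s < T := by
      rw [hs, div_lt_iff₀ hc]
      linarith
    -- At `s` both terms equal the geometric mean of `a` and `b` with exponents `α` and `1 - α`.
    have hprod : a ^ α * b ^ (1 - α) = Real.exp (-c₂ * s) * b := by
      rw [Real.rpow_def_of_pos ha', Real.rpow_def_of_pos hb', ← Real.exp_add]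
      nth_rewrite 2 [← Real.exp_log hb']
      rw [← Real.exp_add]
      congr 1
      rw [hs, hα]
      field_simp
      ring
    have hprod' : a ^ α * b ^ (1 - α) = Real.exp (c₁ * s) * a := by
      rw [Real.rpow_def_of_pos ha', Real.rpow_def_of_pos hb', ← Real.exp_add]
      nth_rewrite 2 [← Real.exp_log ha']
      rw [← Real.exp_add]
      congr 1
      rw [hs, hα]
      field_simp
      ring
    rcases lt_or_ge τ₀ s with hτ | hτ
    · have h1 := H s hτ hsT.le
      rw [← hprod, ← hprod'] at h1
      calc N ≤ 2 * C * (a ^ α * b ^ (1 - α)) := by linarith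
        _ ≤ _ := mul_le_mul (by linarith) (by linarith) hX (by positivity)
    -- A balance point `s ≤ τ₀` is not admissible; then `N ≤ b` is used directly, at the cost of the
    -- factor `exp (c₂ * τ₀)`.
    · have h1 : b ≤ Real.exp (c₂ * τ₀) * (a ^ α * b ^ (1 - α)) := by
        rw [hprod, ← mul_assoc, ← Real.exp_add]
        refine le_mul_of_one_le_left hb (Real.one_le_exp ?_)
        nlinarith
      refine (hNb.trans h1).trans ?_
      exact mul_le_mul (by linarith) (by linarith) hX (by positivity)

theorem theorem5p2 {d : ℕ} (Γ : HexagonalGraph d) (M : ℝ) :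
    (∃ h₀ δ₀ c₁ c₂ τ₀ C : ℝ, 0 < h₀ ∧ h₀ < 1 ∧ 0 < δ₀ ∧ δ₀ < 1 ∧ 0 < c₁ ∧ 0 < c₂ ∧ 1 < τ₀ ∧ 1 < C ∧
      ∀ (h : ℝ) (hh : 0 < h), h < h₀ → ∀ τ : ℝ, τ₀ < τ → τ < δ₀ * h⁻¹ →
      ∀ V u : Γ.Vertex h → ℝ, (∀ x, |V x| ≤ M) →
        (∀ x : Γ.Vertex h, x.1 ∈ Γ.ball 4 → Γ.schrodinger h hh V u x = 0) →
        Γ.l2Norm h u 1 ≤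
          C * (Real.exp (c₁ * τ) * Γ.l2Norm h u (1 / 2) +
            Real.exp (-c₂ * τ) * Γ.l2Norm h u 2)) ∧
    (∃ α c₀ h₀ D : ℝ, 0 < α ∧ α < 1 ∧ 0 < c₀ ∧ 0 < h₀ ∧ h₀ < 1 ∧ 1 < D ∧
      ∀ (h : ℝ) (hh : 0 < h), h < h₀ →
      ∀ V u : Γ.Vertex h → ℝ, (∀ x, |V x| ≤ M) →
        (∀ x : Γ.Vertex h, x.1 ∈ Γ.ball 4 → Γ.schrodinger h hh V u x = 0) →
        Γ.l2Norm h u 1 ≤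
          D * (Γ.l2Norm h u (1 / 2) ^ α * Γ.l2Norm h u 2 ^ (1 - α) +
            Real.exp (-c₀ * h⁻¹) * Γ.l2Norm h u 2)) := by
  obtain ⟨δ₀, c₂, τ₀, C, hδ, hδ1, hc₂, hτ₀, hC, H⟩ :=
    HexagonalFrame.exists_three_balls_exp Γ.connected M
  -- The value 1/2 of `h₀` is arbitrary, since the range of `τ` already restricts `h`.
  refine ⟨⟨1 / 2, δ₀, 1, c₂, τ₀, C, by norm_num, by norm_num, hδ, hδ1, one_pos, hc₂, hτ₀, hC,
    fun h hh _ τ hτ hτh V u hV hu => ?_⟩, ?_⟩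
  · rw [one_mul]
    exact H h hh τ hτ hτh V u hV hu
  · have hα : 0 < c₂ / (1 + c₂) := by positivity
    have hh₀ : δ₀ / (2 * τ₀) < 1 := by
      rw [div_lt_one (by positivity)]
      linarith
    -- The optimization runs up to `T = δ₀ / (2 h)`; the factor 1/2 keeps `τ = T` strictly inside
    -- the range. The condition `h < δ₀ / (2 τ₀)` means `τ₀ < T`, and `c₀ = c₂ δ₀ / 2` comes from
    -- `exp (-c₂ T)`.
    refine ⟨c₂ / (1 + c₂), c₂ * (δ₀ / 2), δ₀ / (2 * τ₀), 2 * C + Real.exp (c₂ * τ₀), hα, ?_,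
      by positivity, by positivity, hh₀, by linarith [Real.exp_pos (c₂ * τ₀)],
      fun h hh hlt V u hV hu => ?_⟩
    · rw [div_lt_one (by positivity)]
      linarith
    have hinv : 0 < h⁻¹ := inv_pos.2 hh
    have hT : τ₀ < δ₀ / 2 * h⁻¹ := by
      rw [lt_div_iff₀ (by positivity)] at hlt
      rw [← div_eq_mul_inv, lt_div_iff₀ hh]
      linarith
    have key := le_rpow_mul_rpow_add_of_forall_exp (N := Γ.l2Norm h u 1)
      (a := Γ.l2Norm h u (1 / 2)) (b := Γ.l2Norm h u 2) one_pos hc₂ hC.le (Real.sqrt_nonneg _)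
      (Real.sqrt_nonneg _) (HexagonalFrame.l2Norm_mono Γ.connected hh u one_le_two) hT
      (fun τ hτ hτT => by
        rw [one_mul]
        exact H h hh τ hτ (hτT.trans_lt (by nlinarith)) V u hV hu)
    rwa [show -c₂ * (δ₀ / 2 * h⁻¹) = -(c₂ * (δ₀ / 2)) * h⁻¹ by ring] at key
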